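/- Let $s\in(0,1)$, $m>0$, $\alpha\in(0,3)$ and $p\in\left(1+\frac{\alpha}{3},\frac{3+\alpha}{3-2s}\right)$. Let $A:\mathbb{R}^3\to\mathbb{R}^3$ be a vector field with locally bounded gradient (it is enough that $A$ is locally Lipschitz) such that $$g(x-y)\cdot A\left(g\tfrac{x+y}{2}\right)=(x-y)\cdot A\left(\tfrac{x+y}{2}\right)\qquad\text{for all }x,y\in\mathbb{R}^3,\ g\in O(3).$$ Put $\nu=\frac{3+2s}{2}$, $C_s=\frac{s\,2^{(2s-1)/2}}{\pi^{3/2}\Gamma(1-s)}$, let $\mathcal{K}_\nu(\zeta)=\frac12\left(\frac{\zeta}{2}\right)^{\nu}\int_0^{\infty}e^{-\zeta^2/(4t)-t}\,t^{-1-\nu}\,dt$ ($\zeta>0$) be the modified Bessel function, and write $\delta_A u(x,y)=e^{-i(x-y)\cdot A\left(\frac{x+y}{2}\right)}u(x)-u(y)$. For measurable $u,v:\mathbb{R}^3\to\mathbb{C}$ (identified when equal a.e.) let $$(u,v)_{A,s}=\frac{C_s}{2}m^{\nu}\,\Re\int_{\mathbb{R}^3\times\mathbb{R}^3}\frac{\delta_Au(x,y)\,\overline{\delta_Av(x,y)}}{|x-y|^{\nu}}\mathcal{K}_{\nu}(m|x-y|)\,dx\,dy+m^{2s}\,\Re\int_{\mathbb{R}^3}u\overline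 v\,dx,\qquad \|u\|_{A,s}^2=(u,u)_{A,s}.$$ Let $H^s_A$ be the closure of $C_c^\infty(\mathbb{R}^3,\mathbb{C})$ in $\{u:\|u\|_{A,s}<\infty\}$, and let $H^s_{A,\mathrm{rad}}$ be its subspace of radially symmetric functions. Let $$I_\alpha(x)=\pi^{3/2}2^\alpha\frac{\Gamma(\alpha/2)}{\Gamma((3-\alpha)/2)}\frac{1}{|x|^{3-\alpha}},\qquad \mathcal{D}(u)=\int_{\mathbb{R}^3}(I_\alpha*|u|^p)|u|^p\,dx,\qquad \tau_{A,\mathrm{rad}}=\inf_{u\in H^s_{A,\mathrm{rad}}\setminus\{0\}}\frac{\|u\|_{A,s}^2}{\mathcal{D}(u)^{1/p}}.$$ Then $0<\tau_{A,\mathrm{rad}}<\infty$, and $\tau_{A,\mathrm{rad}}$ is achieved: there is $u\in H^s_{A,\mathrm{rad}}\setminus\{0\}$ with $\mathcal{D}(u)=1$ and $\|u\|_{A,s}^2=\tau_{A,\mathrm{rad}}$. Moreover, for every $u\in H^s_{A,\mathrm{rad}}\setminus\{0\}$ at which the infimum is attained there is $t>0$ such that the nontrivial radial function $w=tu\in H^s_{A,\mathrm{rad}}$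 is a weak solution of the magnetic pseudorelativistic Choquard equation $$(-\Delta+m^2)^s_A w=(I_\alpha*|w|^p)|w|^{p-2}w\quad\text{in }\mathbb{R}^3,$$ that is, $I_\alpha*|w|^p<\infty$ a.e. and, for every $v\in H^s_A$, the function $(I_\alpha*|w|^p)|w|^{p-2}w\,\overline v$ is integrable and $(w,v)_{A,s}=\Re\int_{\mathbb{R}^3}(I_\alpha*|w|^p)|w|^{p-2}w\,\overline v\,dx$. -/

import Mathlib

open MeasureTheory Set
open scoped ENNReal

noncomputable section

namespace MagneticChoquard

/-- Euclidean space `ℝ³`. -/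
abbrev R3 : Type := EuclideanSpace ℝ (Fin 3)

/-- The modified Bessel function `K_ν(ζ)` of the third kind (Macdonald function), for `ζ > 0`,
through its integral representation `½ (ζ/2)^ν ∫₀^∞ exp(-ζ²/(4t) - t) t^(-1-ν) dt`. -/
def besselK (ν ζ : ℝ) : ℝ :=
  (1 / 2) * (ζ / 2) ^ ν * ∫ t in Ioi (0 : ℝ), Real.exp (-(ζ ^ 2 / (4 * t)) - t) * t ^ (-1 - ν)

/-- The normalizing constant `C_s = s 2^((2s-1)/2) / (π^(3/2) Γ(1-s))`. -/
def constC (s : ℝ) : ℝ :=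
  s * 2 ^ ((2 * s - 1) / 2) / (Real.pi ^ (3 / 2 : ℝ) * Real.Gamma (1 - s))

/-- The kernel `K_{(3+2s)/2}(m|z|) / |z|^((3+2s)/2)`. -/
def kernel (s m : ℝ) (z : R3) : ℝ :=
  besselK ((3 + 2 * s) / 2) (m * ‖z‖) / ‖z‖ ^ ((3 + 2 * s) / 2)

/-- The magnetic difference `exp(-i (x-y)·A((x+y)/2)) u(x) - u(y)`. -/
def magDiff (A : R3 → R3) (u : R3 → ℂ) (x y : R3) : ℂ :=
  Complex.exp (-(Complex.I * ((inner ℝ (x - y) (A ((1 / 2 : ℝ) • (x + y))) : ℝ) : ℂ))) * u x - u y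

/-- The real scalar product `(u,v)_{A,s}`. -/
def scalarProduct (s m : ℝ) (A : R3 → R3) (u v : R3 → ℂ) : ℝ :=
  constC s / 2 * m ^ ((3 + 2 * s) / 2) *
      (∫ z : R3 × R3, magDiff A u z.1 z.2 * (starRingEnd ℂ) (magDiff A v z.1 z.2) *
        ((kernel s m (z.1 - z.2) : ℝ) : ℂ)).re
    + m ^ (2 * s) * (∫ x : R3, u x * (starRingEnd ℂ) (v x)).re

/-- The squared norm `‖u‖_{A,s}² = (u,u)_{A,s}`, with value `∞` when the integrals diverge. -/
def normSq (s m : ℝ) (A : R3 → R3) (u : R3 → ℂ) : ℝ≥0∞ :=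
  ENNReal.ofReal (constC s / 2 * m ^ ((3 + 2 * s) / 2)) *
      (∫⁻ z : R3 × R3, ‖magDiff A u z.1 z.2‖ₑ ^ 2 * ENNReal.ofReal (kernel s m (z.1 - z.2)))
    + ENNReal.ofReal (m ^ (2 * s)) * ∫⁻ x : R3, ‖u x‖ₑ ^ 2

/-- Functions of finite norm: the space in which the test functions are completed. -/
def FiniteNorm (s m : ℝ) (A : R3 → R3) (u : R3 → ℂ) : Prop :=
  AEStronglyMeasurable u volume ∧ normSq s m A u < ∞

/-- The magnetic Sobolev space `H^s_A(ℝ³,ℂ)`: the closure of `C_c^∞(ℝ³,ℂ)` in the space of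
functions of finite norm (functions are understood up to equality almost everywhere). -/
def HsA (s m : ℝ) (A : R3 → R3) : Set (R3 → ℂ) :=
  {u | FiniteNorm s m A u ∧ ∀ ε : ℝ≥0∞, 0 < ε → ∃ φ : R3 → ℂ,
    ContDiff ℝ ((⊤ : ℕ∞) : WithTop ℕ∞) φ ∧ HasCompactSupport φ ∧ normSq s m A (u - φ) < ε}

/-- Radial symmetry of a function class: `u(gx) = u(x)` for almost every `x`, for all `g ∈ O(3)`. -/
def IsRadial (u : R3 → ℂ) : Prop :=
  ∀ g : R3 ≃ₗᵢ[ℝ] R3, (fun x => u (g x)) =ᵐ[volume] u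

/-- The radial subspace `H^s_{A,rad}(ℝ³,ℂ)`. -/
def HsARad (s m : ℝ) (A : R3 → R3) : Set (R3 → ℂ) :=
  {u | u ∈ HsA s m A ∧ IsRadial u}

/-- The vector field `A` has locally bounded gradient, in the weakest usual sense: `A` is locally
Lipschitz, that is, continuous with a locally essentially bounded weak gradient. -/
def HasLocallyBoundedGradient (A : R3 → R3) : Prop := LocallyLipschitz A

/-- Fields that are differentiable with locally bounded classical gradient are included. -/
theorem hasLocallyBoundedGradient_of_fderiv {A : R3 → R3} (hd : Differentiable ℝ A)
    (hb : ∀ R : ℝ, ∃ C : ℝ, ∀ x ∈ Metric.ball (0 : R3) R, ‖fderiv ℝ A x‖ ≤ C) :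
    HasLocallyBoundedGradient A := by
  intro x
  obtain ⟨C, hC⟩ := hb (‖x‖ + 1)
  refine ⟨C.toNNReal, Metric.ball (0 : R3) (‖x‖ + 1), ?_, ?_⟩
  · exact Metric.isOpen_ball.mem_nhds (by simp)
  · refine (convex_ball (0 : R3) (‖x‖ + 1)).lipschitzOnWith_of_nnnorm_fderiv_le
      (𝕜 := ℝ) (fun y _ => hd y) (fun y hy => ?_)
    rw [← NNReal.coe_le_coe, coe_nnnorm]
    exact (hC y hy).trans (Real.le_coe_toNNReal C)

/-- The invariance condition
`g(x-y) · A(g (x+y)/2) = (x-y) · A((x+y)/2)` for all `x, y ∈ ℝ³`, `g ∈ O(3)`. -/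
def InvarianceCondition (A : R3 → R3) : Prop :=
  ∀ (g : R3 ≃ₗᵢ[ℝ] R3) (x y : R3),
    inner ℝ (g (x - y)) (A (g ((1 / 2 : ℝ) • (x + y))))
      = inner ℝ (x - y) (A ((1 / 2 : ℝ) • (x + y)))

/-- The Riesz potential
`I_α(x) = π^(3/2) 2^α Γ(α/2) / Γ((3-α)/2) · 1 / |x|^(3-α)`. -/
def rieszPotential (α : ℝ) (x : R3) : ℝ :=
  Real.pi ^ (3 / 2 : ℝ) * 2 ^ α * (Real.Gamma (α / 2) / Real.Gamma ((3 - α) / 2))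
    * (1 / ‖x‖ ^ (3 - α))

/-- The convolution `(I_α * |u|^p)(x)`, with values in `[0,∞]`. -/
def rieszConv (α p : ℝ) (u : R3 → ℂ) (x : R3) : ℝ≥0∞ :=
  ∫⁻ y : R3, ENNReal.ofReal (rieszPotential α (x - y)) * ‖u y‖ₑ ^ p

/-- The functional `D(u) = ∫ (I_α * |u|^p) |u|^p dx`, with values in `[0,∞]`. -/
def functionalD (α p : ℝ) (u : R3 → ℂ) : ℝ≥0∞ :=
  ∫⁻ x : R3, rieszConv α p u x * ‖u x‖ₑ ^ p

/-- The quotient `G(u) = ‖u‖_{A,s}² / D(u)^(1/p)`. -/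
def functionalG (s m α p : ℝ) (A : R3 → R3) (u : R3 → ℂ) : ℝ≥0∞ :=
  normSq s m A u / functionalD α p u ^ (1 / p)

/-- The radial infimum `τ_{A,rad}` of `G` over `H^s_{A,rad}(ℝ³,ℂ) \ {0}`. -/
def tauRad (s m α p : ℝ) (A : R3 → R3) : ℝ≥0∞ :=
  sInf {c | ∃ u ∈ HsARad s m A, ¬ u =ᵐ[volume] 0 ∧ c = functionalG s m α p A u}

/-- `u` is a weak solution of `(-Δ + m²)_A^s u = (I_α * |u|^p) |u|^(p-2) u` in `ℝ³`:
`u ∈ H^s_A`, the right-hand side is well defined, and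
`(u,v)_{A,s} = Re ∫ (I_α * |u|^p) |u|^(p-2) u v̄ dx` for all `v ∈ H^s_A`, the integral converging
absolutely. -/
def IsWeakSolution (s m α p : ℝ) (A : R3 → R3) (u : R3 → ℂ) : Prop :=
  u ∈ HsA s m A ∧ (∀ᵐ x : R3, rieszConv α p u x < ∞) ∧
    ∀ v ∈ HsA s m A,
      Integrable (fun x : R3 =>
        (((rieszConv α p u x).toReal * ‖u x‖ ^ (p - 2) : ℝ) : ℂ) * u x *
          (starRingEnd ℂ) (v x)) volume ∧
      scalarProduct s m A u v =
        (∫ x : R3, (((rieszConv α p u x).toReal * ‖u x‖ ^ (p - 2) : ℝ) : ℂ) * u x *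
          (starRingEnd ℂ) (v x)).re

end MagneticChoquard

end

open MagneticChoquard

open MeasureTheory Set Filter Topology
open scoped ENNReal

noncomputable section

namespace MagneticChoquard

/-! The minimum is found by the direct method, with compactness supplied by radial symmetry; the
equation then follows from criticality along radial directions and an invariance argument.

Every function estimate rests on two facts. The phase has modulus one, so
$|u(y)|\le|u(x)|+|\delta_Au(x,y)|$ (`enorm_le_add_magDiff`); and the kernel is at most
$C|z|^{-3-2s}$ everywhere and at least $c|z|^{-3-2s}$ for $0<|z|\le1$. Averaging over $B(y,\rho)$
therefore bounds $|u(y)|^2$ by $\rho^{-3}\int_{B(y,\rho)}|u|^2$ plus $\rho^{2s}$ times the energy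
density at $y$. Optimizing in $\rho$ gives $|u(y)|^{2(1+\kappa)}\le C\,Y^{\kappa}(\text{energy
density}+|u(y)|^2)$, where $Y$ measures the local mass (`exists_rpow_le_of_average`). With
$\kappa=2s/(3-2s)$ this integrates to the critical Sobolev inequality (`exists_sobolev`). With
$\kappa=2s/3$ it gives uniform smallness of radial functions at infinity (`exists_tail_le`), because
a unit ball far from the origin has many disjoint rotated copies of the same mass.

Local compactness replaces plain averages by averages transported with the magnetic phase. These are
continuous for weak convergence and differ from $|B|\,u(y)$ by $\int_B\delta_Au$, which the energy
controls (`tendsto_setLIntegral_sq_of_magSum`). Combined with the tail estimate and interpolation,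
bounded, weakly null radial sequences tend to zero in $L^q$ for $2<q<6/(3-2s)$
(`tendsto_lintegral_rpow`).

The Riesz kernel is split at $|z|=1$ into two pieces with different integrability. Young's
inequality then controls $\mathcal D$ by strictly subcritical norms (`exists_riesz_bound`), and
Minkowski's inequality for the measure $I_\alpha(x-y)\,dx\,dy$ shows that the constraint $\mathcal
D=1$ yields $\mathcal D\ge1$ for the weak limit. Pairs $(\delta_Au,u)$ form a closed subspace of a
Hilbert space, which provides weak limits and lower semicontinuity of the norm (`exists_minimizer`).

For the equation, differentiating $\|u+tv\|^2-\tau\,\mathcal D(u+tv)^{1/p}$ at its minimum $t=0$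
gives the Euler–Lagrange identity for radial $v$. The right-hand side is represented by some $w\in
H^s_A$, and invariance of the norm under $O(3)$ forces $w$ to be radial
(`exists_radial_representative`). A radial vector orthogonal to all radial vectors is zero, so the
identity holds for every $v$ (`scalarProduct_eq`). A dilation of $u$ removes the multiplier. -/

/-! ### Two-sided bounds for the Macdonald kernel. -/

/-- The profile `∫₀^∞ exp(-1/(4t) - ζ² t) t^(-1-ν) dt` of the Macdonald function. -/
def besselProfile (ν ζ : ℝ) : ℝ :=
  ∫ t in Ioi (0 : ℝ), Real.exp (-(1 / (4 * t)) - ζ ^ 2 * t) * t ^ (-1 - ν)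

/-- Substituting $t\mapsto\zeta^2t$ isolates the singular power of $\zeta$. The remaining factor is
finite at $\zeta=0$, positive and decreasing, so no Bessel asymptotics are needed. -/
theorem besselK_eq_profile (ν : ℝ) {ζ : ℝ} (hζ : 0 < ζ) :
    besselK ν ζ = (1 / 2) * (ζ / 2) ^ ν * (ζ ^ (-(2 * ν)) * besselProfile ν ζ) := by
  have h := integral_comp_mul_left_Ioi
    (fun t : ℝ => Real.exp (-(ζ ^ 2 / (4 * t)) - t) * t ^ (-1 - ν)) 0 (b := ζ ^ 2) (by positivity)
  rw [mul_zero] at h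
  have h2 : ∫ t in Ioi (0 : ℝ), Real.exp (-(ζ ^ 2 / (4 * (ζ ^ 2 * t))) - ζ ^ 2 * t)
      * (ζ ^ 2 * t) ^ (-1 - ν) = (ζ ^ 2) ^ (-1 - ν) * besselProfile ν ζ := by
    rw [besselProfile, ← integral_const_mul]
    refine setIntegral_congr_fun measurableSet_Ioi fun t ht => ?_
    have ht : 0 < t := ht
    have e : ζ ^ 2 / (4 * (ζ ^ 2 * t)) = 1 / (4 * t) := by field_simp
    rw [e, Real.mul_rpow (by positivity) ht.le]
    ring
  rw [h2, smul_eq_mul] at h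
  have hz : (ζ ^ 2 : ℝ) ≠ 0 := by positivity
  have h3 : ∫ t in Ioi (0 : ℝ), Real.exp (-(ζ ^ 2 / (4 * t)) - t) * t ^ (-1 - ν)
      = ζ ^ 2 * ((ζ ^ 2) ^ (-1 - ν) * besselProfile ν ζ) := by
    rw [h]; field_simp
  rw [besselK, h3]
  have e2 : ζ ^ 2 * (ζ ^ 2) ^ (-1 - ν) = ζ ^ (-(2 * ν)) := by
    rw [← Real.rpow_natCast ζ 2, ← Real.rpow_mul hζ.le, ← Real.rpow_add hζ]
    congr 1; push_cast; ring
  rw [← mul_assoc (ζ ^ 2), e2]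

/-- The inversion $t\mapsto1/t$ turns this into the Gamma-type integrand $y^{\nu-1}e^{-y/4}$. -/
theorem integrableOn_besselProfile_zero {ν : ℝ} (hν : 0 < ν) :
    IntegrableOn (fun t : ℝ => Real.exp (-(1 / (4 * t))) * t ^ (-1 - ν)) (Ioi 0) := by
  have h := (integrableOn_Ioi_comp_rpow_iff (fun y : ℝ => y ^ (ν - 1) * Real.exp (-(1 / 4) * y ^ (1 : ℝ)))
    (p := -1) (by norm_num)).2
    (integrableOn_rpow_mul_exp_neg_mul_rpow (by linarith) one_pos (by norm_num))
  refine h.congr_fun (fun t ht => ?_) measurableSet_Ioi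
  have ht : 0 < t := ht
  simp only [smul_eq_mul, abs_neg, abs_one, one_mul, Real.rpow_one]
  rw [← Real.rpow_mul ht.le, Real.rpow_neg_one, ← mul_assoc, ← Real.rpow_add ht, mul_comm]
  congr 2
  · field_simp
  · ring

theorem integrableOn_besselProfile {ν : ℝ} (hν : 0 < ν) (ζ : ℝ) :
    IntegrableOn (fun t : ℝ => Real.exp (-(1 / (4 * t)) - ζ ^ 2 * t) * t ^ (-1 - ν)) (Ioi 0) := by
  refine Integrable.mono' (integrableOn_besselProfile_zero hν) (by
    refine Measurable.aestronglyMeasurable ?_; fun_prop) ?_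
  filter_upwards [self_mem_ae_restrict measurableSet_Ioi] with t ht
  have ht : 0 < t := ht
  rw [Real.norm_of_nonneg (by positivity)]
  gcongr
  have : 0 ≤ ζ ^ 2 * t := by positivity
  linarith

theorem besselProfile_anti {ν : ℝ} (hν : 0 < ν) {a b : ℝ} (ha : 0 ≤ a) (hab : a ≤ b) :
    besselProfile ν b ≤ besselProfile ν a := by
  refine setIntegral_mono_on (integrableOn_besselProfile hν b) (integrableOn_besselProfile hν a)
    measurableSet_Ioi fun t ht => ?_
  have ht : 0 < t := ht
  gcongr

theorem besselProfile_pos {ν : ℝ} (hν : 0 < ν) (ζ : ℝ) : 0 < besselProfile ν ζ := by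
  have hn : ∀ t ∈ Ioi (0 : ℝ), 0 < Real.exp (-(1 / (4 * t)) - ζ ^ 2 * t) * t ^ (-1 - ν) := by
    intro t ht
    have ht : 0 < t := ht
    positivity
  rw [besselProfile, setIntegral_pos_iff_support_of_nonneg_ae]
  · have : Function.support (fun t : ℝ => Real.exp (-(1 / (4 * t)) - ζ ^ 2 * t) * t ^ (-1 - ν))
        ∩ Ioi 0 = Ioi 0 := by
      refine inter_eq_right.2 fun t ht => (hn t ht).ne'
    rw [this]; simp
  · filter_upwards [self_mem_ae_restrict measurableSet_Ioi] with t ht using (hn t ht).le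
  · exact integrableOn_besselProfile hν ζ

theorem kernel_eq_profile (s : ℝ) {m : ℝ} (hm : 0 < m) {z : R3} (hz : z ≠ 0) :
    kernel s m z = (1 / 2 * (m / 2) ^ ((3 + 2 * s) / 2) * m ^ (-(3 + 2 * s)))
      * (‖z‖ ^ (-(3 + 2 * s)) * besselProfile ((3 + 2 * s) / 2) (m * ‖z‖)) := by
  have hz' : 0 < ‖z‖ := norm_pos_iff.2 hz
  rw [kernel, besselK_eq_profile _ (by positivity)]
  have e1 : (m * ‖z‖ / 2) ^ ((3 + 2 * s) / 2) = (m / 2) ^ ((3 + 2 * s) / 2) * ‖z‖ ^ ((3 + 2 * s) / 2) := by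
    rw [← Real.mul_rpow (by positivity) hz'.le]; congr 1; ring
  rw [e1, Real.mul_rpow hm.le hz'.le, show -(2 * ((3 + 2 * s) / 2)) = -(3 + 2 * s) by ring]
  have : ‖z‖ ^ ((3 + 2 * s) / 2) ≠ 0 := by positivity
  field_simp

theorem kernel_nonneg {s m : ℝ} (hs : 0 < s) (hm : 0 < m) (z : R3) : 0 ≤ kernel s m z := by
  rcases eq_or_ne z 0 with rfl | hz
  -- At the origin the denominator is $0^\nu=0$, so division by zero gives the kernel the value $0$.
  · have : (3 + 2 * s) / 2 ≠ 0 := by positivity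
    simp [kernel, Real.zero_rpow this]
  · rw [kernel_eq_profile s hm hz]
    have := besselProfile_pos (ν := (3 + 2 * s) / 2) (by positivity) (m * ‖z‖)
    positivity

theorem kernel_map (s m : ℝ) (g : R3 ≃ₗᵢ[ℝ] R3) (z : R3) : kernel s m (g z) = kernel s m z := by
  simp [kernel]

/-- The profile is largest at $0$, which gives the constant. -/
theorem exists_kernel_le {s m : ℝ} (hs : 0 < s) (hm : 0 < m) :
    ∃ C : ℝ, 0 < C ∧ ∀ z : R3, kernel s m z ≤ C * ‖z‖ ^ (-(3 + 2 * s)) := by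
  have h0 := besselProfile_pos (ν := (3 + 2 * s) / 2) (by positivity) 0
  refine ⟨1 / 2 * (m / 2) ^ ((3 + 2 * s) / 2) * m ^ (-(3 + 2 * s)) *
    besselProfile ((3 + 2 * s) / 2) 0, by positivity, fun z => ?_⟩
  rcases eq_or_ne z 0 with rfl | hz
  · have : (3 + 2 * s) / 2 ≠ 0 := by positivity
    simp only [kernel, norm_zero, Real.zero_rpow this, div_zero]
    positivity
  · rw [kernel_eq_profile s hm hz, mul_assoc _ (besselProfile _ _), mul_comm (besselProfile _ 0)]
    gcongr
    exact besselProfile_anti (by positivity) le_rfl (by positivity)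

/-- For $|z|\le1$ the monotone profile is at least its value at $m$. The origin is excluded because
the kernel vanishes there by convention. -/
theorem exists_le_kernel {s m : ℝ} (hs : 0 < s) (hm : 0 < m) :
    ∃ c : ℝ, 0 < c ∧ ∀ z : R3, z ≠ 0 → ‖z‖ ≤ 1 → c * ‖z‖ ^ (-(3 + 2 * s)) ≤ kernel s m z := by
  have h0 := besselProfile_pos (ν := (3 + 2 * s) / 2) (by positivity) m
  refine ⟨1 / 2 * (m / 2) ^ ((3 + 2 * s) / 2) * m ^ (-(3 + 2 * s)) *
    besselProfile ((3 + 2 * s) / 2) m, by positivity, fun z hz hz1 => ?_⟩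
  rw [kernel_eq_profile s hm hz, mul_assoc _ (besselProfile _ _), mul_comm (besselProfile _ m)]
  gcongr
  exact besselProfile_anti (by positivity) (by positivity) (by nlinarith)

theorem measurable_besselK (ν : ℝ) : Measurable (besselK ν) := by
  have : StronglyMeasurable fun ζ : ℝ => ∫ t in Ioi (0 : ℝ),
      Real.exp (-(ζ ^ 2 / (4 * t)) - t) * t ^ (-1 - ν) := by
    refine StronglyMeasurable.integral_prod_right (ν := volume.restrict (Ioi (0 : ℝ)))
      (f := fun ζ t => Real.exp (-(ζ ^ 2 / (4 * t)) - t) * t ^ (-1 - ν)) ?_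
    refine Measurable.stronglyMeasurable ?_
    unfold Function.uncurry
    fun_prop
  unfold besselK
  have := this.measurable
  fun_prop

theorem measurable_kernel (s m : ℝ) : Measurable (kernel s m) := by
  unfold kernel
  have := measurable_besselK ((3 + 2 * s) / 2)
  fun_prop

theorem constC_pos {s : ℝ} (hs : 0 < s) (hs' : s < 1) : 0 < constC s := by
  have := Real.Gamma_pos_of_pos (show 0 < 1 - s by linarith)
  unfold constC
  positivity

/-- Integrability of powers of the norm near the origin. -/
theorem lintegral_norm_rpow_ball_lt_top {a : ℝ} (ha : -3 < a) :
    ∫⁻ z : R3, (Metric.ball (0 : R3) 1).indicator (fun z => ENNReal.ofReal (‖z‖ ^ a)) z < ∞ := by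
  have h : Integrable (fun z : R3 => (Iio (1 : ℝ)).indicator (fun r => r ^ a) ‖z‖) volume := by
    rw [integrable_fun_norm_addHaar (μ := (volume : Measure R3))
      (f := (Iio (1 : ℝ)).indicator (fun r => r ^ a))]
    have h1 : IntegrableOn (fun r : ℝ => r ^ (a + 2)) (Ioo 0 1) :=
      (intervalIntegral.integrableOn_Ioo_rpow_iff one_pos).2 (by linarith)
    have h2 : Integrable ((Ioo (0 : ℝ) 1).indicator fun r : ℝ => r ^ (a + 2)) :=
      (integrable_indicator_iff measurableSet_Ioo).2 h1
    refine h2.integrableOn.congr_fun (fun r hr => ?_) measurableSet_Ioi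
    have hr : 0 < r := hr
    by_cases h : r < 1
    · simp [h, hr, Real.rpow_add hr, mul_comm]
    · simp [h]
  have h3 := h.lintegral_lt_top
  refine lt_of_le_of_lt (lintegral_mono fun z => ?_) h3
  by_cases hz : ‖z‖ < 1
  · simp [hz]
  · simp [hz]

/-- Integrability of powers of the norm at infinity. -/
theorem lintegral_norm_rpow_compl_ball_lt_top {a : ℝ} (ha : a < -3) :
    ∫⁻ z : R3, (Metric.ball (0 : R3) 1)ᶜ.indicator (fun z => ENNReal.ofReal (‖z‖ ^ a)) z < ∞ := by
  have h : Integrable (fun z : R3 => (Ici (1 : ℝ)).indicator (fun r => r ^ a) ‖z‖) volume := by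
    rw [integrable_fun_norm_addHaar (μ := (volume : Measure R3))
      (f := (Ici (1 : ℝ)).indicator (fun r => r ^ a))]
    have h1 : IntegrableOn (fun r : ℝ => r ^ (a + 2)) (Ici 1) :=
      (integrableOn_Ici_iff_integrableOn_Ioi).2 (integrableOn_Ioi_rpow_of_lt (by linarith) one_pos)
    have h2 : Integrable ((Ici (1 : ℝ)).indicator fun r : ℝ => r ^ (a + 2)) :=
      (integrable_indicator_iff measurableSet_Ici).2 h1
    refine h2.integrableOn.congr_fun (fun r hr => ?_) measurableSet_Ioi
    have hr : 0 < r := hr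
    by_cases h : 1 ≤ r
    · simp [h, Real.rpow_add hr, mul_comm]
    · simp [h]
  have h3 := h.lintegral_lt_top
  refine lt_of_le_of_lt (lintegral_mono fun z => ?_) h3
  by_cases hz : ‖z‖ < 1
  · simp [hz]
  · simp [not_lt.1 hz]

/-- The kernel integrates `min(|z|², 1)`. -/
theorem lintegral_min_mul_kernel_lt_top {s m : ℝ} (hs : 0 < s) (hs' : s < 1) (hm : 0 < m) :
    ∫⁻ z : R3, ENNReal.ofReal (min (‖z‖ ^ 2) 1) * ENNReal.ofReal (kernel s m z) < ∞ := by
  obtain ⟨C, hC, hk⟩ := exists_kernel_le hs hm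
  have h1 := lintegral_norm_rpow_ball_lt_top (a := -(1 + 2 * s)) (by linarith)
  have h2 := lintegral_norm_rpow_compl_ball_lt_top (a := -(3 + 2 * s)) (by linarith)
  have hb : ∀ z : R3, ENNReal.ofReal (min (‖z‖ ^ 2) 1) * ENNReal.ofReal (kernel s m z) ≤
      ENNReal.ofReal C * ((Metric.ball (0 : R3) 1).indicator
          (fun z => ENNReal.ofReal (‖z‖ ^ (-(1 + 2 * s)))) z
        + (Metric.ball (0 : R3) 1)ᶜ.indicator (fun z => ENNReal.ofReal (‖z‖ ^ (-(3 + 2 * s)))) z) := by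
    intro z
    rw [← ENNReal.ofReal_mul (by positivity)]
    rcases eq_or_ne z 0 with rfl | hz
    · simp
    have hz' : 0 < ‖z‖ := norm_pos_iff.2 hz
    have hk := hk z
    by_cases h : ‖z‖ < 1
    · simp only [mem_ball_zero_iff, h, indicator_of_mem, mem_compl_iff, not_true, not_false_eq_true,
        indicator_of_notMem, add_zero]
      rw [← ENNReal.ofReal_mul hC.le]
      refine ENNReal.ofReal_le_ofReal ?_
      calc min (‖z‖ ^ 2) 1 * kernel s m z ≤ ‖z‖ ^ 2 * (C * ‖z‖ ^ (-(3 + 2 * s))) := by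
            gcongr
            · exact kernel_nonneg hs hm z
            · exact min_le_left _ _
        _ = C * ‖z‖ ^ (-(1 + 2 * s)) := by
            rw [← Real.rpow_natCast, mul_left_comm, ← Real.rpow_add hz']
            congr 2; push_cast; ring
    · simp only [mem_ball_zero_iff, h, indicator_of_mem, mem_compl_iff, not_false_eq_true,
        indicator_of_notMem, zero_add]
      rw [← ENNReal.ofReal_mul hC.le]
      refine ENNReal.ofReal_le_ofReal ?_
      calc min (‖z‖ ^ 2) 1 * kernel s m z ≤ 1 * (C * ‖z‖ ^ (-(3 + 2 * s))) := by
            gcongr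
            · exact kernel_nonneg hs hm z
            · exact min_le_right _ _
        _ = _ := one_mul _
  refine lt_of_le_of_lt (lintegral_mono hb) ?_
  rw [lintegral_const_mul' _ _ ENNReal.ofReal_ne_top, lintegral_add_left]
  · exact ENNReal.mul_lt_top ENNReal.ofReal_lt_top (ENNReal.add_lt_top.2 ⟨h1, h2⟩)
  · exact (by fun_prop : Measurable fun z : R3 => ENNReal.ofReal (‖z‖ ^ (-(1 + 2 * s)))).indicator
      Metric.isOpen_ball.measurableSet

/-! ### The magnetic difference and its energy density. -/

theorem measurable_phase {A : R3 → R3} (hA : Continuous A) :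
    Continuous fun z : R3 × R3 => Complex.exp (-(Complex.I *
      ((inner ℝ (z.1 - z.2) (A ((1 / 2 : ℝ) • (z.1 + z.2))) : ℝ) : ℂ))) := by
  fun_prop

theorem norm_phase (t : ℝ) : ‖Complex.exp (-(Complex.I * (t : ℂ)))‖ = 1 := by
  rw [Complex.norm_exp]; simp

theorem enorm_phase (t : ℝ) : ‖Complex.exp (-(Complex.I * (t : ℂ)))‖ₑ = 1 := by
  rw [← ofReal_norm, norm_phase, ENNReal.ofReal_one]

theorem aestronglyMeasurable_magDiff {A : R3 → R3} (hA : Continuous A) {u : R3 → ℂ}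
    (hu : AEStronglyMeasurable u volume) :
    AEStronglyMeasurable (fun z : R3 × R3 => magDiff A u z.1 z.2) volume := by
  unfold magDiff
  exact ((measurable_phase hA).aestronglyMeasurable.mul
    (hu.comp_quasiMeasurePreserving Measure.quasiMeasurePreserving_fst)).sub
    (hu.comp_quasiMeasurePreserving Measure.quasiMeasurePreserving_snd)

/-- The phase is unimodular. This inequality plays the role of the diamagnetic inequality and makes
the Sobolev and decay constants independent of $A$. -/
theorem enorm_le_add_magDiff (A : R3 → R3) (u : R3 → ℂ) (x y : R3) :
    ‖u y‖ₑ ≤ ‖u x‖ₑ + ‖magDiff A u x y‖ₑ := by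
  have h : u y = Complex.exp (-(Complex.I *
      ((inner ℝ (x - y) (A ((1 / 2 : ℝ) • (x + y))) : ℝ) : ℂ))) * u x - magDiff A u x y := by
    simp [magDiff]
  calc ‖u y‖ₑ ≤ ‖Complex.exp (-(Complex.I *
      ((inner ℝ (x - y) (A ((1 / 2 : ℝ) • (x + y))) : ℝ) : ℂ))) * u x‖ₑ + ‖magDiff A u x y‖ₑ := by
        conv_lhs => rw [h]
        exact enorm_sub_le
    _ = _ := by rw [enorm_mul, enorm_phase, one_mul]

/-- The density `∫ |δ_A u(x,y)|² k(x-y) dx` of the Gagliardo energy. -/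
def energyDensity (s m : ℝ) (A : R3 → R3) (u : R3 → ℂ) (y : R3) : ℝ≥0∞ :=
  ∫⁻ x : R3, ‖magDiff A u x y‖ₑ ^ 2 * ENNReal.ofReal (kernel s m (x - y))

theorem aemeasurable_energy_integrand (s m : ℝ) {A : R3 → R3} (hA : Continuous A) {u : R3 → ℂ}
    (hu : AEStronglyMeasurable u volume) :
    AEMeasurable (fun z : R3 × R3 => ‖magDiff A u z.1 z.2‖ₑ ^ 2 *
      ENNReal.ofReal (kernel s m (z.1 - z.2))) volume := by
  have h1 := (aestronglyMeasurable_magDiff hA hu).enorm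
  have h2 := measurable_kernel s m
  have h3 : Measurable fun z : R3 × R3 => ENNReal.ofReal (kernel s m (z.1 - z.2)) := by fun_prop
  exact (h1.pow_const 2).mul h3.aemeasurable

theorem lintegral_energyDensity (s m : ℝ) {A : R3 → R3} (hA : Continuous A) {u : R3 → ℂ}
    (hu : AEStronglyMeasurable u volume) :
    ∫⁻ y, energyDensity s m A u y = ∫⁻ z : R3 × R3, ‖magDiff A u z.1 z.2‖ₑ ^ 2 *
      ENNReal.ofReal (kernel s m (z.1 - z.2)) := by
  have h := aemeasurable_energy_integrand s m hA hu
  rw [Measure.volume_eq_prod] at h ⊢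
  exact (lintegral_prod_symm _ h).symm

theorem aemeasurable_energyDensity (s m : ℝ) {A : R3 → R3} (hA : Continuous A) {u : R3 → ℂ}
    (hu : AEStronglyMeasurable u volume) : AEMeasurable (energyDensity s m A u) volume := by
  have h := aemeasurable_energy_integrand s m hA hu
  rw [Measure.volume_eq_prod] at h
  exact h.prod_swap.lintegral_prod_right'

theorem exists_energy_le_normSq {s m : ℝ} (hs : 0 < s) (hs' : s < 1) (hm : 0 < m) :
    ∃ C : ℝ, 0 < C ∧ ∀ (A : R3 → R3), Continuous A → ∀ u : R3 → ℂ, AEStronglyMeasurable u volume →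
      ∫⁻ y, (energyDensity s m A u y + ‖u y‖ₑ ^ 2) ≤ ENNReal.ofReal C * normSq s m A u := by
  have hc : 0 < constC s / 2 * m ^ ((3 + 2 * s) / 2) := by
    have := constC_pos hs hs'; positivity
  have hc2 : 0 < m ^ (2 * s) := by positivity
  set a := constC s / 2 * m ^ ((3 + 2 * s) / 2) with ha
  set b := m ^ (2 * s) with hb
  refine ⟨a⁻¹ + b⁻¹, by positivity, fun A hA u hu => ?_⟩
  rw [lintegral_add_left' (aemeasurable_energyDensity s m hA hu), lintegral_energyDensity s m hA hu,
    normSq, ← ha, ← hb]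
  set I := ∫⁻ z : R3 × R3, ‖magDiff A u z.1 z.2‖ₑ ^ 2 * ENNReal.ofReal (kernel s m (z.1 - z.2))
  set J := ∫⁻ x : R3, ‖u x‖ₑ ^ 2
  have h1 : ENNReal.ofReal a⁻¹ * ENNReal.ofReal a = 1 := by
    rw [← ENNReal.ofReal_mul (by positivity), inv_mul_cancel₀ hc.ne', ENNReal.ofReal_one]
  have h2 : ENNReal.ofReal b⁻¹ * ENNReal.ofReal b = 1 := by
    rw [← ENNReal.ofReal_mul (by positivity), inv_mul_cancel₀ hc2.ne', ENNReal.ofReal_one]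
  rw [ENNReal.ofReal_add (by positivity) (by positivity)]
  calc I + J = ENNReal.ofReal a⁻¹ * (ENNReal.ofReal a * I) + ENNReal.ofReal b⁻¹ * (ENNReal.ofReal b * J) := by
        rw [← mul_assoc, ← mul_assoc, h1, h2, one_mul, one_mul]
    _ ≤ (ENNReal.ofReal a⁻¹ + ENNReal.ofReal b⁻¹) * (ENNReal.ofReal a * I)
        + (ENNReal.ofReal a⁻¹ + ENNReal.ofReal b⁻¹) * (ENNReal.ofReal b * J) := by
        gcongr
        · exact le_self_add
        · exact le_add_self
    _ = _ := by ring

/-! ### Pointwise bounds from averages over small balls. -/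

/-- On small balls, mean squares are controlled by the kernel. -/
theorem exists_setLIntegral_sq_le {s m : ℝ} (hs : 0 < s) (hm : 0 < m) :
    ∃ c : ℝ, 0 < c ∧ ∀ (d : R3 → ℝ≥0∞) (y : R3) (ρ : ℝ), 0 < ρ → ρ ≤ 1 →
      ∫⁻ x in Metric.ball y ρ, d x ^ 2 ≤ ENNReal.ofReal (ρ ^ (3 + 2 * s) / c) *
        ∫⁻ x, d x ^ 2 * ENNReal.ofReal (kernel s m (x - y)) := by
  obtain ⟨c, hc, hk⟩ := exists_le_kernel hs hm
  refine ⟨c, hc, fun d y ρ hρ hρ1 => ?_⟩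
  rw [← lintegral_const_mul' _ _ ENNReal.ofReal_ne_top]
  refine le_trans ?_ (setLIntegral_le_lintegral (Metric.ball y ρ) _)
  -- The kernel bound from below fails at $x=y$, a null set.
  have hne : ∀ᵐ x ∂(volume.restrict (Metric.ball y ρ)), x ≠ y :=
    ae_restrict_of_ae (by simp [ae_iff])
  refine lintegral_mono_ae ?_
  filter_upwards [hne, self_mem_ae_restrict Metric.isOpen_ball.measurableSet] with x hx hxb
  have hz : 0 < ‖x - y‖ := norm_pos_iff.2 (sub_ne_zero.2 hx)
  have hzb : ‖x - y‖ < ρ := by rwa [Metric.mem_ball, dist_eq_norm] at hxb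
  have hk1 := hk (x - y) (sub_ne_zero.2 hx) (hzb.le.trans hρ1)
  have h2 : 1 ≤ ρ ^ (3 + 2 * s) / c * kernel s m (x - y) := by
    calc (1 : ℝ) = ρ ^ (3 + 2 * s) / c * (c * ρ ^ (-(3 + 2 * s))) := by
          rw [Real.rpow_neg hρ.le]
          have : ρ ^ (3 + 2 * s) ≠ 0 := by positivity
          field_simp
      _ ≤ ρ ^ (3 + 2 * s) / c * (c * ‖x - y‖ ^ (-(3 + 2 * s))) := by
          gcongr _ * (_ * ?_)
          exact Real.rpow_le_rpow_of_nonpos hz hzb.le (by linarith)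
      _ ≤ _ := by gcongr
  calc d x ^ 2 = d x ^ 2 * 1 := (mul_one _).symm
    _ ≤ d x ^ 2 * ENNReal.ofReal (ρ ^ (3 + 2 * s) / c * kernel s m (x - y)) := by
        gcongr; rwa [ENNReal.one_le_ofReal]
    _ = _ := by rw [ENNReal.ofReal_mul (by positivity)]; ring

theorem volume_ball_eq (y : R3) {ρ : ℝ} (hρ : 0 ≤ ρ) : volume (Metric.ball y ρ) =
    ENNReal.ofReal (ρ ^ 3 * (volume (Metric.ball (0 : R3) 1)).toReal) := by
  rw [Measure.addHaar_ball _ _ hρ, ENNReal.ofReal_mul (by positivity),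
    ENNReal.ofReal_toReal measure_ball_lt_top.ne]
  simp

/-- Averaging over a ball: a value is controlled by the mean square over the ball and the energy. -/
theorem exists_average_bound {s m : ℝ} (hs : 0 < s) (hm : 0 < m) :
    ∃ K : ℝ, 0 < K ∧ ∀ (f d : R3 → ℝ≥0∞) (y : R3) (t : ℝ≥0∞) (ρ : ℝ), 0 < ρ → ρ ≤ 1 →
      AEMeasurable f volume → (∀ x, t ^ 2 ≤ 2 * f x ^ 2 + 2 * d x ^ 2) →
      t ^ 2 ≤ ENNReal.ofReal K * (ENNReal.ofReal (ρ ^ (-3 : ℝ)) * ∫⁻ x in Metric.ball y ρ, f x ^ 2)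
        + ENNReal.ofReal K * (ENNReal.ofReal (ρ ^ (2 * s)) *
          ∫⁻ x, d x ^ 2 * ENNReal.ofReal (kernel s m (x - y))) := by
  obtain ⟨c, hc, hk⟩ := exists_setLIntegral_sq_le hs hm
  set V := (volume (Metric.ball (0 : R3) 1)).toReal with hV
  have hV0 : 0 < V := ENNReal.toReal_pos (Metric.measure_ball_pos _ _ one_pos).ne'
    measure_ball_lt_top.ne
  refine ⟨2 / V + 2 / (c * V), by positivity, fun f d y t ρ hρ hρ1 hf h => ?_⟩
  set I := ∫⁻ x in Metric.ball y ρ, f x ^ 2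
  set G := ∫⁻ x, d x ^ 2 * ENNReal.ofReal (kernel s m (x - y))
  have hvol := volume_ball_eq y hρ.le
  rw [← hV] at hvol
  have h1 : t ^ 2 * ENNReal.ofReal (ρ ^ 3 * V) ≤
      2 * I + 2 * (ENNReal.ofReal (ρ ^ (3 + 2 * s) / c) * G) := by
    calc t ^ 2 * ENNReal.ofReal (ρ ^ 3 * V) = ∫⁻ x in Metric.ball y ρ, t ^ 2 := by
          rw [setLIntegral_const, hvol]
      _ ≤ ∫⁻ x in Metric.ball y ρ, (2 * f x ^ 2 + 2 * d x ^ 2) := lintegral_mono h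
      _ = 2 * I + 2 * ∫⁻ x in Metric.ball y ρ, d x ^ 2 := by
          rw [lintegral_add_left' (((hf.restrict).pow_const 2).const_mul 2),
            lintegral_const_mul' _ _ (by simp), lintegral_const_mul' _ _ (by simp)]
      _ ≤ _ := by
          gcongr
          exact hk d y ρ hρ hρ1
  have hpos : 0 < ρ ^ 3 * V := by positivity
  have h2 : t ^ 2 = ENNReal.ofReal ((ρ ^ 3 * V)⁻¹) * (t ^ 2 * ENNReal.ofReal (ρ ^ 3 * V)) := by
    rw [mul_left_comm, ← ENNReal.ofReal_mul (by positivity), inv_mul_cancel₀ hpos.ne',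
      ENNReal.ofReal_one, mul_one]
  rw [h2]
  calc ENNReal.ofReal ((ρ ^ 3 * V)⁻¹) * (t ^ 2 * ENNReal.ofReal (ρ ^ 3 * V))
      ≤ ENNReal.ofReal ((ρ ^ 3 * V)⁻¹) * (2 * I + 2 * (ENNReal.ofReal (ρ ^ (3 + 2 * s) / c) * G)) := by
        gcongr
    _ = ENNReal.ofReal (2 / V) * (ENNReal.ofReal (ρ ^ (-3 : ℝ)) * I)
        + ENNReal.ofReal (2 / (c * V)) * (ENNReal.ofReal (ρ ^ (2 * s)) * G) := by
        rw [show (2 : ℝ≥0∞) = ENNReal.ofReal 2 by simp, mul_add, ← mul_assoc, ← mul_assoc,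
          ← mul_assoc, ← mul_assoc, ← mul_assoc, ← ENNReal.ofReal_mul (by positivity),
          ← ENNReal.ofReal_mul (by positivity), ← ENNReal.ofReal_mul (by positivity),
          ← ENNReal.ofReal_mul (by positivity)]
        have e3 : ρ ^ (-3 : ℝ) = (ρ ^ 3)⁻¹ := by
          rw [Real.rpow_neg hρ.le]; norm_cast
        have e4 : ρ ^ (3 + 2 * s) = ρ ^ 3 * ρ ^ (2 * s) := by
          rw [Real.rpow_add hρ]; norm_cast
        congr 3
        · rw [e3]; field_simp
        · rw [e4]; field_simp
    _ ≤ _ := by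
        gcongr
        · have : 0 ≤ 2 / (c * V) := by positivity
          linarith
        · have : 0 ≤ 2 / V := by positivity
          linarith

/-- Optimizing the radius of the average. -/
theorem rpow_le_of_forall_average_real {K κ T Y G : ℝ} (hK : 0 < K) (hκ : 0 < κ) (hT : 0 ≤ T)
    (hY : 0 < Y) (hG : 0 ≤ G)
    (h : ∀ σ : ℝ, 0 < σ → σ ≤ 1 → T ≤ K * (σ ^ (-(1 / κ)) * Y) + K * (σ * G)) :
    T ^ (1 + κ) ≤ (2 * K) ^ κ * (2 * K + 1) * (Y ^ κ * (G + T)) := by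
  rcases hT.eq_or_lt with rfl | hT
  · rw [Real.zero_rpow (by linarith)]; positivity
  have hKY : 0 < 2 * K * Y := by positivity
  rw [Real.rpow_add hT, Real.rpow_one]
  have e : (2 * K) ^ κ * Y ^ κ = (2 * K * Y) ^ κ := (Real.mul_rpow (by positivity) hY.le).symm
  suffices T * T ^ κ ≤ (2 * K * Y) ^ κ * ((2 * K + 1) * (G + T)) by
    rw [← e] at this; linarith
  -- The choice $\sigma=(2KY/T)^\kappa$ makes the first term equal to $T/2$, to be absorbed on the
  -- left. If it exceeds $1$, then $T<2KY$ already suffices; this case is the reason for the summand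
  -- $T$ next to $G$ in the conclusion.
  by_cases h1 : 2 * K * Y / T ≤ 1
  · have hq : 0 < 2 * K * Y / T := by positivity
    have h2 := h ((2 * K * Y / T) ^ κ) (by positivity) (Real.rpow_le_one hq.le h1 hκ.le)
    rw [← Real.rpow_mul hq.le, show κ * -(1 / κ) = -1 by field_simp, Real.rpow_neg_one] at h2
    have h3 : K * ((2 * K * Y / T)⁻¹ * Y) = T / 2 := by field_simp
    rw [h3] at h2
    have h4 : T ≤ 2 * K * ((2 * K * Y / T) ^ κ * G) := by linarith
    calc T * T ^ κ ≤ 2 * K * ((2 * K * Y / T) ^ κ * G) * T ^ κ := by gcongr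
      _ = (2 * K * Y) ^ κ * (2 * K * G) := by
          rw [Real.div_rpow hKY.le hT.le]
          have : T ^ κ ≠ 0 := by positivity
          field_simp
      _ ≤ _ := by gcongr <;> linarith
  · rw [not_le, one_lt_div hT] at h1
    calc T * T ^ κ ≤ T * (2 * K * Y) ^ κ := by gcongr
      _ = (2 * K * Y) ^ κ * (1 * T) := by ring
      _ ≤ _ := by gcongr <;> linarith

theorem rpow_le_of_forall_average {K κ : ℝ} (hK : 0 < K) (hκ : 0 < κ) {T Y G : ℝ≥0∞} (hT : T ≠ ∞)
    (hY : Y ≠ 0) (hY' : Y ≠ ∞)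
    (h : ∀ σ : ℝ, 0 < σ → σ ≤ 1 → T ≤ ENNReal.ofReal K * (ENNReal.ofReal (σ ^ (-(1 / κ))) * Y)
      + ENNReal.ofReal K * (ENNReal.ofReal σ * G)) :
    T ^ (1 + κ) ≤ ENNReal.ofReal ((2 * K) ^ κ * (2 * K + 1)) * (Y ^ κ * (G + T)) := by
  rcases eq_or_ne G ∞ with rfl | hG
  · rw [top_add, ENNReal.mul_top, ENNReal.mul_top]
    · exact le_top
    · rw [ENNReal.ofReal_ne_zero_iff]; positivity
    · exact (ENNReal.rpow_pos (pos_iff_ne_zero.2 hY) hY').ne'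
  lift T to NNReal using hT
  lift Y to NNReal using hY'
  lift G to NNReal using hG
  have hY0 : (0 : ℝ) < Y := by
    have : Y ≠ 0 := by simpa using hY
    exact_mod_cast pos_iff_ne_zero.2 this
  have key := rpow_le_of_forall_average_real (T := T) (Y := Y) (G := G) hK hκ T.2 hY0 G.2 (by
    intro σ h0 h1
    have := h σ h0 h1
    simp only [← ENNReal.ofReal_coe_nnreal] at this
    rw [← ENNReal.ofReal_mul (by positivity), ← ENNReal.ofReal_mul (by positivity),
      ← ENNReal.ofReal_mul (by positivity), ← ENNReal.ofReal_mul (by positivity),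
      ← ENNReal.ofReal_add (by positivity) (by positivity),
      ENNReal.ofReal_le_ofReal_iff (by positivity)] at this
    exact this)
  simp only [← ENNReal.ofReal_coe_nnreal]
  rw [← ENNReal.ofReal_add (by positivity) (by positivity),
    ENNReal.ofReal_rpow_of_nonneg (by positivity) (by positivity),
    ENNReal.ofReal_rpow_of_nonneg (by positivity) (by positivity),
    ← ENNReal.ofReal_mul (by positivity), ← ENNReal.ofReal_mul (by positivity)]
  exact ENNReal.ofReal_le_ofReal key

theorem ennreal_add_sq_le (a b : ℝ≥0∞) : (a + b) ^ 2 ≤ 2 * a ^ 2 + 2 * b ^ 2 := by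
  have := ENNReal.rpow_add_le_mul_rpow_add_rpow a b (p := 2) (by norm_num)
  rw [← mul_add]
  norm_num at this
  exact_mod_cast this

/-- The optimization in $\sigma=\rho^{2s}$ applied to the averaged bound. The parameter $\kappa$
records how fast the mean square may blow up as $\rho\to0$: critical integrability allows
$\kappa=2s/(3-2s)$, mere mass in the unit ball allows $\kappa=2s/3$. -/
theorem exists_rpow_le_of_average {s m : ℝ} (hs : 0 < s) (hm : 0 < m) :
    ∃ K : ℝ, 0 < K ∧ ∀ (κ : ℝ), 0 < κ → ∀ (f d : R3 → ℝ≥0∞) (y : R3) (Y : ℝ≥0∞),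
      AEMeasurable f volume → f y ≠ ∞ → (∀ x, f y ≤ f x + d x) → Y ≠ 0 → Y ≠ ∞ →
      (∀ ρ : ℝ, 0 < ρ → ρ ≤ 1 → ENNReal.ofReal (ρ ^ (-3 : ℝ)) * ∫⁻ x in Metric.ball y ρ, f x ^ 2
        ≤ ENNReal.ofReal (ρ ^ (-(2 * s / κ))) * Y) →
      (f y ^ 2) ^ (1 + κ) ≤ ENNReal.ofReal ((2 * K) ^ κ * (2 * K + 1)) *
        (Y ^ κ * ((∫⁻ x, d x ^ 2 * ENNReal.ofReal (kernel s m (x - y))) + f y ^ 2)) := by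
  obtain ⟨K, hK, h⟩ := exists_average_bound hs hm
  refine ⟨K, hK, fun κ hκ f d y Y hf hfy hfd hY hY' hav => ?_⟩
  refine rpow_le_of_forall_average hK hκ (by simpa using hfy) hY hY' fun σ hσ hσ1 => ?_
  have hρ : 0 < σ ^ (1 / (2 * s)) := by positivity
  have hρ1 : σ ^ (1 / (2 * s)) ≤ 1 := Real.rpow_le_one hσ.le hσ1 (by positivity)
  have h1 := h f d y (f y) _ hρ hρ1 hf fun x =>
    (pow_le_pow_left₀ (zero_le) (hfd x) 2).trans (ennreal_add_sq_le _ _)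
  have h2 := hav _ hρ hρ1
  rw [← Real.rpow_mul hσ.le _ (2 * s), show 1 / (2 * s) * (2 * s) = 1 by field_simp, Real.rpow_one] at h1
  rw [← Real.rpow_mul hσ.le _ (-(2 * s / κ)), show 1 / (2 * s) * -(2 * s / κ) = -(1 / κ) by
    field_simp] at h2
  refine h1.trans ?_
  gcongr

/-! ### The critical Sobolev inequality. -/

theorem setLIntegral_sq_le {q : ℝ} (hq : 2 < q) {f : R3 → ℝ≥0∞} (hf : AEMeasurable f volume)
    (B : Set R3) :
    ∫⁻ x in B, f x ^ 2 ≤ (∫⁻ x, f x ^ q) ^ (2 / q) * volume B ^ (1 - 2 / q) := by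
  have hc : Real.HolderConjugate (q / 2) (1 - 2 / q)⁻¹ := by
    refine Real.holderConjugate_iff.2 ⟨by linarith, ?_⟩
    rw [inv_inv]; field_simp; ring
  have h := ENNReal.lintegral_mul_le_Lp_mul_Lq (volume.restrict B) hc
    (f := fun x => f x ^ 2) (g := fun _ => 1) ((hf.restrict).pow_const 2) aemeasurable_const
  simp only [Pi.mul_apply, mul_one, ENNReal.one_rpow, lintegral_const, Measure.restrict_apply
    MeasurableSet.univ, univ_inter, one_mul, one_div, inv_inv] at h
  refine h.trans ?_
  rw [inv_div]
  gcongr ?_ ^ _ * _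
  refine (setLIntegral_le_lintegral _ _).trans_eq (lintegral_congr fun x => ?_)
  rw [← ENNReal.rpow_natCast, ← ENNReal.rpow_mul]
  congr 1; push_cast; field_simp

/-- Hölder on $B(y,\rho)$ feeds the critical integral $X$ of $u$ itself into the pointwise bound.
Integrating gives $X\le C X^{2s/3}\|u\|^2$, and dividing by $X^{2s/3}$ leaves $X^{(3-2s)/3}\le
C\|u\|^2$. -/
theorem exists_sobolev {s m : ℝ} (hs : 0 < s) (hs' : s < 1) (hm : 0 < m) :
    ∃ C : ℝ, 0 < C ∧ ∀ (A : R3 → R3), Continuous A → ∀ u : R3 → ℂ, AEStronglyMeasurable u volume →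
      ∫⁻ x, ‖u x‖ₑ ^ (6 / (3 - 2 * s)) ≤ (ENNReal.ofReal C * normSq s m A u) ^ (3 / (3 - 2 * s)) := by
  obtain ⟨K, hK, hav⟩ := exists_rpow_le_of_average hs hm
  obtain ⟨C₁, hC₁, hE⟩ := exists_energy_le_normSq hs hs' hm
  set V := (volume (Metric.ball (0 : R3) 1)).toReal with hV
  have hV0 : 0 < V := ENNReal.toReal_pos (Metric.measure_ball_pos _ _ one_pos).ne'
    measure_ball_lt_top.ne
  have hd : 0 < 3 - 2 * s := by linarith
  set q := 6 / (3 - 2 * s) with hq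
  set κ := 2 * s / (3 - 2 * s) with hκ
  have hκ0 : 0 < κ := by positivity
  have hq2 : 2 < q := by rw [hq, lt_div_iff₀ hd]; linarith
  have hq0 : 0 < q := by linarith
  have hqκ : q = 2 * (1 + κ) := by rw [hq, hκ]; field_simp; ring
  set M := (2 * K) ^ κ * (2 * K + 1) with hM
  have hM0 : 0 < M := by positivity
  clear_value M
  refine ⟨M * (V ^ (2 * s / 3)) ^ κ * C₁, by positivity, fun A hA u hu => ?_⟩
  set N := normSq s m A u
  rcases eq_or_ne N ∞ with hN | hN
  · rw [hN, ENNReal.mul_top, ENNReal.top_rpow_of_pos (by positivity)]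
    · exact le_top
    · rw [ENNReal.ofReal_ne_zero_iff]; positivity
  have hE := hE A hA u hu
  have hL2 : ∫⁻ x, ‖u x‖ₑ ^ 2 < ∞ := by
    refine lt_of_le_of_lt (lintegral_mono fun y => le_add_self) (hE.trans_lt ?_)
    exact ENNReal.mul_lt_top ENNReal.ofReal_lt_top hN.lt_top
  have hpq : ∀ t : ℝ≥0∞, (t ^ 2) ^ (1 + κ) = t ^ q := fun t => by
    rw [← ENNReal.rpow_natCast, ← ENNReal.rpow_mul, hqκ]; norm_num
  -- Dividing by a power of $X$ requires $X<\infty$. The truncation at height $n$ still satisfies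
  -- the difference inequality and has finite $X$, since $f^q\le n^{q-2}|u|^2$; the bound is uniform
  -- in $n$ and passes to the limit by monotone convergence.
  have trunc : ∀ n : ℕ, ∫⁻ x, (min ‖u x‖ₑ n) ^ q ≤
      (ENNReal.ofReal (M * (V ^ (2 * s / 3)) ^ κ * C₁) * N) ^ (3 / (3 - 2 * s)) := by
    intro n
    set f : R3 → ℝ≥0∞ := fun x => min ‖u x‖ₑ n with hf
    have hfm : AEMeasurable f volume := hu.enorm.min aemeasurable_const
    have hfu : ∀ x, f x ≤ ‖u x‖ₑ := fun x => min_le_left _ _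
    have hfn : ∀ x, f x ≤ n := fun x => min_le_right _ _
    set X := ∫⁻ x, f x ^ q with hX
    change X ≤ _
    rcases eq_or_ne X 0 with hX0 | hX0
    · rw [hX0]; exact zero_le
    have hXt : X ≠ ∞ := by
      have h1 : X ≤ ∫⁻ x, (n : ℝ≥0∞) ^ (q - 2) * ‖u x‖ₑ ^ 2 := by
        refine lintegral_mono fun x => ?_
        calc f x ^ q = f x ^ (q - 2) * f x ^ (2 : ℝ) := by
              rw [← ENNReal.rpow_add_of_nonneg _ _ (by linarith) (by norm_num)]; congr 1; ring
          _ ≤ _ := by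
              rw [show (2 : ℝ) = (2 : ℕ) by norm_num, ENNReal.rpow_natCast]
              gcongr
              · exact hfn x
              · exact hfu x
      rw [lintegral_const_mul' _ _ (by
        exact ENNReal.rpow_ne_top_of_nonneg (by linarith) (ENNReal.natCast_ne_top n))] at h1
      refine (h1.trans_lt (ENNReal.mul_lt_top ?_ hL2)).ne
      exact (ENNReal.rpow_ne_top_of_nonneg (by linarith) (ENNReal.natCast_ne_top n)).lt_top
    set Y := ENNReal.ofReal (V ^ (2 * s / 3)) * X ^ (2 / q) with hY
    have hXr0 : X ^ (2 / q) ≠ 0 := (ENNReal.rpow_pos (pos_iff_ne_zero.2 hX0) hXt).ne'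
    have hXrt : X ^ (2 / q) ≠ ∞ := ENNReal.rpow_ne_top_of_nonneg (by positivity) hXt
    have hY0 : Y ≠ 0 := mul_ne_zero (by rw [ENNReal.ofReal_ne_zero_iff]; positivity) hXr0
    have hYt : Y ≠ ∞ := ENNReal.mul_ne_top ENNReal.ofReal_ne_top hXrt
    have hpt : ∀ y, f y ^ q ≤ ENNReal.ofReal M * (Y ^ κ * (energyDensity s m A u y + ‖u y‖ₑ ^ 2)) := by
      intro y
      have h1 := hav κ hκ0 f (fun x => ‖magDiff A u x y‖ₑ) y Y hfm
        (ne_top_of_le_ne_top (ENNReal.natCast_ne_top n) (hfn y)) (fun x => by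
          calc f y ≤ min (‖u x‖ₑ + ‖magDiff A u x y‖ₑ) (n + ‖magDiff A u x y‖ₑ) := by
                refine le_min ((hfu y).trans (enorm_le_add_magDiff A u x y)) ((hfn y).trans le_self_add)
            _ = _ := by rw [hf, min_add_add_right]) hY0 hYt (fun ρ hρ hρ1 => by
          have h2 := setLIntegral_sq_le hq2 hfm (Metric.ball y ρ)
          have hvol := volume_ball_eq y hρ.le
          rw [← hV] at hvol
          have hq1 : 1 - 2 / q = 2 * s / 3 := by rw [hq]; field_simp; ring
          rw [hvol, hq1, ENNReal.ofReal_rpow_of_nonneg (by positivity) (by positivity),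
            Real.mul_rpow (by positivity) hV0.le] at h2
          calc _ ≤ ENNReal.ofReal (ρ ^ (-3 : ℝ)) *
                (X ^ (2 / q) * ENNReal.ofReal ((ρ ^ 3) ^ (2 * s / 3) * V ^ (2 * s / 3))) := by gcongr
            _ = ENNReal.ofReal (ρ ^ (-3 : ℝ) * ((ρ ^ 3) ^ (2 * s / 3))) * Y := by
                rw [hY, ENNReal.ofReal_mul (by positivity), ENNReal.ofReal_mul (by positivity)]; ring
            _ ≤ _ := by
                gcongr
                rw [← Real.rpow_natCast, ← Real.rpow_mul hρ.le, ← Real.rpow_add hρ]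
                refine le_of_eq ?_
                congr 1
                rw [hκ]; push_cast; field_simp; ring)
      rw [hpq, ← hM] at h1
      refine h1.trans ?_
      gcongr
      · exact le_rfl
      · exact hfu y
    have h3 : X ≤ ENNReal.ofReal M * (Y ^ κ * (ENNReal.ofReal C₁ * N)) := by
      calc X ≤ ∫⁻ y, ENNReal.ofReal M * (Y ^ κ * (energyDensity s m A u y + ‖u y‖ₑ ^ 2)) :=
            lintegral_mono hpt
        _ = ENNReal.ofReal M * (Y ^ κ * ∫⁻ y, (energyDensity s m A u y + ‖u y‖ₑ ^ 2)) := by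
            rw [lintegral_const_mul' _ _ ENNReal.ofReal_ne_top, lintegral_const_mul']
            exact ENNReal.rpow_ne_top_of_nonneg hκ0.le hYt
        _ ≤ _ := by gcongr
    have h4 : Y ^ κ = ENNReal.ofReal ((V ^ (2 * s / 3)) ^ κ) * X ^ (2 * s / 3) := by
      rw [hY, ENNReal.mul_rpow_of_nonneg _ _ hκ0.le, ENNReal.ofReal_rpow_of_nonneg (by positivity)
        hκ0.le, ← ENNReal.rpow_mul]
      congr 2
      rw [hq, hκ]; field_simp; ring
    have h5 : X = X ^ (2 * s / 3) * X ^ ((3 - 2 * s) / 3) := by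
      rw [← ENNReal.rpow_add_of_nonneg _ _ (by positivity) (by positivity)]
      rw [show 2 * s / 3 + (3 - 2 * s) / 3 = 1 by ring, ENNReal.rpow_one]
    have h6 : X ^ ((3 - 2 * s) / 3) ≤ ENNReal.ofReal (M * (V ^ (2 * s / 3)) ^ κ * C₁) * N := by
      have h7 : X ^ (2 * s / 3) * X ^ ((3 - 2 * s) / 3) ≤
          X ^ (2 * s / 3) * (ENNReal.ofReal (M * (V ^ (2 * s / 3)) ^ κ * C₁) * N) := by
        rw [← h5]
        refine h3.trans_eq ?_
        rw [h4, ENNReal.ofReal_mul (by positivity), ENNReal.ofReal_mul (by positivity)]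
        ring
      refine (ENNReal.mul_le_mul_iff_right ?_ ?_).1 h7
      · exact (ENNReal.rpow_pos (pos_iff_ne_zero.2 hX0) hXt).ne'
      · exact ENNReal.rpow_ne_top_of_nonneg (by positivity) hXt
    calc X = (X ^ ((3 - 2 * s) / 3)) ^ (3 / (3 - 2 * s)) := by
          rw [← ENNReal.rpow_mul, show (3 - 2 * s) / 3 * (3 / (3 - 2 * s)) = 1 by field_simp,
            ENNReal.rpow_one]
      _ ≤ _ := by gcongr
  refine le_of_tendsto' (lintegral_tendsto_of_tendsto_of_monotone
    (f := fun (n : ℕ) x => (min ‖u x‖ₑ n) ^ q) (fun n => (hu.enorm.min aemeasurable_const).pow_const q)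
    (ae_of_all _ fun x a b hab => ?_) (ae_of_all _ fun x => ?_)) trunc
  · simp only
    gcongr
  · obtain ⟨n, hn⟩ := ENNReal.exists_nat_gt (enorm_ne_top (x := u x))
    refine tendsto_const_nhds.congr' ?_
    filter_upwards [eventually_ge_atTop n] with k hk
    rw [min_eq_left]
    exact hn.le.trans (by exact_mod_cast hk)

/-! ### Decay of radial functions at infinity. -/

/-- The reflection in the hyperplane orthogonal to $x-x'$ exchanges the two centres. -/
theorem setLIntegral_ball_eq_of_norm_eq {f : R3 → ℝ≥0∞}
    (hf : ∀ g : R3 ≃ₗᵢ[ℝ] R3, (fun x => f (g x)) =ᵐ[volume] f) {x x' : R3} (h : ‖x‖ = ‖x'‖) (r : ℝ) :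
    ∫⁻ y in Metric.ball x' r, f y = ∫⁻ y in Metric.ball x r, f y := by
  set g : R3 ≃ₗᵢ[ℝ] R3 := (Submodule.span ℝ {x - x'})ᗮ.reflection with hg
  have hgx : g x = x' := Submodule.reflection_sub h
  have h1 := g.measurePreserving.setLIntegral_comp_preimage_emb
    g.toHomeomorph.measurableEmbedding f (Metric.ball x' r)
  rw [← hgx, g.preimage_ball, g.symm_apply_apply] at h1
  rw [← hgx, ← h1]
  exact lintegral_congr_ae (ae_restrict_of_ae (hf g))

/-- A sequence of distinct unit vectors. -/
def unitSeq (k : ℕ) : R3 := !₂[Real.cos (1 / (k + 1)), Real.sin (1 / (k + 1)), 0]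

theorem norm_unitSeq (k : ℕ) : ‖unitSeq k‖ = 1 := by
  simp [EuclideanSpace.norm_eq, Fin.sum_univ_three, unitSeq]

theorem unitSeq_injective : Function.Injective unitSeq := by
  intro j k h
  have h1 : Real.sin (1 / (j + 1)) = Real.sin (1 / (k + 1)) := by
    simpa [unitSeq] using congrArg (fun v : R3 => v 1) h
  have hb : ∀ i : ℕ, (1 / ((i : ℝ) + 1)) ∈ Icc (-(Real.pi / 2)) (Real.pi / 2) := fun i => by
    have h0 : 0 < 1 / ((i : ℝ) + 1) := by positivity
    have h1 : 1 / ((i : ℝ) + 1) ≤ 1 := by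
      rw [div_le_one (by positivity)]; linarith [(Nat.cast_nonneg i : (0 : ℝ) ≤ i)]
    have := Real.pi_gt_three
    constructor <;> linarith
  have h2 := Real.injOn_sin (hb j) (hb k) h1
  rw [one_div, one_div, inv_inj, add_left_inj] at h2
  exact_mod_cast h2

/-- Far from the origin, unit balls carry a small part of the mass of a radial function. -/
theorem exists_mul_setLIntegral_ball_le (n : ℕ) : ∃ R : ℝ, 0 < R ∧ ∀ x : R3, R ≤ ‖x‖ →
    ∀ f : R3 → ℝ≥0∞, (∀ g : R3 ≃ₗᵢ[ℝ] R3, (fun x => f (g x)) =ᵐ[volume] f) →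
      n * ∫⁻ y in Metric.ball x 1, f y ≤ ∫⁻ y, f y := by
  -- For a large radius the first $n$ rescaled unit vectors are pairwise at distance at least $2$,
  -- so the unit balls around them are disjoint.
  have h1 : ∀ᶠ r : ℝ in atTop, ∀ j ∈ Finset.range n, ∀ k ∈ Finset.range n, j ≠ k →
      2 ≤ r * dist (unitSeq j) (unitSeq k) := by
    refine (Finset.eventually_all _).2 fun j _ => (Finset.eventually_all _).2 fun k _ => ?_
    by_cases hjk : j = k
    · simp [hjk]
    · have : 0 < dist (unitSeq j) (unitSeq k) := dist_pos.2 fun h => hjk (unitSeq_injective h)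
      filter_upwards [(tendsto_id.atTop_mul_const this).eventually_ge_atTop 2] with r hr _ using hr
  obtain ⟨R, hR⟩ := eventually_atTop.1 h1
  refine ⟨max R 1, by positivity, fun x hx f hf => ?_⟩
  have hR := hR ‖x‖ ((le_max_left _ _).trans hx)
  have hd : (Finset.range n : Set ℕ).PairwiseDisjoint fun k => Metric.ball (‖x‖ • unitSeq k) 1 := by
    intro j hj k hk hjk
    refine Metric.ball_disjoint_ball ?_
    rw [dist_smul₀, norm_norm]
    have := hR j (by simpa using hj) k (by simpa using hk) hjk
    linarith
  have h2 := lintegral_biUnion_finset hd (fun k _ => Metric.isOpen_ball.measurableSet) f (μ := volume)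
  calc n * ∫⁻ y in Metric.ball x 1, f y
      = ∑ k ∈ Finset.range n, ∫⁻ y in Metric.ball (‖x‖ • unitSeq k) 1, f y := by
        rw [Finset.sum_congr rfl fun k _ => setLIntegral_ball_eq_of_norm_eq hf (x := x)
          (x' := ‖x‖ • unitSeq k) (by rw [norm_smul, norm_unitSeq, norm_norm, mul_one]) 1]
        simp
    _ ≤ _ := by rw [← h2]; exact setLIntegral_le_lintegral _ _

theorem IsRadial.enorm_rpow {u : R3 → ℂ} (hu : IsRadial u) (g : R3 ≃ₗᵢ[ℝ] R3) (q : ℝ) :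
    (fun x => ‖u (g x)‖ₑ ^ q) =ᵐ[volume] fun x => ‖u x‖ₑ ^ q := by
  filter_upwards [hu g] with x hx
  rw [hx]

/-- Uniform decay at infinity of radial functions of bounded norm. -/
theorem exists_tail_le {s m : ℝ} (hs : 0 < s) (hs' : s < 1) (hm : 0 < m) {M ε : ℝ} (hM : 0 < M)
    (hε : 0 < ε) : ∃ R : ℝ, 0 < R ∧ ∀ A : R3 → R3, Continuous A → ∀ u : R3 → ℂ,
      AEStronglyMeasurable u volume → IsRadial u → normSq s m A u ≤ ENNReal.ofReal M →
      ∫⁻ x in (Metric.ball 0 R)ᶜ, ‖u x‖ₑ ^ (2 + 4 * s / 3) ≤ ENNReal.ofReal ε := by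
  obtain ⟨K, hK, hav⟩ := exists_rpow_le_of_average hs hm
  obtain ⟨C₁, hC₁, hE⟩ := exists_energy_le_normSq hs hs' hm
  have hκ0 : 0 < 2 * s / 3 := by positivity
  have hav := hav (2 * s / 3) hκ0
  set K' := (2 * K) ^ (2 * s / 3) * (2 * K + 1)
  have hK' : 0 < K' := by positivity
  clear_value K'
  -- Chosen so that the final constant $K'\eta^{2s/3}C_1M$ equals $\varepsilon$. With $n>C_1M/\eta$,
  -- far unit balls carry mass at most $\eta$.
  set η : ℝ := (ε / (K' * (C₁ * M))) ^ (3 / (2 * s)) with hη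
  have hη0 : 0 < η := by positivity
  have hηε : K' * (η ^ (2 * s / 3) * (C₁ * M)) = ε := by
    rw [hη, ← Real.rpow_mul (by positivity), show 3 / (2 * s) * (2 * s / 3) = 1 by field_simp,
      Real.rpow_one]
    field_simp
  obtain ⟨n, hn⟩ := exists_nat_gt (C₁ * M / η)
  have hn0 : (0 : ℝ) < n := lt_trans (by positivity) hn
  obtain ⟨R, hR0, hR⟩ := exists_mul_setLIntegral_ball_le n
  refine ⟨R, hR0, fun A hA u hu hur hN => ?_⟩
  have hE : ∫⁻ y, (energyDensity s m A u y + ‖u y‖ₑ ^ 2) ≤ ENNReal.ofReal (C₁ * M) := by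
    rw [ENNReal.ofReal_mul hC₁.le]
    exact (hE A hA u hu).trans (by gcongr)
  have hmass : ∀ y ∈ (Metric.ball (0 : R3) R)ᶜ, ∫⁻ x in Metric.ball y 1, ‖u x‖ₑ ^ 2 ≤ ENNReal.ofReal η := by
    intro y hy
    have hy : R ≤ ‖y‖ := by simpa using hy
    have h1 := hR y hy (fun x => ‖u x‖ₑ ^ 2) fun g => by
      simpa using hur.enorm_rpow g 2
    have h2 : ∫⁻ y, ‖u y‖ₑ ^ 2 ≤ ENNReal.ofReal (C₁ * M) :=
      (lintegral_mono fun y => le_add_self).trans hE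
    have h3 : ENNReal.ofReal (C₁ * M) ≤ n * ENNReal.ofReal η := by
      rw [← ENNReal.ofReal_natCast, ← ENNReal.ofReal_mul hn0.le]
      refine ENNReal.ofReal_le_ofReal ?_
      rw [div_lt_iff₀ hη0] at hn
      exact hn.le
    refine (ENNReal.mul_le_mul_iff_right ?_ (ENNReal.natCast_ne_top n)).1 ((h1.trans h2).trans h3)
    exact_mod_cast hn0.ne'
  have hpt : ∀ y ∈ (Metric.ball (0 : R3) R)ᶜ, ‖u y‖ₑ ^ (2 + 4 * s / 3) ≤ ENNReal.ofReal K' *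
      (ENNReal.ofReal η ^ (2 * s / 3) * (energyDensity s m A u y + ‖u y‖ₑ ^ 2)) := by
    -- Here $\kappa=2s/3$, so the permitted growth is exactly $\rho^{-3}$ and $Y=\eta$ only has to
    -- bound the mass of the unit ball around $y$.
    intro y hy
    have h1 := hav (fun x => ‖u x‖ₑ) (fun x => ‖magDiff A u x y‖ₑ) y (ENNReal.ofReal η) hu.enorm
      enorm_ne_top (fun x => enorm_le_add_magDiff A u x y) (by rwa [ENNReal.ofReal_ne_zero_iff])
      ENNReal.ofReal_ne_top (fun ρ hρ hρ1 => by
        rw [show 2 * s / (2 * s / 3) = 3 by field_simp]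
        gcongr
        exact (lintegral_mono_set (Metric.ball_subset_ball hρ1)).trans (hmass y hy))
    have h2 : ‖u y‖ₑ ^ (2 + 4 * s / 3) = (‖u y‖ₑ ^ 2) ^ (1 + 2 * s / 3) := by
      rw [← ENNReal.rpow_natCast, ← ENNReal.rpow_mul]
      congr 1; push_cast; ring
    rw [h2]
    exact h1
  calc ∫⁻ x in (Metric.ball 0 R)ᶜ, ‖u x‖ₑ ^ (2 + 4 * s / 3)
      ≤ ∫⁻ y in (Metric.ball 0 R)ᶜ, ENNReal.ofReal K' *
      (ENNReal.ofReal η ^ (2 * s / 3) * (energyDensity s m A u y + ‖u y‖ₑ ^ 2)) := by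
        refine lintegral_mono_ae ?_
        filter_upwards [self_mem_ae_restrict Metric.isOpen_ball.measurableSet.compl] with y hy
          using hpt y hy
    _ ≤ ∫⁻ y, ENNReal.ofReal K' *
      (ENNReal.ofReal η ^ (2 * s / 3) * (energyDensity s m A u y + ‖u y‖ₑ ^ 2)) :=
        setLIntegral_le_lintegral _ _
    _ = ENNReal.ofReal K' * (ENNReal.ofReal η ^ (2 * s / 3) *
          ∫⁻ y, (energyDensity s m A u y + ‖u y‖ₑ ^ 2)) := by
        rw [lintegral_const_mul' _ _ ENNReal.ofReal_ne_top, lintegral_const_mul']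
        exact ENNReal.rpow_ne_top_of_nonneg hκ0.le ENNReal.ofReal_ne_top
    _ ≤ ENNReal.ofReal K' * (ENNReal.ofReal η ^ (2 * s / 3) * ENNReal.ofReal (C₁ * M)) := by gcongr
    _ = ENNReal.ofReal ε := by
        rw [ENNReal.ofReal_rpow_of_nonneg hη0.le hκ0.le, ← ENNReal.ofReal_mul (by positivity),
          ← ENNReal.ofReal_mul (by positivity), hηε]

/-! ### Magnetic averages and local compactness. -/

/-- The integral over a ball of `u`, transported to the center by the magnetic phase. -/
def magSum (A : R3 → R3) (ρ : ℝ) (u : R3 → ℂ) (y : R3) : ℂ :=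
  ∫ x in Metric.ball y ρ, Complex.exp (-(Complex.I *
      ((inner ℝ (x - y) (A ((1 / 2 : ℝ) • (x + y))) : ℝ) : ℂ))) * u x

theorem aestronglyMeasurable_magSum {A : R3 → R3} (hA : Continuous A) (ρ : ℝ) {u : R3 → ℂ}
    (hu : AEStronglyMeasurable u volume) : AEStronglyMeasurable (magSum A ρ u) volume := by
  have h1 : AEStronglyMeasurable (fun z : R3 × R3 => {z : R3 × R3 | dist z.2 z.1 < ρ}.indicator
      (fun z => Complex.exp (-(Complex.I *
      ((inner ℝ (z.2 - z.1) (A ((1 / 2 : ℝ) • (z.2 + z.1))) : ℝ) : ℂ))) * u z.2) z)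
      ((volume : Measure R3).prod (volume : Measure R3)) := by
    refine AEStronglyMeasurable.indicator ?_ (isOpen_lt (by fun_prop) (by fun_prop)).measurableSet
    have hc : Continuous fun z : R3 × R3 => Complex.exp (-(Complex.I *
      ((inner ℝ (z.2 - z.1) (A ((1 / 2 : ℝ) • (z.2 + z.1))) : ℝ) : ℂ))) := by fun_prop
    exact hc.aestronglyMeasurable.mul
      (hu.comp_quasiMeasurePreserving Measure.quasiMeasurePreserving_snd)
  refine h1.integral_prod_right'.congr (ae_of_all _ fun y => ?_)
  simp only [magSum]
  rw [← integral_indicator Metric.isOpen_ball.measurableSet]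
  rfl

theorem setLIntegral_pow_two_le {f : R3 → ℝ≥0∞} {B : Set R3} (hf : AEMeasurable f volume) :
    (∫⁻ x in B, f x) ^ 2 ≤ volume B * ∫⁻ x in B, f x ^ 2 := by
  have h := ENNReal.lintegral_mul_le_Lp_mul_Lq (volume.restrict B) Real.HolderConjugate.two_two
    (f := f) (g := fun _ => 1) hf.restrict aemeasurable_const
  simp only [Pi.mul_apply, mul_one, lintegral_const, Measure.restrict_apply
    MeasurableSet.univ, univ_inter, ENNReal.rpow_ofNat, one_pow, one_mul] at h
  calc _ ≤ ((∫⁻ x in B, f x ^ 2) ^ (1 / 2 : ℝ) * volume B ^ (1 / 2 : ℝ)) ^ 2 := by gcongr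
    _ = _ := by
      rw [mul_pow, ← ENNReal.rpow_natCast, ← ENNReal.rpow_natCast, ← ENNReal.rpow_mul,
        ← ENNReal.rpow_mul]
      norm_num
      rw [mul_comm]

theorem enorm_magSum_sq_le (A : R3 → R3) (ρ : ℝ) {u : R3 → ℂ} (hu : AEStronglyMeasurable u volume)
    (y : R3) : ‖magSum A ρ u y‖ₑ ^ 2 ≤ volume (Metric.ball y ρ) * ∫⁻ x, ‖u x‖ₑ ^ 2 := by
  calc ‖magSum A ρ u y‖ₑ ^ 2 ≤ (∫⁻ x in Metric.ball y ρ, ‖u x‖ₑ) ^ 2 := by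
        gcongr
        refine (enorm_integral_le_lintegral_enorm _).trans_eq (lintegral_congr fun x => ?_)
        rw [enorm_mul, enorm_phase, one_mul]
    _ ≤ volume (Metric.ball y ρ) * ∫⁻ x in Metric.ball y ρ, ‖u x‖ₑ ^ 2 :=
        setLIntegral_pow_two_le hu.enorm
    _ ≤ _ := by gcongr; exact Measure.restrict_le_self

/-- The transported average minus $|B|\,u(y)$ is $\int_B\delta_Au(x,y)\,dx$; Cauchy–Schwarz bounds
its square. -/
theorem volume_mul_enorm_sq_le {A : R3 → R3} (hA : Continuous A) {ρ : ℝ} {u : R3 → ℂ}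
    (hu : AEStronglyMeasurable u volume) (hL : ∫⁻ x, ‖u x‖ₑ ^ 2 < ∞) (y : R3) :
    (volume (Metric.ball y ρ) * ‖u y‖ₑ) ^ 2 ≤ 2 * ‖magSum A ρ u y‖ₑ ^ 2 +
      2 * (volume (Metric.ball y ρ) * ∫⁻ x in Metric.ball y ρ, ‖magDiff A u x y‖ₑ ^ 2) := by
  have hph : Continuous fun x : R3 => Complex.exp (-(Complex.I *
      ((inner ℝ (x - y) (A ((1 / 2 : ℝ) • (x + y))) : ℝ) : ℂ))) := by fun_prop
  have hdm : AEStronglyMeasurable (fun x => magDiff A u x y) volume :=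
    (hph.aestronglyMeasurable.mul hu).sub aestronglyMeasurable_const
  have hint : IntegrableOn (fun x => Complex.exp (-(Complex.I *
      ((inner ℝ (x - y) (A ((1 / 2 : ℝ) • (x + y))) : ℝ) : ℂ))) * u x) (Metric.ball y ρ) := by
    refine ⟨(hph.aestronglyMeasurable.mul hu).restrict, ?_⟩
    have h2 : (∫⁻ x in Metric.ball y ρ, ‖u x‖ₑ) ^ 2 < ∞ := by
      refine (setLIntegral_pow_two_le hu.enorm).trans_lt (ENNReal.mul_lt_top measure_ball_lt_top ?_)
      exact (setLIntegral_le_lintegral _ _).trans_lt hL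
    rw [ENNReal.pow_lt_top_iff] at h2
    refine lt_of_eq_of_lt (lintegral_congr fun x => ?_) (h2.resolve_right (by norm_num))
    rw [enorm_mul, enorm_phase, one_mul]
  have hdiff : ∫ x in Metric.ball y ρ, magDiff A u x y =
      magSum A ρ u y - (volume.real (Metric.ball y ρ)) • u y := by
    simp only [magDiff]
    rw [integral_sub hint (integrableOn_const measure_ball_lt_top.ne), setIntegral_const]
    rfl
  have h3 : (volume.real (Metric.ball y ρ)) • u y =
      magSum A ρ u y - ∫ x in Metric.ball y ρ, magDiff A u x y := by rw [hdiff]; abel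
  have h4 : volume (Metric.ball y ρ) * ‖u y‖ₑ = ‖(volume.real (Metric.ball y ρ)) • u y‖ₑ := by
    rw [enorm_smul, Real.enorm_of_nonneg measureReal_nonneg, ofReal_measureReal measure_ball_lt_top.ne]
  rw [h4, h3]
  calc _ ≤ (‖magSum A ρ u y‖ₑ + ∫⁻ x in Metric.ball y ρ, ‖magDiff A u x y‖ₑ) ^ 2 := by
        gcongr
        exact enorm_sub_le.trans (by gcongr; exact enorm_integral_le_lintegral_enorm _)
    _ ≤ 2 * ‖magSum A ρ u y‖ₑ ^ 2 + 2 * (∫⁻ x in Metric.ball y ρ, ‖magDiff A u x y‖ₑ) ^ 2 :=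
        ennreal_add_sq_le _ _
    _ ≤ _ := by
        gcongr
        exact setLIntegral_pow_two_le hdm.enorm

/-- Unlike the averages of $|u|$, the magnetic average is linear in $u$ and so vanishes along weakly
null sequences for fixed $\rho$, while the energy term is uniformly small as $\rho\to0$. -/
theorem exists_enorm_sq_le_magSum {s m : ℝ} (hs : 0 < s) (hm : 0 < m) :
    ∃ c : ℝ, 0 < c ∧ ∀ A : R3 → R3, Continuous A → ∀ (ρ : ℝ), 0 < ρ → ρ ≤ 1 → ∀ u : R3 → ℂ,
      AEStronglyMeasurable u volume → ∫⁻ x, ‖u x‖ₑ ^ 2 < ∞ → ∀ y,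
      ‖u y‖ₑ ^ 2 ≤ ENNReal.ofReal (c * ρ ^ (-6 : ℝ)) * ‖magSum A ρ u y‖ₑ ^ 2 +
        ENNReal.ofReal (c * ρ ^ (2 * s)) * energyDensity s m A u y := by
  obtain ⟨c, hc, hk⟩ := exists_setLIntegral_sq_le hs hm
  set V := (volume (Metric.ball (0 : R3) 1)).toReal with hV
  have hV0 : 0 < V := ENNReal.toReal_pos (Metric.measure_ball_pos _ _ one_pos).ne'
    measure_ball_lt_top.ne
  refine ⟨2 / V ^ 2 + 2 / (c * V), by positivity, fun A hA ρ hρ hρ1 u hu hL y => ?_⟩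
  have h1 := volume_mul_enorm_sq_le hA hu hL y (ρ := ρ)
  rw [volume_ball_eq y hρ.le, ← hV] at h1
  set S := ‖magSum A ρ u y‖ₑ ^ 2
  set G := energyDensity s m A u y with hG
  have hk := hk (fun x => ‖magDiff A u x y‖ₑ) y ρ hρ hρ1
  have h2 : (ENNReal.ofReal (ρ ^ 3 * V) * ‖u y‖ₑ) ^ 2 ≤
      2 * S + 2 * (ENNReal.ofReal (ρ ^ 3 * V) * (ENNReal.ofReal (ρ ^ (3 + 2 * s) / c) * G)) := by
    refine h1.trans ?_
    gcongr
    exact hk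
  have hpos : 0 < (ρ ^ 3 * V) ^ 2 := by positivity
  have h3 : ‖u y‖ₑ ^ 2 = ENNReal.ofReal (((ρ ^ 3 * V) ^ 2)⁻¹) * (ENNReal.ofReal (ρ ^ 3 * V) * ‖u y‖ₑ) ^ 2 := by
    rw [mul_pow (ENNReal.ofReal _), ← ENNReal.ofReal_pow (by positivity), ← mul_assoc, ← ENNReal.ofReal_mul (by positivity),
      inv_mul_cancel₀ hpos.ne', ENNReal.ofReal_one, one_mul]
  have e3 : ρ ^ (-6 : ℝ) = (ρ ^ 6)⁻¹ := by
    rw [Real.rpow_neg hρ.le]; norm_cast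
  have e4 : ρ ^ (3 + 2 * s) = ρ ^ 3 * ρ ^ (2 * s) := by
    rw [Real.rpow_add hρ]; norm_cast
  rw [h3]
  calc _ ≤ ENNReal.ofReal (((ρ ^ 3 * V) ^ 2)⁻¹) * (2 * S + 2 * (ENNReal.ofReal (ρ ^ 3 * V) *
        (ENNReal.ofReal (ρ ^ (3 + 2 * s) / c) * G))) := by gcongr
    _ = ENNReal.ofReal (2 / V ^ 2 * ρ ^ (-6 : ℝ)) * S + ENNReal.ofReal (2 / (c * V) * ρ ^ (2 * s)) * G := by
        rw [show (2 : ℝ≥0∞) = ENNReal.ofReal 2 by simp, mul_add, ← mul_assoc, ← mul_assoc, ← mul_assoc,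
          ← mul_assoc, ← ENNReal.ofReal_mul (by positivity), ← ENNReal.ofReal_mul (by positivity),
          ← ENNReal.ofReal_mul (by positivity)]
        congr 3
        · rw [e3]; field_simp
        · rw [e4]; field_simp
    _ ≤ _ := by
        gcongr
        · have : 0 ≤ 2 / (c * V) := by positivity
          linarith
        · have : 0 ≤ 2 / V ^ 2 := by positivity
          linarith

/-- Local compactness: bounded sequences with vanishing magnetic averages vanish in `L²_loc`. -/
theorem tendsto_setLIntegral_sq_of_magSum {s m : ℝ} (hs : 0 < s) (hs' : s < 1) (hm : 0 < m)
    {A : R3 → R3} (hA : Continuous A) {w : ℕ → R3 → ℂ} (hw : ∀ n, AEStronglyMeasurable (w n) volume)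
    {M : ℝ} (hM : 0 < M) (hN : ∀ n, normSq s m A (w n) ≤ ENNReal.ofReal M)
    (hlim : ∀ ρ y, Tendsto (fun n => magSum A ρ (w n) y) atTop (𝓝 0)) (R : ℝ) :
    Tendsto (fun n => ∫⁻ x in Metric.ball 0 R, ‖w n x‖ₑ ^ 2) atTop (𝓝 0) := by
  obtain ⟨c, hc, hav⟩ := exists_enorm_sq_le_magSum hs hm
  obtain ⟨C₁, hC₁, hE⟩ := exists_energy_le_normSq hs hs' hm
  have hE : ∀ n, ∫⁻ y, (energyDensity s m A (w n) y + ‖w n y‖ₑ ^ 2) ≤ ENNReal.ofReal (C₁ * M) := by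
    intro n
    rw [ENNReal.ofReal_mul hC₁.le]
    exact (hE A hA _ (hw n)).trans (by gcongr; exact hN n)
  have hL : ∀ n, ∫⁻ y, ‖w n y‖ₑ ^ 2 ≤ ENNReal.ofReal (C₁ * M) := fun n =>
    (lintegral_mono fun y => le_add_self).trans (hE n)
  have hG : ∀ n, ∫⁻ y, energyDensity s m A (w n) y ≤ ENNReal.ofReal (C₁ * M) := fun n =>
    (lintegral_mono fun y => le_self_add).trans (hE n)
  have hS : ∀ ρ, Tendsto (fun n => ∫⁻ y in Metric.ball 0 R, ‖magSum A ρ (w n) y‖ₑ ^ 2) atTop (𝓝 0) := by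
    intro ρ
    -- The dominating constant comes from Cauchy–Schwarz and the uniform $L^2$ bound; balls of
    -- radius $\rho$ all have the same volume.
    have := tendsto_lintegral_of_dominated_convergence' (μ := volume.restrict (Metric.ball (0 : R3) R))
      (F := fun n y => ‖magSum A ρ (w n) y‖ₑ ^ 2) (f := fun _ => 0)
      (fun _ => volume (Metric.ball (0 : R3) ρ) * ENNReal.ofReal (C₁ * M))
      (fun n => (aestronglyMeasurable_magSum hA ρ (hw n)).restrict.enorm.pow_const 2)
      (fun n => ae_of_all _ fun y => by
        refine (enorm_magSum_sq_le A ρ (hw n) y).trans ?_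
        rw [Measure.addHaar_ball_center]
        exact mul_le_mul_right (hL n) _) ?_ (ae_of_all _ fun y => ?_)
    · simpa using this
    · rw [setLIntegral_const]
      exact (ENNReal.mul_lt_top (ENNReal.mul_lt_top measure_ball_lt_top ENNReal.ofReal_lt_top)
        measure_ball_lt_top).ne
    · have h1 := (hlim ρ y).enorm
      have h2 := ENNReal.Tendsto.pow h1 (n := 2)
      simpa using h2
  rw [ENNReal.tendsto_atTop_zero]
  intro ε hε
  obtain ⟨e, he0, heε⟩ : ∃ e : ℝ, 0 < e ∧ ENNReal.ofReal e ≤ ε := by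
    rcases eq_or_ne ε ∞ with rfl | h
    · exact ⟨1, one_pos, le_top⟩
    · exact ⟨ε.toReal, ENNReal.toReal_pos hε.ne' h, ENNReal.ofReal_toReal_le⟩
  -- Makes the energy contribution at most $e/2$, uniformly in $n$; the minimum with $1$ keeps
  -- $\rho$ in the range of the kernel bound.
  set ρ : ℝ := min 1 ((e / (2 * (c * (C₁ * M)))) ^ (1 / (2 * s))) with hρ
  have hρ0 : 0 < ρ := by positivity
  have hρ1 : ρ ≤ 1 := min_le_left _ _
  have hρs : c * ρ ^ (2 * s) * (C₁ * M) ≤ e / 2 := by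
    have h1 : ρ ^ (2 * s) ≤ e / (2 * (c * (C₁ * M))) := by
      calc ρ ^ (2 * s) ≤ ((e / (2 * (c * (C₁ * M)))) ^ (1 / (2 * s))) ^ (2 * s) := by
            gcongr
            exact min_le_right _ _
        _ = _ := by
            rw [← Real.rpow_mul (by positivity), show 1 / (2 * s) * (2 * s) = 1 by field_simp,
              Real.rpow_one]
    calc c * ρ ^ (2 * s) * (C₁ * M) ≤ c * (e / (2 * (c * (C₁ * M)))) * (C₁ * M) := by gcongr
      _ = _ := by field_simp
  have h2 : Tendsto (fun n => ENNReal.ofReal (c * ρ ^ (-6 : ℝ)) *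
      ∫⁻ y in Metric.ball 0 R, ‖magSum A ρ (w n) y‖ₑ ^ 2) atTop (𝓝 0) := by
    simpa using ENNReal.Tendsto.const_mul (hS ρ) (Or.inr ENNReal.ofReal_ne_top)
  obtain ⟨n₀, hn₀⟩ := (ENNReal.tendsto_atTop_zero.1 h2) (ENNReal.ofReal (e / 2))
    (ENNReal.ofReal_pos.2 (by positivity))
  refine ⟨n₀, fun n hn => le_trans ?_ heε⟩
  calc ∫⁻ x in Metric.ball 0 R, ‖w n x‖ₑ ^ 2
      ≤ ∫⁻ y in Metric.ball 0 R, (ENNReal.ofReal (c * ρ ^ (-6 : ℝ)) * ‖magSum A ρ (w n) y‖ₑ ^ 2 +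
        ENNReal.ofReal (c * ρ ^ (2 * s)) * energyDensity s m A (w n) y) :=
        lintegral_mono fun y => hav A hA ρ hρ0 hρ1 (w n) (hw n)
          ((hL n).trans_lt ENNReal.ofReal_lt_top) y
    _ = ENNReal.ofReal (c * ρ ^ (-6 : ℝ)) * (∫⁻ y in Metric.ball 0 R, ‖magSum A ρ (w n) y‖ₑ ^ 2) +
        ENNReal.ofReal (c * ρ ^ (2 * s)) * ∫⁻ y in Metric.ball 0 R, energyDensity s m A (w n) y := by
        rw [lintegral_add_left', lintegral_const_mul' _ _ ENNReal.ofReal_ne_top,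
          lintegral_const_mul' _ _ ENNReal.ofReal_ne_top]
        exact ((aestronglyMeasurable_magSum hA ρ (hw n)).restrict.enorm.pow_const 2).const_mul _
    _ ≤ ENNReal.ofReal (e / 2) + ENNReal.ofReal (c * ρ ^ (2 * s)) * ENNReal.ofReal (C₁ * M) := by
        gcongr
        · exact hn₀ n hn
        · exact (setLIntegral_le_lintegral _ _).trans (hG n)
    _ ≤ ENNReal.ofReal (e / 2) + ENNReal.ofReal (e / 2) := by
        gcongr
        rw [← ENNReal.ofReal_mul (by positivity)]
        exact ENNReal.ofReal_le_ofReal hρs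
    _ = ENNReal.ofReal e := by
        rw [← ENNReal.ofReal_add (by positivity) (by positivity)]; congr 1; ring

/-! ### Interpolation and compactness in subcritical Lebesgue spaces. -/

theorem lintegral_rpow_interpolate {a q b : ℝ} (ha : 0 ≤ a) (haq : a ≤ q) (hqb : q ≤ b) (hab : a < b)
    (μ : Measure R3) {f : R3 → ℝ≥0∞} (hf : AEMeasurable f μ) :
    ∫⁻ x, f x ^ q ∂μ ≤ (∫⁻ x, f x ^ a ∂μ) ^ ((b - q) / (b - a)) *
      (∫⁻ x, f x ^ b ∂μ) ^ ((q - a) / (b - a)) := by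
  have hba : 0 < b - a := by linarith
  have h := ENNReal.lintegral_mul_norm_pow_le (μ := μ) (f := fun x => f x ^ a) (g := fun x => f x ^ b)
    (hf.pow_const a) (hf.pow_const b) (p := (b - q) / (b - a)) (q := (q - a) / (b - a))
    (div_nonneg (by linarith) hba.le) (div_nonneg (by linarith) hba.le) (by field_simp; ring)
  refine (lintegral_congr fun x => ?_).trans_le h
  rw [← ENNReal.rpow_mul, ← ENNReal.rpow_mul, ← ENNReal.rpow_add_of_nonneg]
  · congr 1; field_simp; ring
  · exact mul_nonneg ha (div_nonneg (by linarith) hba.le)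
  · exact mul_nonneg (by linarith) (div_nonneg (by linarith) hba.le)

theorem tendsto_rpow_mul_rpow_zero {X : ℕ → ℝ≥0∞} (hX : Tendsto X atTop (𝓝 0)) {θ τ : ℝ}
    (hθ : 0 < θ) (hτ : 0 ≤ τ) {C : ℝ≥0∞} (hC : C ≠ ∞) :
    Tendsto (fun n => X n ^ θ * C ^ τ) atTop (𝓝 0) := by
  have h1 : Tendsto (fun n => X n ^ θ) atTop (𝓝 0) := by
    have := (ENNReal.continuous_rpow_const (y := θ)).tendsto 0 |>.comp hX
    simpa [ENNReal.zero_rpow_of_pos hθ, Function.comp_def] using this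
  simpa using ENNReal.Tendsto.mul_const h1 (Or.inr (ENNReal.rpow_ne_top_of_nonneg hτ hC))

/-- At the exponent $r=2+4s/3$ of the tail estimate, the outside of a large ball is uniformly small
and the inside is interpolated between local $L^2$ convergence and the critical bound. Any other
subcritical $q$ lies between $r$ and one of the endpoints $2$, $6/(3-2s)$, where the norms stay
bounded. -/
theorem tendsto_lintegral_rpow {s m : ℝ} (hs : 0 < s) (hs' : s < 1) (hm : 0 < m)
    {A : R3 → R3} (hA : Continuous A) {w : ℕ → R3 → ℂ} (hw : ∀ n, AEStronglyMeasurable (w n) volume)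
    (hr : ∀ n, IsRadial (w n))
    {M : ℝ} (hM : 0 < M) (hN : ∀ n, normSq s m A (w n) ≤ ENNReal.ofReal M)
    (hlim : ∀ ρ y, Tendsto (fun n => magSum A ρ (w n) y) atTop (𝓝 0)) {q : ℝ} (hq : 2 < q)
    (hq' : q < 6 / (3 - 2 * s)) :
    Tendsto (fun n => ∫⁻ x, ‖w n x‖ₑ ^ q) atTop (𝓝 0) := by
  obtain ⟨S, hS, hsob⟩ := exists_sobolev hs hs' hm
  obtain ⟨C₁, hC₁, hE⟩ := exists_energy_le_normSq hs hs' hm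
  have hd : 0 < 3 - 2 * s := by linarith
  set Q := 6 / (3 - 2 * s) with hQ
  have hB : ∀ n, ∫⁻ x, ‖w n x‖ₑ ^ Q ≤ (ENNReal.ofReal S * ENNReal.ofReal M) ^ (3 / (3 - 2 * s)) := by
    intro n
    refine (hsob A hA _ (hw n)).trans ?_
    gcongr
    exact hN n
  set B := (ENNReal.ofReal S * ENNReal.ofReal M) ^ (3 / (3 - 2 * s))
  have hBt : B ≠ ∞ := ENNReal.rpow_ne_top_of_nonneg (by positivity)
    (ENNReal.mul_ne_top ENNReal.ofReal_ne_top ENNReal.ofReal_ne_top)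
  have hL : ∀ n, ∫⁻ y, ‖w n y‖ₑ ^ (2 : ℝ) ≤ ENNReal.ofReal C₁ * ENNReal.ofReal M := by
    intro n
    refine le_trans (lintegral_mono fun y => ?_) ((hE A hA _ (hw n)).trans (by gcongr; exact hN n))
    rw [ENNReal.rpow_ofNat]
    exact le_add_self
  set L := ENNReal.ofReal C₁ * ENNReal.ofReal M
  have hLt : L ≠ ∞ := ENNReal.mul_ne_top ENNReal.ofReal_ne_top ENNReal.ofReal_ne_top
  set r := 2 + 4 * s / 3 with hrdef
  have hr2 : 2 < r := by rw [hrdef]; linarith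
  -- Indeed $(2+4s/3)(3-2s)=6-8s^2/3<6$.
  have hrQ : r < Q := by
    rw [hrdef, hQ, lt_div_iff₀ hd]
    nlinarith
  have key : Tendsto (fun n => ∫⁻ x, ‖w n x‖ₑ ^ r) atTop (𝓝 0) := by
    rw [ENNReal.tendsto_atTop_zero]
    intro ε hε
    obtain ⟨e, he0, heε⟩ : ∃ e : ℝ, 0 < e ∧ ENNReal.ofReal e ≤ ε := by
      rcases eq_or_ne ε ∞ with rfl | h
      · exact ⟨1, one_pos, le_top⟩
      · exact ⟨ε.toReal, ENNReal.toReal_pos hε.ne' h, ENNReal.ofReal_toReal_le⟩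
    obtain ⟨R, hR, htail⟩ := exists_tail_le hs hs' hm hM (half_pos he0)
    have hloc := tendsto_setLIntegral_sq_of_magSum hs hs' hm hA hw hM hN hlim R
    have h1 := tendsto_rpow_mul_rpow_zero hloc (θ := (Q - r) / (Q - 2)) (τ := (r - 2) / (Q - 2))
      (div_pos (by linarith) (by linarith)) (div_nonneg (by linarith) (by linarith)) hBt
    obtain ⟨n₀, hn₀⟩ := (ENNReal.tendsto_atTop_zero.1 h1) (ENNReal.ofReal (e / 2))
      (ENNReal.ofReal_pos.2 (by positivity))
    refine ⟨n₀, fun n hn => le_trans ?_ heε⟩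
    rw [← lintegral_add_compl _ (Metric.isOpen_ball (x := (0 : R3)) (ε := R)).measurableSet]
    calc _ ≤ ENNReal.ofReal (e / 2) + ENNReal.ofReal (e / 2) := by
          gcongr
          · refine le_trans ?_ (hn₀ n hn)
            refine (lintegral_rpow_interpolate (by norm_num) hr2.le hrQ.le (hr2.trans hrQ) _
              (hw n).enorm.restrict).trans ?_
            simp only [ENNReal.rpow_ofNat]
            have h4 : 0 ≤ (r - 2) / (Q - 2) := div_nonneg (by linarith) (by linarith)
            gcongr
            exact (setLIntegral_le_lintegral _ _).trans (hB n)
          · exact htail A hA _ (hw n) (hr n) (hN n)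
      _ = ENNReal.ofReal e := by
        rw [← ENNReal.ofReal_add (by positivity) (by positivity)]; congr 1; ring
  rcases le_total q r with h | h
  · have h1 := tendsto_rpow_mul_rpow_zero key (θ := (q - 2) / (r - 2)) (τ := (r - q) / (r - 2))
      (div_pos (by linarith) (by linarith)) (div_nonneg (by linarith) (by linarith)) hLt
    refine tendsto_of_tendsto_of_tendsto_of_le_of_le tendsto_const_nhds h1 (fun _ => zero_le)
      fun n => ?_
    refine (lintegral_rpow_interpolate (by norm_num) hq.le h hr2 _ (hw n).enorm).trans ?_
    rw [mul_comm]
    have h4 : 0 ≤ (r - q) / (r - 2) := div_nonneg (by linarith) (by linarith)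
    gcongr
    exact hL n
  · have h1 := tendsto_rpow_mul_rpow_zero key (θ := (Q - q) / (Q - r)) (τ := (q - r) / (Q - r))
      (div_pos (by linarith) (by linarith)) (div_nonneg (by linarith) (by linarith)) hBt
    refine tendsto_of_tendsto_of_tendsto_of_le_of_le tendsto_const_nhds h1 (fun _ => zero_le)
      fun n => ?_
    refine (lintegral_rpow_interpolate (by linarith) h hq'.le hrQ _ (hw n).enorm).trans ?_
    have h4 : 0 ≤ (q - r) / (Q - r) := div_nonneg (by linarith) (by linarith)
    gcongr
    exact hB n

theorem lintegral_rpow_lt_top {s m : ℝ} (hs : 0 < s) (hs' : s < 1) (hm : 0 < m)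
    {A : R3 → R3} (hA : Continuous A) {u : R3 → ℂ} (hu : FiniteNorm s m A u) {q : ℝ} (hq : 2 ≤ q)
    (hq' : q ≤ 6 / (3 - 2 * s)) : ∫⁻ x, ‖u x‖ₑ ^ q < ∞ := by
  obtain ⟨S, hS, hsob⟩ := exists_sobolev hs hs' hm
  obtain ⟨C₁, hC₁, hE⟩ := exists_energy_le_normSq hs hs' hm
  have hd : 0 < 3 - 2 * s := by linarith
  have hQ : 2 < 6 / (3 - 2 * s) := by rw [lt_div_iff₀ hd]; linarith
  refine (lintegral_rpow_interpolate (by norm_num) hq hq' hQ _ hu.1.enorm).trans_lt ?_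
  refine ENNReal.mul_lt_top (ENNReal.rpow_lt_top_of_nonneg (div_nonneg (by linarith) (by linarith))
    (ne_of_lt ?_)) (ENNReal.rpow_lt_top_of_nonneg (div_nonneg (by linarith) (by linarith)) (ne_of_lt ?_))
  · refine (lintegral_mono fun y => ?_).trans_lt ((hE A hA u hu.1).trans_lt
      (ENNReal.mul_lt_top ENNReal.ofReal_lt_top hu.2))
    rw [ENNReal.rpow_ofNat]
    exact le_add_self
  · refine (hsob A hA u hu.1).trans_lt (ENNReal.rpow_lt_top_of_nonneg (by positivity) ?_)
    exact (ENNReal.mul_lt_top ENNReal.ofReal_lt_top hu.2).ne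

/-! ### Young's inequality and the Riesz potential. -/

/-- Young's inequality for the trilinear form `∬ f(x) k(x-y) h(y)`. -/
theorem lintegral_young {r a : ℝ} (hr : 1 ≤ r) (ha : 0 < a) (har : 1 / a + 1 / (2 * r) = 1)
    {k f h : R3 → ℝ≥0∞} (hk : Measurable k) (hf : AEMeasurable f volume) (hh : AEMeasurable h volume) :
    ∫⁻ z : R3 × R3, k (z.1 - z.2) * f z.1 * h z.2 ≤
      (∫⁻ x, k x ^ r) ^ (1 / r) * ((∫⁻ x, f x ^ a) ^ (1 / a) * (∫⁻ x, h x ^ a) ^ (1 / a)) := by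
  have hr0 : 0 < r := by linarith
  have hf1 : AEMeasurable (fun z : R3 × R3 => f z.1) volume :=
    hf.comp_quasiMeasurePreserving Measure.quasiMeasurePreserving_fst
  have hh1 : AEMeasurable (fun z : R3 × R3 => h z.2) volume :=
    hh.comp_quasiMeasurePreserving Measure.quasiMeasurePreserving_snd
  have hk1 : Measurable (fun z : R3 × R3 => k (z.1 - z.2)) := by fun_prop
  have e1 : 1 / (2 * r) + (1 / (2 * r) + (1 - 1 / r)) = 1 := by field_simp; ring
  have e2 : a * (1 - 1 / (2 * r)) = 1 := by
    rw [sub_eq_iff_eq_add.2 har.symm, mul_one_div_cancel ha.ne']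
  have hr1 : 0 ≤ 1 - 1 / r := by rw [sub_nonneg, div_le_one hr0]; exact hr
  -- Three-factor Hölder for $f^ak^r$, $h^ak^r$ and $f^ah^a$ with weights
  -- $\frac1{2r},\frac1{2r},1-\frac1r$. Each of the three integrals factorizes by translation
  -- invariance or Fubini.
  have H := ENNReal.lintegral_prod_norm_pow_le (μ := (volume : Measure (R3 × R3))) Finset.univ
    (f := ![fun z => f z.1 ^ a * k (z.1 - z.2) ^ r, fun z => h z.2 ^ a * k (z.1 - z.2) ^ r,
      fun z => f z.1 ^ a * h z.2 ^ a]) (p := ![1 / (2 * r), 1 / (2 * r), 1 - 1 / r])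
    (by
      intro i _
      fin_cases i
      · exact (hf1.pow_const a).mul (hk1.pow_const r).aemeasurable
      · exact (hh1.pow_const a).mul (hk1.pow_const r).aemeasurable
      · exact (hf1.pow_const a).mul (hh1.pow_const a))
    (by simpa [Fin.sum_univ_three, add_assoc] using e1)
    (by
      intro i _
      fin_cases i
      · simp; positivity
      · simp; positivity
      · simpa using hr1)
  simp only [Fin.prod_univ_three, Matrix.cons_val_zero, Matrix.cons_val_one, Matrix.cons_val] at H
  have i1 : ∫⁻ z : R3 × R3, f z.1 ^ a * k (z.1 - z.2) ^ r = (∫⁻ x, f x ^ a) * ∫⁻ x, k x ^ r := by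
    rw [Measure.volume_eq_prod, lintegral_prod]
    · simp only
      rw [← lintegral_mul_const'' _ (hf.pow_const a)]
      refine lintegral_congr fun x => ?_
      rw [lintegral_const_mul _ (by fun_prop), lintegral_sub_left_eq_self (fun y => k y ^ r)]
    · exact (hf1.pow_const a).mul (hk1.pow_const r).aemeasurable
  have i2 : ∫⁻ z : R3 × R3, h z.2 ^ a * k (z.1 - z.2) ^ r = (∫⁻ x, h x ^ a) * ∫⁻ x, k x ^ r := by
    rw [Measure.volume_eq_prod, lintegral_prod_symm]
    · simp only
      rw [← lintegral_mul_const'' _ (hh.pow_const a)]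
      refine lintegral_congr fun x => ?_
      rw [lintegral_const_mul _ (by fun_prop), lintegral_sub_right_eq_self (fun y => k y ^ r)]
    · exact (hh1.pow_const a).mul (hk1.pow_const r).aemeasurable
  have i3 : ∫⁻ z : R3 × R3, f z.1 ^ a * h z.2 ^ a = (∫⁻ x, f x ^ a) * ∫⁻ x, h x ^ a := by
    rw [Measure.volume_eq_prod, lintegral_prod_mul (hf.pow_const a) (hh.pow_const a)]
  rw [i1, i2, i3] at H
  have p1 : ∀ t : ℝ≥0∞, (t ^ a) ^ (1 / (2 * r)) * (t ^ a) ^ (1 - 1 / r) = t := by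
    intro t
    rw [← ENNReal.rpow_mul, ← ENNReal.rpow_mul, ← ENNReal.rpow_add_of_nonneg _ _ (by positivity)
      (mul_nonneg ha.le hr1), ← mul_add]
    rw [show 1 / (2 * r) + (1 - 1 / r) = 1 - 1 / (2 * r) by field_simp; ring, e2, ENNReal.rpow_one]
  have p2 : ∀ t : ℝ≥0∞, t ^ (1 / (2 * r)) * t ^ (1 - 1 / r) = t ^ (1 / a) := by
    intro t
    rw [← ENNReal.rpow_add_of_nonneg _ _ (by positivity) hr1]
    congr 1
    rw [← sub_eq_iff_eq_add.2 har.symm]; field_simp; ring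
  have p3 : ∀ t : ℝ≥0∞, t ^ (1 / (2 * r)) * t ^ (1 / (2 * r)) = t ^ (1 / r) := by
    intro t
    rw [← ENNReal.rpow_add_of_nonneg _ _ (by positivity) (by positivity)]
    congr 1; field_simp; ring
  have p4 : ∀ t : ℝ≥0∞, (t ^ r) ^ (1 / (2 * r)) * (t ^ r) ^ (1 / (2 * r)) = t := by
    intro t
    rw [p3, ← ENNReal.rpow_mul, mul_one_div_cancel hr0.ne', ENNReal.rpow_one]
  have hn : 0 ≤ 1 / (2 * r) := by positivity
  calc ∫⁻ z : R3 × R3, k (z.1 - z.2) * f z.1 * h z.2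
      = ∫⁻ z : R3 × R3, (f z.1 ^ a * k (z.1 - z.2) ^ r) ^ (1 / (2 * r)) *
          (h z.2 ^ a * k (z.1 - z.2) ^ r) ^ (1 / (2 * r)) * (f z.1 ^ a * h z.2 ^ a) ^ (1 - 1 / r) := by
        refine lintegral_congr fun z => ?_
        rw [ENNReal.mul_rpow_of_nonneg _ _ hn, ENNReal.mul_rpow_of_nonneg _ _ hn,
          ENNReal.mul_rpow_of_nonneg _ _ hr1]
        conv_lhs => rw [← p1 (f z.1), ← p1 (h z.2), ← p4 (k (z.1 - z.2))]
        ring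
    _ ≤ _ := H
    _ = _ := by
        rw [ENNReal.mul_rpow_of_nonneg _ _ hn, ENNReal.mul_rpow_of_nonneg _ _ hn,
          ENNReal.mul_rpow_of_nonneg _ _ hr1, ← p2, ← p2, ← p3]
        ring

theorem rieszPotential_nonneg {α : ℝ} (hα : 0 < α) (hα' : α < 3) (x : R3) :
    0 ≤ rieszPotential α x := by
  have h1 := Real.Gamma_pos_of_pos (half_pos hα)
  have h2 := Real.Gamma_pos_of_pos (show 0 < (3 - α) / 2 by linarith)
  unfold rieszPotential
  positivity

theorem rieszPotential_pos {α : ℝ} (hα : 0 < α) (hα' : α < 3) {x : R3} (hx : x ≠ 0) :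
    0 < rieszPotential α x := by
  have h1 := Real.Gamma_pos_of_pos (half_pos hα)
  have h2 := Real.Gamma_pos_of_pos (show 0 < (3 - α) / 2 by linarith)
  have h3 := norm_pos_iff.2 hx
  unfold rieszPotential
  positivity

theorem measurable_rieszPotential (α : ℝ) : Measurable (rieszPotential α) := by
  unfold rieszPotential
  fun_prop

theorem rieszPotential_eq (α : ℝ) (x : R3) : rieszPotential α x =
    (Real.pi ^ (3 / 2 : ℝ) * 2 ^ α * (Real.Gamma (α / 2) / Real.Gamma ((3 - α) / 2))) *
      ‖x‖ ^ (-(3 - α)) := by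
  rw [rieszPotential, Real.rpow_neg (norm_nonneg _), one_div]

theorem ofReal_rieszPotential_rpow {α : ℝ} (hα : 0 < α) (hα' : α < 3) {r : ℝ} (hr : 0 < r) (x : R3) :
    ENNReal.ofReal (rieszPotential α x) ^ r = ENNReal.ofReal ((Real.pi ^ (3 / 2 : ℝ) * 2 ^ α *
      (Real.Gamma (α / 2) / Real.Gamma ((3 - α) / 2))) ^ r) * ENNReal.ofReal (‖x‖ ^ (-(3 - α) * r)) := by
  have h1 := Real.Gamma_pos_of_pos (half_pos hα)
  have h2 := Real.Gamma_pos_of_pos (show 0 < (3 - α) / 2 by linarith)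
  rw [ENNReal.ofReal_rpow_of_nonneg (rieszPotential_nonneg hα hα' x) hr.le, rieszPotential_eq,
    Real.mul_rpow (by positivity) (by positivity), ENNReal.ofReal_mul (by positivity),
    ← Real.rpow_mul (norm_nonneg _)]

theorem lintegral_rieszPotential_near {α : ℝ} (hα : 0 < α) (hα' : α < 3) {r : ℝ} (hr : 0 < r)
    (h : (3 - α) * r < 3) : ∫⁻ x : R3, (Metric.ball (0 : R3) 1).indicator
      (fun x => ENNReal.ofReal (rieszPotential α x)) x ^ r < ∞ := by
  have h1 := lintegral_norm_rpow_ball_lt_top (a := -(3 - α) * r) (by linarith)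
  refine lt_of_eq_of_lt ?_ (ENNReal.mul_lt_top (ENNReal.ofReal_lt_top (r := (Real.pi ^ (3 / 2 : ℝ) * 2 ^ α *
      (Real.Gamma (α / 2) / Real.Gamma ((3 - α) / 2))) ^ r)) h1)
  rw [← lintegral_const_mul' _ _ ENNReal.ofReal_ne_top]
  refine lintegral_congr fun x => ?_
  by_cases hx : x ∈ Metric.ball (0 : R3) 1
  · rw [indicator_of_mem hx, indicator_of_mem hx, ofReal_rieszPotential_rpow hα hα' hr]
  · rw [indicator_of_notMem hx, indicator_of_notMem hx, ENNReal.zero_rpow_of_pos hr, mul_zero]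

theorem lintegral_rieszPotential_far {α : ℝ} (hα : 0 < α) (hα' : α < 3) {r : ℝ} (hr : 0 < r)
    (h : 3 < (3 - α) * r) : ∫⁻ x : R3, (Metric.ball (0 : R3) 1)ᶜ.indicator
      (fun x => ENNReal.ofReal (rieszPotential α x)) x ^ r < ∞ := by
  have h1 := lintegral_norm_rpow_compl_ball_lt_top (a := -(3 - α) * r) (by linarith)
  refine lt_of_eq_of_lt ?_ (ENNReal.mul_lt_top (ENNReal.ofReal_lt_top (r := (Real.pi ^ (3 / 2 : ℝ) * 2 ^ α *
      (Real.Gamma (α / 2) / Real.Gamma ((3 - α) / 2))) ^ r)) h1)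
  rw [← lintegral_const_mul' _ _ ENNReal.ofReal_ne_top]
  refine lintegral_congr fun x => ?_
  by_cases hx : x ∈ (Metric.ball (0 : R3) 1)ᶜ
  · rw [indicator_of_mem hx, indicator_of_mem hx, ofReal_rieszPotential_rpow hα hα' hr]
  · rw [indicator_of_notMem hx, indicator_of_notMem hx, ENNReal.zero_rpow_of_pos hr, mul_zero]

/-- The Choquard double integral is controlled by two subcritical Lebesgue norms. -/
theorem exists_riesz_bound {s α p : ℝ} (hs : 0 < s) (hs' : s < 1) (hα : 0 < α) (hα' : α < 3)
    (hp : 1 + α / 3 < p) (hp' : p < (3 + α) / (3 - 2 * s)) :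
    ∃ (q₁ q₂ b₁ b₂ : ℝ) (K₁ K₂ : ℝ≥0∞), 2 < q₁ ∧ q₁ < 6 / (3 - 2 * s) ∧ 2 < q₂ ∧ q₂ < 6 / (3 - 2 * s) ∧
      0 < b₁ ∧ 0 < b₂ ∧ K₁ ≠ ∞ ∧ K₂ ≠ ∞ ∧ ∀ f h : R3 → ℝ≥0∞, AEMeasurable f volume →
      AEMeasurable h volume →
      ∫⁻ z : R3 × R3, ENNReal.ofReal (rieszPotential α (z.1 - z.2)) * f z.1 ^ p * h z.2 ^ p ≤
        K₁ * ((∫⁻ x, f x ^ q₁) ^ b₁ * (∫⁻ x, h x ^ q₁) ^ b₁) +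
        K₂ * ((∫⁻ x, f x ^ q₂) ^ b₂ * (∫⁻ x, h x ^ q₂) ^ b₂) := by
  have hd : 0 < 3 - 2 * s := by linarith
  rw [lt_div_iff₀ hd] at hp'
  -- With $q=p/(1-\beta/2)$, the value $\beta=1-\alpha/3$ is the borderline integrability
  -- $1/\beta=3/(3-\alpha)$ of the kernel. The near part is in $L^{1/\beta}$ for $\beta$ above it,
  -- the far part for $\beta$ below it. The conditions $2<q<6/(3-2s)$ read $2-p<\beta<2-p(3-2s)/3$,
  -- and the strict bounds on $p$ place the borderline inside this interval, leaving room on both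
  -- sides.
  obtain ⟨β₂, hβ₂, hβ₂'⟩ := exists_between (show max 0 (2 - p) < 1 - α / 3 from
    max_lt (by linarith) (by linarith))
  obtain ⟨β₁, hβ₁, hβ₁'⟩ := exists_between (show 1 - α / 3 < min 1 (2 - p * (3 - 2 * s) / 3) from
    lt_min (by linarith) (by linarith))
  rw [max_lt_iff] at hβ₂
  rw [lt_min_iff] at hβ₁'
  have hq : ∀ β : ℝ, 0 < β → β < 1 → 2 - p < β → β < 2 - p * (3 - 2 * s) / 3 →
      2 < p / (1 - β / 2) ∧ p / (1 - β / 2) < 6 / (3 - 2 * s) := by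
    intro β h0 h1 h2 h3
    have : 0 < 1 - β / 2 := by linarith
    constructor
    · rw [lt_div_iff₀ this]; linarith
    · rw [div_lt_div_iff₀ this hd]; linarith
  have hy : ∀ β : ℝ, 0 < β → β < 1 → ∀ k f h : R3 → ℝ≥0∞, Measurable k → AEMeasurable f volume →
      AEMeasurable h volume → ∫⁻ z : R3 × R3, k (z.1 - z.2) * f z.1 ^ p * h z.2 ^ p ≤
      (∫⁻ x, k x ^ (1 / β)) ^ β * ((∫⁻ x, f x ^ (p / (1 - β / 2))) ^ (1 - β / 2) *
        (∫⁻ x, h x ^ (p / (1 - β / 2))) ^ (1 - β / 2)) := by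
    intro β h0 h1 k f h hk hf hh
    have hb : 0 < 1 - β / 2 := by linarith
    have := lintegral_young (r := 1 / β) (a := 1 / (1 - β / 2))
      (by rw [le_div_iff₀ h0]; linarith) (by positivity) (by field_simp; ring) hk
      (hf.pow_const p) (hh.pow_const p)
    simpa only [← ENNReal.rpow_mul, mul_one_div, one_div_one_div] using this
  obtain ⟨a1, a2⟩ := hq β₁ (by linarith) hβ₁'.1 (by linarith) hβ₁'.2
  obtain ⟨a3, a4⟩ := hq β₂ hβ₂.1 (by linarith) hβ₂.2 (by linarith [hβ₁'.2])
  have hk := (measurable_rieszPotential α).ennreal_ofReal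
  have hB : MeasurableSet (Metric.ball (0 : R3) 1) := Metric.isOpen_ball.measurableSet
  have hb1 : 0 < β₁ := by linarith
  refine ⟨_, _, _, _, (∫⁻ x : R3, (Metric.ball (0 : R3) 1).indicator
      (fun x => ENNReal.ofReal (rieszPotential α x)) x ^ (1 / β₁)) ^ β₁,
      (∫⁻ x : R3, (Metric.ball (0 : R3) 1)ᶜ.indicator
      (fun x => ENNReal.ofReal (rieszPotential α x)) x ^ (1 / β₂)) ^ β₂, a1, a2, a3, a4,
      (by linarith : 0 < 1 - β₁ / 2), (by linarith : 0 < 1 - β₂ / 2), ?_, ?_, fun f h hf hh => ?_⟩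
  · refine ENNReal.rpow_ne_top_of_nonneg hb1.le (lintegral_rieszPotential_near hα hα' (by positivity) ?_).ne
    rw [mul_one_div, div_lt_iff₀ hb1]; linarith
  · refine ENNReal.rpow_ne_top_of_nonneg hβ₂.1.le (lintegral_rieszPotential_far hα hα'
      (by have := hβ₂.1; positivity) ?_).ne
    rw [mul_one_div, lt_div_iff₀ hβ₂.1]; linarith
  · refine le_trans (le_of_eq ?_) (add_le_add
      (hy β₁ hb1 hβ₁'.1 _ f h (hk.indicator hB) hf hh)
      (hy β₂ hβ₂.1 (by linarith) _ f h (hk.indicator hB.compl) hf hh))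
    rw [← lintegral_add_left']
    · refine lintegral_congr fun z => ?_
      by_cases hz : z.1 - z.2 ∈ Metric.ball (0 : R3) 1
      · simp [indicator, hz]
      · simp [indicator, hz]
    · refine AEMeasurable.mul (AEMeasurable.mul ?_ ?_) ?_
      · exact ((hk.indicator hB).comp (measurable_fst.sub measurable_snd)).aemeasurable
      · exact (hf.comp_quasiMeasurePreserving Measure.quasiMeasurePreserving_fst).pow_const p
      · exact (hh.comp_quasiMeasurePreserving Measure.quasiMeasurePreserving_snd).pow_const p

/-! ### The Choquard energy: finiteness, positivity, continuity. -/

/-- The Choquard double integral of two nonnegative functions. -/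
def rieszForm (α p : ℝ) (f h : R3 → ℝ≥0∞) : ℝ≥0∞ :=
  ∫⁻ z : R3 × R3, ENNReal.ofReal (rieszPotential α (z.1 - z.2)) * f z.1 ^ p * h z.2 ^ p

theorem measurable_rieszPotential_sub (α : ℝ) :
    Measurable fun z : R3 × R3 => ENNReal.ofReal (rieszPotential α (z.1 - z.2)) :=
  (measurable_rieszPotential α).ennreal_ofReal.comp (measurable_fst.sub measurable_snd)

theorem aemeasurable_riesz_mul (α p : ℝ) {h : R3 → ℝ≥0∞} (hh : AEMeasurable h volume) (x : R3) :
    AEMeasurable (fun y => ENNReal.ofReal (rieszPotential α (x - y)) * h y ^ p) volume := by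
  have h1 := measurable_rieszPotential α
  have h2 : Measurable fun y => ENNReal.ofReal (rieszPotential α (x - y)) := by fun_prop
  exact h2.aemeasurable.mul (hh.pow_const p)

theorem rieszForm_eq {α p : ℝ} {f h : R3 → ℝ≥0∞} (hf : AEMeasurable f volume)
    (hh : AEMeasurable h volume) : rieszForm α p f h =
    ∫⁻ x, (∫⁻ y, ENNReal.ofReal (rieszPotential α (x - y)) * h y ^ p) * f x ^ p := by
  rw [rieszForm, Measure.volume_eq_prod, lintegral_prod]
  · refine lintegral_congr fun x => ?_
    rw [← lintegral_mul_const'' _ (aemeasurable_riesz_mul α p hh x)]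
    refine lintegral_congr fun y => ?_
    ring
  · refine ((measurable_rieszPotential_sub α).aemeasurable.mul ?_).mul ?_
    · exact (hf.comp_quasiMeasurePreserving Measure.quasiMeasurePreserving_fst).pow_const p
    · exact (hh.comp_quasiMeasurePreserving Measure.quasiMeasurePreserving_snd).pow_const p

theorem functionalD_eq (α p : ℝ) {u : R3 → ℂ} (hu : AEStronglyMeasurable u volume) :
    functionalD α p u = rieszForm α p (fun x => ‖u x‖ₑ) (fun x => ‖u x‖ₑ) := by
  rw [rieszForm_eq hu.enorm hu.enorm]
  rfl

theorem rieszConv_congr (α p : ℝ) {u v : R3 → ℂ} (h : u =ᵐ[volume] v) (x : R3) :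
    rieszConv α p u x = rieszConv α p v x := by
  refine lintegral_congr_ae ?_
  filter_upwards [h] with y hy
  rw [hy]

theorem functionalD_congr (α p : ℝ) {u v : R3 → ℂ} (h : u =ᵐ[volume] v) :
    functionalD α p u = functionalD α p v := by
  refine lintegral_congr_ae ?_
  filter_upwards [h] with y hy
  rw [hy, rieszConv_congr α p h]

theorem rieszConv_smul (α : ℝ) {p : ℝ} (hp : 0 < p) (c : ℂ) (u : R3 → ℂ) (x : R3) :
    rieszConv α p (fun x => c * u x) x = ‖c‖ₑ ^ p * rieszConv α p u x := by
  rw [rieszConv, rieszConv, ← lintegral_const_mul' _ _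
    (ENNReal.rpow_ne_top_of_nonneg hp.le enorm_ne_top)]
  refine lintegral_congr fun y => ?_
  rw [enorm_mul, ENNReal.mul_rpow_of_nonneg _ _ hp.le]
  ring

theorem functionalD_smul (α : ℝ) {p : ℝ} (hp : 0 < p) (c : ℂ) (u : R3 → ℂ) :
    functionalD α p (fun x => c * u x) = (‖c‖ₑ ^ 2) ^ p * functionalD α p u := by
  rw [functionalD, functionalD, ← lintegral_const_mul' _ _
    (ENNReal.rpow_ne_top_of_nonneg hp.le (by simp))]
  refine lintegral_congr fun y => ?_
  rw [rieszConv_smul α hp, enorm_mul, ENNReal.mul_rpow_of_nonneg _ _ hp.le, pow_two,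
    ENNReal.mul_rpow_of_nonneg _ _ hp.le]
  ring

section finite

variable {s m α p : ℝ} {A : R3 → R3}

theorem rieszForm_lt_top (hs : 0 < s) (hs' : s < 1) (hα : 0 < α) (hα' : α < 3)
    (hp : 1 + α / 3 < p) (hp' : p < (3 + α) / (3 - 2 * s)) {f h : R3 → ℝ≥0∞}
    (hf : AEMeasurable f volume) (hh : AEMeasurable h volume)
    (hfq : ∀ q, 2 < q → q < 6 / (3 - 2 * s) → ∫⁻ x, f x ^ q < ∞)
    (hhq : ∀ q, 2 < q → q < 6 / (3 - 2 * s) → ∫⁻ x, h x ^ q < ∞) : rieszForm α p f h < ∞ := by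
  obtain ⟨q₁, q₂, b₁, b₂, K₁, K₂, h1, h2, h3, h4, h5, h6, h7, h8, H⟩ :=
    exists_riesz_bound hs hs' hα hα' hp hp'
  refine (H f h hf hh).trans_lt (ENNReal.add_lt_top.2
    ⟨ENNReal.mul_lt_top h7.lt_top (ENNReal.mul_lt_top ?_ ?_),
      ENNReal.mul_lt_top h8.lt_top (ENNReal.mul_lt_top ?_ ?_)⟩)
  · exact ENNReal.rpow_lt_top_of_nonneg h5.le (hfq q₁ h1 h2).ne
  · exact ENNReal.rpow_lt_top_of_nonneg h5.le (hhq q₁ h1 h2).ne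
  · exact ENNReal.rpow_lt_top_of_nonneg h6.le (hfq q₂ h3 h4).ne
  · exact ENNReal.rpow_lt_top_of_nonneg h6.le (hhq q₂ h3 h4).ne

theorem functionalD_lt_top (hs : 0 < s) (hs' : s < 1) (hm : 0 < m) (hα : 0 < α) (hα' : α < 3)
    (hp : 1 + α / 3 < p) (hp' : p < (3 + α) / (3 - 2 * s)) (hA : Continuous A) {u : R3 → ℂ}
    (hu : FiniteNorm s m A u) : functionalD α p u < ∞ := by
  rw [functionalD_eq _ _ hu.1]
  have h := fun q (h1 : 2 < q) (h2 : q < 6 / (3 - 2 * s)) =>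
    lintegral_rpow_lt_top hs hs' hm hA hu h1.le h2.le
  exact rieszForm_lt_top hs hs' hα hα' hp hp' hu.1.enorm hu.1.enorm h h

theorem rieszForm_add_lt_top (hs : 0 < s) (hs' : s < 1) (hm : 0 < m) (hα : 0 < α) (hα' : α < 3)
    (hp : 1 + α / 3 < p) (hp' : p < (3 + α) / (3 - 2 * s)) (hA : Continuous A) {u v : R3 → ℂ}
    (hu : FiniteNorm s m A u) (hv : FiniteNorm s m A v) :
    rieszForm α p (fun x => ‖u x‖ₑ + ‖v x‖ₑ) (fun x => ‖u x‖ₑ + ‖v x‖ₑ) < ∞ := by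
  have h := fun q (h1 : 2 < q) (h2 : q < 6 / (3 - 2 * s)) =>
    ENNReal.lintegral_rpow_add_lt_top_of_lintegral_rpow_lt_top hu.1.enorm
      (lintegral_rpow_lt_top hs hs' hm hA hu h1.le h2.le)
      (lintegral_rpow_lt_top hs hs' hm hA hv h1.le h2.le) (by linarith)
  exact rieszForm_lt_top hs hs' hα hα' hp hp' (hu.1.enorm.add hv.1.enorm)
    (hu.1.enorm.add hv.1.enorm) h h

/-- Pairing with the indicator of a ball gives a finite integral, so the potential is locally
integrable. -/
theorem ae_rieszConv_lt_top (hs : 0 < s) (hs' : s < 1) (hm : 0 < m) (hα : 0 < α) (hα' : α < 3)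
    (hp : 1 + α / 3 < p) (hp' : p < (3 + α) / (3 - 2 * s)) (hA : Continuous A) {u : R3 → ℂ}
    (hu : FiniteNorm s m A u) : ∀ᵐ x : R3, rieszConv α p u x < ∞ := by
  have hp0 : 0 < p := by linarith
  have h1 : ∀ n : ℕ, ∀ᵐ x : R3, x ∈ Metric.ball (0 : R3) n → rieszConv α p u x < ∞ := by
    intro n
    have hB : MeasurableSet (Metric.ball (0 : R3) n) := Metric.isOpen_ball.measurableSet
    have hf : Measurable ((Metric.ball (0 : R3) n).indicator (fun _ => (1 : ℝ≥0∞))) :=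
      measurable_const.indicator hB
    have hpow : ∀ q : ℝ, 0 < q → ∀ x, (Metric.ball (0 : R3) n).indicator (fun _ => (1 : ℝ≥0∞)) x ^ q
        = (Metric.ball (0 : R3) n).indicator (fun _ => (1 : ℝ≥0∞)) x := fun q hq x => by
      by_cases hx : x ∈ Metric.ball (0 : R3) n
      · rw [indicator_of_mem hx, ENNReal.one_rpow]
      · rw [indicator_of_notMem hx, ENNReal.zero_rpow_of_pos hq]
    have h2 := rieszForm_lt_top hs hs' hα hα' hp hp' hf.aemeasurable hu.1.enorm
      (fun q hq _ => by
        simp only [hpow q (by linarith)]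
        rw [lintegral_indicator hB, setLIntegral_const, one_mul]
        exact measure_ball_lt_top)
      (fun q h1 h2 => lintegral_rpow_lt_top hs hs' hm hA hu h1.le h2.le)
    rw [rieszForm_eq hf.aemeasurable hu.1.enorm] at h2
    simp only [hpow p hp0] at h2
    have h3 : ∫⁻ x in Metric.ball (0 : R3) n, rieszConv α p u x < ∞ := by
      rw [← lintegral_indicator hB]
      refine lt_of_le_of_lt (lintegral_mono fun x => ?_) h2
      by_cases hx : x ∈ Metric.ball (0 : R3) n
      · rw [indicator_of_mem hx, indicator_of_mem hx, mul_one]; rfl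
      · rw [indicator_of_notMem hx]; exact zero_le
    have hmeas : AEMeasurable (rieszConv α p u) volume := by
      have : AEMeasurable (fun z : R3 × R3 => ENNReal.ofReal (rieszPotential α (z.1 - z.2)) *
          ‖u z.2‖ₑ ^ p) (volume.prod volume) :=
        (measurable_rieszPotential_sub α).aemeasurable.mul
          ((hu.1.enorm.comp_quasiMeasurePreserving Measure.quasiMeasurePreserving_snd).pow_const p)
      exact this.lintegral_prod_right'
    have h4 := ae_lt_top' hmeas.restrict h3.ne
    rwa [ae_restrict_iff' hB] at h4
  filter_upwards [ae_all_iff.2 h1] with x hx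
  obtain ⟨n, hn⟩ := exists_nat_gt ‖x‖
  exact hx n (by simpa using hn)

theorem aemeasurable_rieszConv (α p : ℝ) {u : R3 → ℂ} (hu : AEStronglyMeasurable u volume) :
    AEMeasurable (rieszConv α p u) volume := by
  have : AEMeasurable (fun z : R3 × R3 => ENNReal.ofReal (rieszPotential α (z.1 - z.2)) *
      ‖u z.2‖ₑ ^ p) (volume.prod volume) :=
    (measurable_rieszPotential_sub α).aemeasurable.mul
      ((hu.enorm.comp_quasiMeasurePreserving Measure.quasiMeasurePreserving_snd).pow_const p)
  exact this.lintegral_prod_right'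

/-- The Riesz kernel is positive off the diagonal, so the potential of a nonzero function vanishes
nowhere. -/
theorem functionalD_pos (hα : 0 < α) (hα' : α < 3) (hp : 0 < p) {u : R3 → ℂ}
    (hu : AEStronglyMeasurable u volume) (hne : ¬ u =ᵐ[volume] 0) : 0 < functionalD α p u := by
  rw [pos_iff_ne_zero]
  intro h0
  refine hne ?_
  have hpos : ∀ x, ¬ u =ᵐ[volume] 0 → rieszConv α p u x ≠ 0 := by
    intro x hx h
    refine hx ?_
    rw [rieszConv, lintegral_eq_zero_iff' (aemeasurable_riesz_mul α p hu.enorm x)] at h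
    have hxy : ∀ᵐ y : R3, y ≠ x := by simp [ae_iff]
    filter_upwards [h, hxy] with y hy hxy
    simp only [Pi.zero_apply, mul_eq_zero] at hy
    rcases hy with hy | hy
    · have := rieszPotential_pos hα hα' (sub_ne_zero.2 hxy.symm)
      rw [ENNReal.ofReal_eq_zero] at hy
      linarith
    · rw [ENNReal.rpow_eq_zero_iff_of_pos hp] at hy
      simpa using hy
  have hm : AEMeasurable (fun x => rieszConv α p u x * ‖u x‖ₑ ^ p) volume :=
    (aemeasurable_rieszConv α p hu).mul (hu.enorm.pow_const p)
  rw [functionalD, lintegral_eq_zero_iff' hm] at h0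
  filter_upwards [h0] with x hx
  simp only [Pi.zero_apply, mul_eq_zero] at hx
  rcases hx with hx | hx
  · exact absurd hx (hpos x hne)
  · rw [ENNReal.rpow_eq_zero_iff_of_pos hp] at hx
    simpa using hx

/-- Minkowski's inequality in $L^p$ of the measure $I_\alpha(x-y)\,dx\,dy$. -/
theorem lintegral_riesz_add_le (α : ℝ) (hp : 1 ≤ p) {f g : R3 × R3 → ℝ≥0∞}
    (hf : AEMeasurable f volume) (hg : AEMeasurable g volume) :
    (∫⁻ z : R3 × R3, ENNReal.ofReal (rieszPotential α (z.1 - z.2)) * (f z + g z) ^ p) ^ (1 / p) ≤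
    (∫⁻ z : R3 × R3, ENNReal.ofReal (rieszPotential α (z.1 - z.2)) * f z ^ p) ^ (1 / p) +
    (∫⁻ z : R3 × R3, ENNReal.ofReal (rieszPotential α (z.1 - z.2)) * g z ^ p) ^ (1 / p) := by
  have hI := measurable_rieszPotential_sub α
  set ρ := (volume : Measure (R3 × R3)).withDensity
    fun z => ENNReal.ofReal (rieszPotential α (z.1 - z.2)) with hρ
  have hac : ρ ≪ volume := withDensity_absolutelyContinuous _ _
  have h := ENNReal.lintegral_Lp_add_le (μ := ρ) (hf.mono_ac hac) (hg.mono_ac hac) hp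
  rw [hρ, lintegral_withDensity_eq_lintegral_mul₀ hI.aemeasurable ((hf.add hg).pow_const p),
    lintegral_withDensity_eq_lintegral_mul₀ hI.aemeasurable (hf.pow_const p),
    lintegral_withDensity_eq_lintegral_mul₀ hI.aemeasurable (hg.pow_const p)] at h
  exact h

/-- $\mathcal D(u)^{1/p}$ is the $L^p$ norm of $|u(x)||u(y)|$ for the Riesz measure. Expanding the
product into four terms separates $\mathcal D(u)$ from cross terms, so a Brezis–Lieb splitting is
not needed. -/
theorem rieszForm_add_self_le (α : ℝ) (hp : 1 ≤ p) {a b : R3 → ℝ≥0∞} (ha : AEMeasurable a volume)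
    (hb : AEMeasurable b volume) :
    rieszForm α p (a + b) (a + b) ^ (1 / p) ≤ rieszForm α p a a ^ (1 / p) +
      (rieszForm α p a b ^ (1 / p) + (rieszForm α p b a ^ (1 / p) + rieszForm α p b b ^ (1 / p))) := by
  have hp0 : 0 ≤ p := by linarith
  have e : ∀ f h : R3 → ℝ≥0∞, rieszForm α p f h = ∫⁻ z : R3 × R3,
      ENNReal.ofReal (rieszPotential α (z.1 - z.2)) * (f z.1 * h z.2) ^ p := fun f h => by
    refine lintegral_congr fun z => ?_
    rw [ENNReal.mul_rpow_of_nonneg _ _ hp0, mul_assoc]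
  have h1 : ∀ f : R3 → ℝ≥0∞, AEMeasurable f volume → AEMeasurable (fun z : R3 × R3 => f z.1) volume :=
    fun f hf => hf.comp_quasiMeasurePreserving Measure.quasiMeasurePreserving_fst
  have h2 : ∀ f : R3 → ℝ≥0∞, AEMeasurable f volume → AEMeasurable (fun z : R3 × R3 => f z.2) volume :=
    fun f hf => hf.comp_quasiMeasurePreserving Measure.quasiMeasurePreserving_snd
  simp only [e]
  have e2 : ∀ z : R3 × R3, (a + b) z.1 * (a + b) z.2 = a z.1 * a z.2 + (a z.1 * b z.2 +
      (b z.1 * a z.2 + b z.1 * b z.2)) := fun z => by simp only [Pi.add_apply]; ring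
  simp only [e2]
  have hm : ∀ f h : R3 → ℝ≥0∞, AEMeasurable f volume → AEMeasurable h volume →
      AEMeasurable (fun z : R3 × R3 => f z.1 * h z.2) volume := fun f h hf hh => (h1 f hf).mul (h2 h hh)
  have aa := hm a a ha ha
  have ab := hm a b ha hb
  have ba := hm b a hb ha
  have bb := hm b b hb hb
  have l1 := lintegral_riesz_add_le α hp aa (ab.add (ba.add bb))
  have l2 := lintegral_riesz_add_le α hp ab (ba.add bb)
  have l3 := lintegral_riesz_add_le α hp ba bb
  exact l1.trans (add_le_add le_rfl (l2.trans (add_le_add le_rfl l3)))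

/-- The bound is a product of norms of the two factors; one factor tending to zero suffices when the
other has finite limits. -/
theorem tendsto_rieszForm_zero (hs : 0 < s) (hs' : s < 1) (hα : 0 < α) (hα' : α < 3)
    (hp : 1 + α / 3 < p) (hp' : p < (3 + α) / (3 - 2 * s)) {f h : ℕ → R3 → ℝ≥0∞}
    (hf : ∀ n, AEMeasurable (f n) volume) (hh : ∀ n, AEMeasurable (h n) volume)
    (hfq : ∀ q, 2 < q → q < 6 / (3 - 2 * s) → ∃ a : ℝ≥0∞, a ≠ ∞ ∧
      Tendsto (fun n => ∫⁻ x, f n x ^ q) atTop (𝓝 a))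
    (hhq : ∀ q, 2 < q → q < 6 / (3 - 2 * s) → ∃ a : ℝ≥0∞, a ≠ ∞ ∧
      Tendsto (fun n => ∫⁻ x, h n x ^ q) atTop (𝓝 a))
    (hz : ∀ q, 2 < q → q < 6 / (3 - 2 * s) → Tendsto (fun n => ∫⁻ x, f n x ^ q) atTop (𝓝 0) ∨
      Tendsto (fun n => ∫⁻ x, h n x ^ q) atTop (𝓝 0)) :
    Tendsto (fun n => rieszForm α p (f n) (h n) ^ (1 / p)) atTop (𝓝 0) := by
  obtain ⟨q₁, q₂, b₁, b₂, K₁, K₂, h1, h2, h3, h4, h5, h6, h7, h8, H⟩ :=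
    exists_riesz_bound hs hs' hα hα' hp hp'
  have hp0 : 0 < 1 / p := by have : 0 < p := by linarith
                             positivity
  have hprod : ∀ q b : ℝ, ∀ K : ℝ≥0∞, 2 < q → q < 6 / (3 - 2 * s) → 0 < b → K ≠ ∞ →
      Tendsto (fun n => K * ((∫⁻ x, f n x ^ q) ^ b * (∫⁻ x, h n x ^ q) ^ b)) atTop (𝓝 0) := by
    intro q b K hq hq' hb hK
    obtain ⟨a, ha, hfa⟩ := hfq q hq hq'
    obtain ⟨c, hc, hhc⟩ := hhq q hq hq'
    have t1 := ((ENNReal.continuous_rpow_const (y := b)).tendsto a).comp hfa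
    have t2 := ((ENNReal.continuous_rpow_const (y := b)).tendsto c).comp hhc
    have ha' : a ^ b ≠ ∞ := ENNReal.rpow_ne_top_of_nonneg hb.le ha
    have hc' : c ^ b ≠ ∞ := ENNReal.rpow_ne_top_of_nonneg hb.le hc
    have t3 := ENNReal.Tendsto.const_mul (a := K)
      (ENNReal.Tendsto.mul t1 (Or.inr hc') t2 (Or.inr ha')) (Or.inr hK)
    have hac : a = 0 ∨ c = 0 := (hz q hq hq').imp (tendsto_nhds_unique hfa) (tendsto_nhds_unique hhc)
    have : K * (a ^ b * c ^ b) = 0 := by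
      rcases hac with rfl | rfl <;> simp [ENNReal.zero_rpow_of_pos hb]
    rwa [this] at t3
  have t := (hprod q₁ b₁ K₁ h1 h2 h5 h7).add (hprod q₂ b₂ K₂ h3 h4 h6 h8)
  rw [add_zero] at t
  have t0 : Tendsto (fun n => rieszForm α p (f n) (h n)) atTop (𝓝 0) :=
    tendsto_of_tendsto_of_tendsto_of_le_of_le tendsto_const_nhds t (fun _ => zero_le)
      fun n => H _ _ (hf n) (hh n)
  have := ((ENNReal.continuous_rpow_const (y := 1 / p)).tendsto 0).comp t0
  rwa [ENNReal.zero_rpow_of_pos hp0] at this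

/-- Upper semicontinuity of `D` under strong subcritical convergence. -/
theorem one_le_functionalD_of_tendsto (hs : 0 < s) (hs' : s < 1) (hm : 0 < m) (hα : 0 < α)
    (hα' : α < 3) (hp : 1 + α / 3 < p) (hp' : p < (3 + α) / (3 - 2 * s)) (hA : Continuous A)
    {u : R3 → ℂ} (hu : FiniteNorm s m A u) {v w : ℕ → R3 → ℂ}
    (hw : ∀ n, AEStronglyMeasurable (w n) volume) (hv : ∀ n, AEStronglyMeasurable (v n) volume)
    (hvw : ∀ n, v n =ᵐ[volume] u + w n) (hD : ∀ n, functionalD α p (v n) = 1)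
    (hlim : ∀ q, 2 < q → q < 6 / (3 - 2 * s) → Tendsto (fun n => ∫⁻ x, ‖w n x‖ₑ ^ q) atTop (𝓝 0)) :
    1 ≤ functionalD α p u := by
  have hp1 : 1 ≤ p := by linarith
  have hp0 : 0 < p := by linarith
  have hip : 0 < 1 / p := by positivity
  have hl1 := fun q (h1 : 2 < q) (h2 : q < 6 / (3 - 2 * s)) =>
    (⟨_, (lintegral_rpow_lt_top hs hs' hm hA hu h1.le h2.le).ne, tendsto_const_nhds⟩ :
      ∃ a : ℝ≥0∞, a ≠ ∞ ∧ Tendsto (fun _ : ℕ => ∫⁻ x, ‖u x‖ₑ ^ q) atTop (𝓝 a))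
  have hl2 := fun q (h1 : 2 < q) (h2 : q < 6 / (3 - 2 * s)) =>
    (⟨0, ENNReal.zero_ne_top, hlim q h1 h2⟩ :
      ∃ a : ℝ≥0∞, a ≠ ∞ ∧ Tendsto (fun n : ℕ => ∫⁻ x, ‖w n x‖ₑ ^ q) atTop (𝓝 a))
  have t1 := tendsto_rieszForm_zero hs hs' hα hα' hp hp' (fun _ => hu.1.enorm)
    (fun n => (hw n).enorm) hl1 hl2 fun q h1 h2 => Or.inr (hlim q h1 h2)
  have t2 := tendsto_rieszForm_zero hs hs' hα hα' hp hp' (fun n => (hw n).enorm)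
    (fun _ => hu.1.enorm) hl2 hl1 fun q h1 h2 => Or.inl (hlim q h1 h2)
  have t3 := tendsto_rieszForm_zero hs hs' hα hα' hp hp' (fun n => (hw n).enorm)
    (fun n => (hw n).enorm) hl2 hl2 fun q h1 h2 => Or.inl (hlim q h1 h2)
  have t := (t1.add (t2.add t3)).const_add (functionalD α p u ^ (1 / p))
  rw [add_zero, add_zero, add_zero] at t
  have h1 : 1 ≤ functionalD α p u ^ (1 / p) := by
    refine ge_of_tendsto' t fun n => ?_
    rw [functionalD_eq _ _ hu.1]
    refine le_trans ?_ (rieszForm_add_self_le α hp1 hu.1.enorm (hw n).enorm)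
    have h2 : 1 ≤ rieszForm α p ((fun x => ‖u x‖ₑ) + fun x => ‖w n x‖ₑ)
        ((fun x => ‖u x‖ₑ) + fun x => ‖w n x‖ₑ) := by
      rw [← hD n, functionalD_eq _ _ (hv n), rieszForm_eq (hv n).enorm (hv n).enorm,
        rieszForm_eq (hu.1.enorm.add (hw n).enorm) (hu.1.enorm.add (hw n).enorm)]
      have hle : ∀ᵐ x, ‖v n x‖ₑ ≤ ((fun x => ‖u x‖ₑ) + fun x => ‖w n x‖ₑ) x := by
        filter_upwards [hvw n] with x hx
        rw [hx]
        exact enorm_add_le _ _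
      refine lintegral_mono_ae ?_
      filter_upwards [hle] with x hx
      refine mul_le_mul' (lintegral_mono_ae ?_) (by gcongr)
      filter_upwards [hle] with y hy
      gcongr
    calc (1 : ℝ≥0∞) = 1 ^ (1 / p) := (ENNReal.one_rpow _).symm
      _ ≤ _ := by gcongr
  calc (1 : ℝ≥0∞) = 1 ^ p := (ENNReal.one_rpow _).symm
    _ ≤ (functionalD α p u ^ (1 / p)) ^ p := by gcongr
    _ = _ := by rw [← ENNReal.rpow_mul, one_div_mul_cancel hp0.ne', ENNReal.rpow_one]

end finite

/-! ### Linear structure of the magnetic Sobolev space. -/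

theorem magDiff_add (A : R3 → R3) (u v : R3 → ℂ) (x y : R3) :
    magDiff A (u + v) x y = magDiff A u x y + magDiff A v x y := by
  simp only [magDiff, Pi.add_apply]; ring

theorem magDiff_smul (A : R3 → R3) (c : ℂ) (u : R3 → ℂ) (x y : R3) :
    magDiff A (c • u) x y = c * magDiff A u x y := by
  simp only [magDiff, Pi.smul_apply, smul_eq_mul]; ring

theorem magDiff_congr (A : R3 → R3) {u v : R3 → ℂ} (h : u =ᵐ[volume] v) :
    (fun z : R3 × R3 => magDiff A u z.1 z.2) =ᵐ[volume] fun z => magDiff A v z.1 z.2 := by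
  filter_upwards [Measure.quasiMeasurePreserving_fst.ae_eq_comp h,
    Measure.quasiMeasurePreserving_snd.ae_eq_comp h] with z h1 h2
  simp only [Function.comp_apply] at h1 h2
  simp only [magDiff, h1, h2]

theorem normSq_congr (s m : ℝ) (A : R3 → R3) {u v : R3 → ℂ} (h : u =ᵐ[volume] v) :
    normSq s m A u = normSq s m A v := by
  unfold normSq
  congr 2
  · refine lintegral_congr_ae ?_
    filter_upwards [magDiff_congr A h] with z hz
    rw [hz]
  · refine lintegral_congr_ae ?_
    filter_upwards [h] with z hz
    rw [hz]

theorem normSq_smul (s m : ℝ) (A : R3 → R3) (c : ℂ) (u : R3 → ℂ) :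
    normSq s m A (c • u) = ‖c‖ₑ ^ 2 * normSq s m A u := by
  unfold normSq
  simp only [magDiff_smul, Pi.smul_apply, smul_eq_mul, enorm_mul, mul_pow, mul_assoc]
  rw [lintegral_const_mul' _ _ (by simp), lintegral_const_mul' _ _ (by simp)]
  ring

/-- From $|a+b|^2\le2|a|^2+2|b|^2$; this crude form is enough for closure arguments and explains the
$\varepsilon/4$ used there. -/
theorem normSq_add_le (s m : ℝ) {A : R3 → R3} (hA : Continuous A) {u v : R3 → ℂ}
    (hu : AEStronglyMeasurable u volume) :
    normSq s m A (u + v) ≤ 2 * normSq s m A u + 2 * normSq s m A v := by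
  have h1 : ∫⁻ z : R3 × R3, ‖magDiff A (u + v) z.1 z.2‖ₑ ^ 2 * ENNReal.ofReal (kernel s m (z.1 - z.2))
      ≤ 2 * (∫⁻ z : R3 × R3, ‖magDiff A u z.1 z.2‖ₑ ^ 2 * ENNReal.ofReal (kernel s m (z.1 - z.2))) +
        2 * ∫⁻ z : R3 × R3, ‖magDiff A v z.1 z.2‖ₑ ^ 2 * ENNReal.ofReal (kernel s m (z.1 - z.2)) := by
    rw [← lintegral_const_mul' _ _ (by simp), ← lintegral_const_mul' _ _ (by simp),
      ← lintegral_add_left' ((aemeasurable_energy_integrand s m hA hu).const_mul 2)]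
    refine lintegral_mono fun z => ?_
    rw [← mul_assoc, ← mul_assoc, ← add_mul, magDiff_add]
    gcongr
    exact (pow_le_pow_left₀ zero_le (enorm_add_le _ _) 2).trans (ennreal_add_sq_le _ _)
  have h2 : ∫⁻ x : R3, ‖(u + v) x‖ₑ ^ 2 ≤ 2 * (∫⁻ x : R3, ‖u x‖ₑ ^ 2) + 2 * ∫⁻ x : R3, ‖v x‖ₑ ^ 2 := by
    rw [← lintegral_const_mul' _ _ (by simp), ← lintegral_const_mul' _ _ (by simp),
      ← lintegral_add_left' ((hu.enorm.pow_const 2).const_mul 2)]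
    refine lintegral_mono fun z => ?_
    exact (pow_le_pow_left₀ zero_le (enorm_add_le _ _) 2).trans (ennreal_add_sq_le _ _)
  unfold normSq
  refine (add_le_add (mul_le_mul_right h1 _) (mul_le_mul_right h2 _)).trans_eq ?_
  ring

theorem FiniteNorm.add {s m : ℝ} {A : R3 → R3} (hA : Continuous A) {u v : R3 → ℂ}
    (hu : FiniteNorm s m A u) (hv : FiniteNorm s m A v) : FiniteNorm s m A (u + v) := by
  refine ⟨hu.1.add hv.1, (normSq_add_le s m hA hu.1).trans_lt ?_⟩
  exact ENNReal.add_lt_top.2 ⟨ENNReal.mul_lt_top (by simp) hu.2, ENNReal.mul_lt_top (by simp) hv.2⟩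

theorem FiniteNorm.smul {s m : ℝ} {A : R3 → R3} (c : ℂ) {u : R3 → ℂ}
    (hu : FiniteNorm s m A u) : FiniteNorm s m A (c • u) := by
  refine ⟨hu.1.const_smul c, ?_⟩
  rw [normSq_smul]
  exact ENNReal.mul_lt_top (by simp) hu.2

theorem HsA_congr {s m : ℝ} {A : R3 → R3} {u v : R3 → ℂ} (h : u =ᵐ[volume] v)
    (hu : u ∈ HsA s m A) : v ∈ HsA s m A := by
  refine ⟨⟨hu.1.1.congr h, by rw [← normSq_congr s m A h]; exact hu.1.2⟩, fun ε hε => ?_⟩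
  obtain ⟨φ, h1, h2, h3⟩ := hu.2 ε hε
  refine ⟨φ, h1, h2, ?_⟩
  rwa [← normSq_congr s m A (h.sub (EventuallyEq.refl _ φ))]

/-- The closure of the test functions is itself closed. -/
theorem HsA_of_approx {s m : ℝ} {A : R3 → R3} (hA : Continuous A) {u : R3 → ℂ}
    (hu : FiniteNorm s m A u)
    (h : ∀ ε : ℝ≥0∞, 0 < ε → ∃ v ∈ HsA s m A, normSq s m A (u - v) < ε) : u ∈ HsA s m A := by
  refine ⟨hu, fun ε hε => ?_⟩
  have hε4 : 0 < ε / 4 := ENNReal.div_pos hε.ne' (by simp)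
  obtain ⟨v, hv, h1⟩ := h (ε / 4) hε4
  obtain ⟨φ, h2, h3, h4⟩ := hv.2 (ε / 4) hε4
  refine ⟨φ, h2, h3, ?_⟩
  rw [show u - φ = (u - v) + (v - φ) by abel]
  refine (normSq_add_le s m hA (hu.1.sub hv.1.1)).trans_lt ?_
  calc 2 * normSq s m A (u - v) + 2 * normSq s m A (v - φ) < 2 * (ε / 4) + 2 * (ε / 4) := by
        refine ENNReal.add_lt_add ?_ ?_
        · exact (ENNReal.mul_lt_mul_iff_right (by simp) (by simp)).2 h1
        · exact (ENNReal.mul_lt_mul_iff_right (by simp) (by simp)).2 h4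
    _ = ε := by
      rw [← two_mul, ← mul_assoc, show (2 : ℝ≥0∞) * 2 = 4 by norm_num,
        ENNReal.mul_div_cancel (by simp) (by simp)]

theorem HsA_smul {s m : ℝ} {A : R3 → R3} (c : ℂ) {u : R3 → ℂ}
    (hu : u ∈ HsA s m A) : c • u ∈ HsA s m A := by
  refine ⟨hu.1.smul c, fun ε hε => ?_⟩
  rcases eq_or_ne c 0 with rfl | hc
  · refine ⟨0, contDiff_const, HasCompactSupport.zero, ?_⟩
    have : (0 : ℂ) • u - 0 = (0 : ℂ) • u := by simp
    rw [this, normSq_smul]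
    simpa using hε
  · have hc0 : ‖c‖ₑ ^ 2 ≠ 0 := by simpa using hc
    have hct : ‖c‖ₑ ^ 2 ≠ ∞ := by simp
    obtain ⟨φ, h1, h2, h3⟩ := hu.2 (ε / ‖c‖ₑ ^ 2) (ENNReal.div_pos hε.ne' hct)
    refine ⟨c • φ, contDiff_const.smul h1, h2.smul_left (f := fun _ => c), ?_⟩
    rw [← smul_sub, normSq_smul, mul_comm]
    rwa [ENNReal.lt_div_iff_mul_lt (Or.inl hc0) (Or.inl hct)] at h3

theorem HsA_add {s m : ℝ} {A : R3 → R3} (hA : Continuous A) {u v : R3 → ℂ}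
    (hu : u ∈ HsA s m A) (hv : v ∈ HsA s m A) : u + v ∈ HsA s m A := by
  refine ⟨hu.1.add hA hv.1, fun ε hε => ?_⟩
  have hε4 : 0 < ε / 4 := ENNReal.div_pos hε.ne' (by simp)
  obtain ⟨φ, h1, h2, h3⟩ := hu.2 (ε / 4) hε4
  obtain ⟨ψ, h4, h5, h6⟩ := hv.2 (ε / 4) hε4
  refine ⟨φ + ψ, h1.add h4, h2.add h5, ?_⟩
  rw [show u + v - (φ + ψ) = (u - φ) + (v - ψ) by abel]
  refine (normSq_add_le s m hA (hu.1.1.sub h1.continuous.aestronglyMeasurable)).trans_lt ?_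
  calc 2 * normSq s m A (u - φ) + 2 * normSq s m A (v - ψ) < 2 * (ε / 4) + 2 * (ε / 4) := by
        refine ENNReal.add_lt_add ?_ ?_
        · exact (ENNReal.mul_lt_mul_iff_right (by simp) (by simp)).2 h3
        · exact (ENNReal.mul_lt_mul_iff_right (by simp) (by simp)).2 h6
    _ = ε := by
      rw [← two_mul, ← mul_assoc, show (2 : ℝ≥0∞) * 2 = 4 by norm_num,
        ENNReal.mul_div_cancel (by simp) (by simp)]

/-! ### Realization as a closed subspace of a Hilbert space. -/

/-- The measure on `ℝ³ × ℝ³` of the Gagliardo energy. -/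
def energyMeasure (s m : ℝ) : Measure (R3 × R3) :=
  volume.withDensity fun z => ENNReal.ofReal (constC s / 2 * m ^ ((3 + 2 * s) / 2) * kernel s m (z.1 - z.2))

/-- The measure on `ℝ³` of the mass term. -/
def massMeasure (s m : ℝ) : Measure R3 :=
  volume.withDensity fun _ => ENNReal.ofReal (m ^ (2 * s))

instance (s m : ℝ) : SigmaFinite (energyMeasure s m) := SigmaFinite.withDensity_ofReal _

instance (s m : ℝ) : SigmaFinite (massMeasure s m) := SigmaFinite.withDensity_ofReal _

theorem energyMeasure_ac (s m : ℝ) : energyMeasure s m ≪ volume := withDensity_absolutelyContinuous _ _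

theorem massMeasure_ac (s m : ℝ) : massMeasure s m ≪ volume := withDensity_absolutelyContinuous _ _

/-- The weight $m^{2s}$ is positive, so almost-everywhere statements pass back from the mass measure
to Lebesgue measure. -/
theorem ac_massMeasure (s : ℝ) {m : ℝ} (hm : 0 < m) : volume ≪ massMeasure s m :=
  withDensity_absolutelyContinuous' aemeasurable_const (ae_of_all _ fun _ => by
    rw [ENNReal.ofReal_ne_zero_iff]; positivity)

theorem measurable_kernel_sub (s m : ℝ) : Measurable fun z : R3 × R3 => kernel s m (z.1 - z.2) :=
  (measurable_kernel s m).comp (measurable_fst.sub measurable_snd)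

theorem measurable_energyWeight (s m : ℝ) : Measurable fun z : R3 × R3 =>
    ENNReal.ofReal (constC s / 2 * m ^ ((3 + 2 * s) / 2) * kernel s m (z.1 - z.2)) :=
  ((measurable_kernel_sub s m).const_mul _).ennreal_ofReal

theorem integral_energyMeasure (s m : ℝ) (F : R3 × R3 → ℂ) : ∫ z, F z ∂energyMeasure s m =
    ∫ z, (ENNReal.ofReal (constC s / 2 * m ^ ((3 + 2 * s) / 2) *
      kernel s m (z.1 - z.2))).toReal • F z :=
  integral_withDensity_eq_integral_toReal_smul (measurable_energyWeight s m) (by simp) F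

theorem integral_massMeasure (s : ℝ) {m : ℝ} (hm : 0 < m) (F : R3 → ℂ) : ∫ x, F x ∂massMeasure s m =
    m ^ (2 * s) • ∫ x, F x := by
  rw [massMeasure, integral_withDensity_eq_integral_toReal_smul measurable_const (by simp),
    integral_smul, ENNReal.toReal_ofReal (by positivity)]

theorem normSq_eq {s m : ℝ} (hs : 0 < s) (hs' : s < 1) (hm : 0 < m) {A : R3 → R3} (hA : Continuous A)
    {u : R3 → ℂ} (hu : AEStronglyMeasurable u volume) : normSq s m A u =
    (∫⁻ z, ‖magDiff A u z.1 z.2‖ₑ ^ 2 ∂energyMeasure s m) + ∫⁻ x, ‖u x‖ₑ ^ 2 ∂massMeasure s m := by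
  have hc : 0 < constC s / 2 * m ^ ((3 + 2 * s) / 2) := by
    have := constC_pos hs hs'; positivity
  rw [energyMeasure, massMeasure, lintegral_withDensity_eq_lintegral_mul₀
    (measurable_energyWeight s m).aemeasurable
    ((aestronglyMeasurable_magDiff hA hu).enorm.pow_const 2),
    lintegral_withDensity_eq_lintegral_mul₀ aemeasurable_const (hu.enorm.pow_const 2), normSq]
  simp only [Pi.mul_apply]
  rw [lintegral_const_mul' _ _ ENNReal.ofReal_ne_top, ← lintegral_const_mul' _ _ ENNReal.ofReal_ne_top]
  congr 1
  refine lintegral_congr fun z => ?_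
  rw [ENNReal.ofReal_mul hc.le]
  ring

/-- Serves the separability of the $L^2$ factors, on which sequential weak compactness depends. -/
instance fact_two_ne_top : Fact ((2 : ℝ≥0∞) ≠ ∞) := ⟨by simp⟩

/-- The ambient Hilbert space of pairs (magnetic difference, function). -/
abbrev Ambient (s m : ℝ) : Type := WithLp 2 (Lp ℂ 2 (energyMeasure s m) × Lp ℂ 2 (massMeasure s m))

theorem enorm_sq_Lp {β : Type*} [MeasurableSpace β] {μ : Measure β} (f : Lp ℂ 2 μ) :
    ‖f‖ₑ ^ 2 = ∫⁻ x, ‖f x‖ₑ ^ 2 ∂μ := by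
  have := eLpNorm_nnreal_pow_eq_lintegral (μ := μ) (f := f) (p := 2) (by norm_num)
  simpa [Lp.enorm_def] using this

theorem enorm_sq_ambient {s m : ℝ} (e : Ambient s m) : ‖e‖ₑ ^ 2 =
    (∫⁻ z, ‖e.fst z‖ₑ ^ 2 ∂energyMeasure s m) + ∫⁻ x, ‖e.snd x‖ₑ ^ 2 ∂massMeasure s m := by
  rw [← enorm_sq_Lp, ← enorm_sq_Lp]
  have h : ∀ {X : Type} [NormedAddCommGroup X] (x : X), ‖x‖ₑ ^ 2 = ENNReal.ofReal (‖x‖ ^ 2) := by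
    intro X _ x
    rw [ENNReal.ofReal_pow (norm_nonneg _), ofReal_norm]
  rw [h, h, h, WithLp.prod_norm_sq_eq_of_L2, ENNReal.ofReal_add (by positivity) (by positivity)]

theorem memLp_two_of_lintegral {β : Type*} [MeasurableSpace β] {μ : Measure β} {f : β → ℂ}
    (hf : AEStronglyMeasurable f μ) (h : ∫⁻ x, ‖f x‖ₑ ^ 2 ∂μ < ∞) : MemLp f 2 μ := by
  refine ⟨hf, ?_⟩
  rw [eLpNorm_lt_top_iff_lintegral_rpow_enorm_lt_top (by simp) (by simp)]
  simpa using h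

theorem FiniteNorm.memLp_magDiff {s m : ℝ} (hs : 0 < s) (hs' : s < 1) (hm : 0 < m) {A : R3 → R3}
    (hA : Continuous A) {u : R3 → ℂ} (hu : FiniteNorm s m A u) :
    MemLp (fun z : R3 × R3 => magDiff A u z.1 z.2) 2 (energyMeasure s m) := by
  refine memLp_two_of_lintegral ((aestronglyMeasurable_magDiff hA hu.1).mono_ac (energyMeasure_ac s m)) ?_
  have := hu.2
  rw [normSq_eq hs hs' hm hA hu.1] at this
  exact lt_of_le_of_lt le_self_add this

theorem FiniteNorm.memLp {s m : ℝ} (hs : 0 < s) (hs' : s < 1) (hm : 0 < m) {A : R3 → R3}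
    (hA : Continuous A) {u : R3 → ℂ} (hu : FiniteNorm s m A u) : MemLp u 2 (massMeasure s m) := by
  refine memLp_two_of_lintegral (hu.1.mono_ac (massMeasure_ac s m)) ?_
  have := hu.2
  rw [normSq_eq hs hs' hm hA hu.1] at this
  exact lt_of_le_of_lt le_add_self this

section space

variable {s m : ℝ} {A : R3 → R3}

/-- Pairs consisting of a magnetic difference and its function. -/
def IsGraph (s m : ℝ) (A : R3 → R3) (e : Ambient s m) : Prop :=
  (e.fst : R3 × R3 → ℂ) =ᵐ[energyMeasure s m] fun z => magDiff A e.snd z.1 z.2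

theorem aestronglyMeasurable_snd (hm : 0 < m) (e : Ambient s m) :
    AEStronglyMeasurable (e.snd : R3 → ℂ) volume :=
  (Lp.aestronglyMeasurable e.snd).mono_ac (ac_massMeasure s hm)

/-- On graph pairs the second component determines the first, so the space $H^s_A$ sits
isometrically in the ambient Hilbert space. -/
theorem IsGraph.normSq_snd (hs : 0 < s) (hs' : s < 1) (hm : 0 < m) (hA : Continuous A)
    {e : Ambient s m} (he : IsGraph s m A e) : normSq s m A e.snd = ‖e‖ₑ ^ 2 := by
  rw [normSq_eq hs hs' hm hA (aestronglyMeasurable_snd hm e), enorm_sq_ambient]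
  congr 1
  refine lintegral_congr_ae ?_
  filter_upwards [he] with z hz
  rw [hz]

theorem IsGraph.finiteNorm (hs : 0 < s) (hs' : s < 1) (hm : 0 < m) (hA : Continuous A)
    {e : Ambient s m} (he : IsGraph s m A e) : FiniteNorm s m A e.snd :=
  ⟨aestronglyMeasurable_snd hm e, by rw [he.normSq_snd hs hs' hm hA]; simp⟩

theorem snd_add_ae (hm : 0 < m) (e f : Ambient s m) :
    ((e + f).snd : R3 → ℂ) =ᵐ[volume] (e.snd : R3 → ℂ) + (f.snd : R3 → ℂ) :=
  (ac_massMeasure s hm).ae_eq (Lp.coeFn_add e.snd f.snd)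

theorem snd_sub_ae (hm : 0 < m) (e f : Ambient s m) :
    ((e - f).snd : R3 → ℂ) =ᵐ[volume] (e.snd : R3 → ℂ) - (f.snd : R3 → ℂ) :=
  (ac_massMeasure s hm).ae_eq (Lp.coeFn_sub e.snd f.snd)

theorem snd_smul_ae (hm : 0 < m) (c : ℂ) (e : Ambient s m) :
    ((c • e).snd : R3 → ℂ) =ᵐ[volume] c • (e.snd : R3 → ℂ) :=
  (ac_massMeasure s hm).ae_eq (Lp.coeFn_smul c e.snd)

theorem IsGraph.add (hm : 0 < m) {e f : Ambient s m} (he : IsGraph s m A e) (hf : IsGraph s m A f) :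
    IsGraph s m A (e + f) := by
  unfold IsGraph at *
  filter_upwards [he, hf, Lp.coeFn_add e.fst f.fst,
    (energyMeasure_ac s m).ae_eq (magDiff_congr A (snd_add_ae hm e f))] with z h1 h2 h3 h4
  rw [h4, magDiff_add, ← h1, ← h2]
  exact h3

theorem IsGraph.smul (hm : 0 < m) (c : ℂ) {e : Ambient s m} (he : IsGraph s m A e) :
    IsGraph s m A (c • e) := by
  unfold IsGraph at *
  filter_upwards [he, Lp.coeFn_smul c e.fst,
    (energyMeasure_ac s m).ae_eq (magDiff_congr A (snd_smul_ae hm c e))] with z h1 h3 h4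
  rw [h4, magDiff_smul, ← h1]
  exact h3

/-- Norm convergence in both $L^2$ factors yields one common subsequence converging almost
everywhere in each; graph and radial conditions then survive limits. -/
theorem exists_subseq_ae (hm : 0 < m) {e : ℕ → Ambient s m} {f : Ambient s m}
    (h : Tendsto e atTop (𝓝 f)) : ∃ ns : ℕ → ℕ,
      (∀ᵐ z ∂energyMeasure s m, Tendsto (fun n => (e (ns n)).fst z) atTop (𝓝 (f.fst z))) ∧
      (∀ᵐ x : R3, Tendsto (fun n => (e (ns n)).snd x) atTop (𝓝 (f.snd x))) := by
  have h1 : Tendsto (fun n => (e n).fst) atTop (𝓝 f.fst) :=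
    ((WithLp.fstL 2 ℂ (Lp ℂ 2 (energyMeasure s m)) (Lp ℂ 2 (massMeasure s m))).continuous.tendsto f).comp h
  obtain ⟨ns, hns, hae⟩ := (tendstoInMeasure_of_tendsto_Lp h1).exists_seq_tendsto_ae
  have h2 : Tendsto (fun n => (e (ns n)).snd) atTop (𝓝 f.snd) :=
    ((WithLp.sndL 2 ℂ (Lp ℂ 2 (energyMeasure s m)) (Lp ℂ 2 (massMeasure s m))).continuous.tendsto f).comp
      (h.comp hns.tendsto_atTop)
  obtain ⟨ks, hks, hae2⟩ := (tendstoInMeasure_of_tendsto_Lp h2).exists_seq_tendsto_ae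
  refine ⟨ns ∘ ks, ?_, (ac_massMeasure s hm).ae_le hae2⟩
  filter_upwards [hae] with z hz using hz.comp hks.tendsto_atTop

theorem IsGraph.of_tendsto (hm : 0 < m) {e : ℕ → Ambient s m} {f : Ambient s m}
    (h : Tendsto e atTop (𝓝 f)) (he : ∀ n, IsGraph s m A (e n)) : IsGraph s m A f := by
  obtain ⟨ns, h1, h2⟩ := exists_subseq_ae hm h
  -- Convergence for almost every point of $\mathbb R^3$ lifts to both coordinates on the product,
  -- so the magnetic differences converge pointwise too.
  have h3 := (energyMeasure_ac s m).ae_le (Measure.quasiMeasurePreserving_fst.ae h2)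
  have h4 := (energyMeasure_ac s m).ae_le (Measure.quasiMeasurePreserving_snd.ae h2)
  unfold IsGraph at *
  filter_upwards [h1, h3, h4, ae_all_iff.2 fun n => he (ns n)] with z h1 h3 h4 he
  refine tendsto_nhds_unique h1 ?_
  simp only [he, magDiff]
  exact (h3.const_mul _).sub h4

/-- The magnetic Sobolev space as a subspace of the ambient Hilbert space. -/
def magSpace (hm : 0 < m) (hA : Continuous A) : Submodule ℂ (Ambient s m) where
  carrier := {e | IsGraph s m A e ∧ (e.snd : R3 → ℂ) ∈ HsA s m A}
  add_mem' := fun {e f} he hf =>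
    ⟨he.1.add hm hf.1, HsA_congr (snd_add_ae hm e f).symm (HsA_add hA he.2 hf.2)⟩
  zero_mem' := by
    have h0 : ((0 : Ambient s m).snd : R3 → ℂ) =ᵐ[volume] 0 :=
      (ac_massMeasure s hm).ae_eq (Lp.coeFn_zero ℂ 2 (massMeasure s m))
    refine ⟨?_, HsA_congr h0.symm ⟨⟨aestronglyMeasurable_const, ?_⟩, fun ε hε =>
      ⟨0, contDiff_const, HasCompactSupport.zero, ?_⟩⟩⟩
    · unfold IsGraph
      filter_upwards [Lp.coeFn_zero ℂ 2 (energyMeasure s m),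
        (energyMeasure_ac s m).ae_eq (magDiff_congr A h0)] with z h1 h2
      rw [h2]
      refine Eq.trans h1 ?_
      simp [magDiff]
    · have : normSq s m A (0 : R3 → ℂ) = 0 := by simp [normSq, magDiff]
      rw [this]; simp
    · have : normSq s m A ((0 : R3 → ℂ) - 0) = 0 := by simp [normSq, magDiff]
      rw [this]; exact hε
  smul_mem' := fun c e he => ⟨he.1.smul hm c, HsA_congr (snd_smul_ae hm c e).symm (HsA_smul c he.2)⟩

theorem IsGraph.sub (hm : 0 < m) {e f : Ambient s m} (he : IsGraph s m A e) (hf : IsGraph s m A f) :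
    IsGraph s m A (e - f) := by
  have := he.add hm (hf.smul hm (-1))
  rwa [neg_one_smul, ← sub_eq_add_neg] at this

/-- The graph condition is closed, and norm convergence of graphs is convergence in
$\|\cdot\|_{A,s}$, under which $H^s_A$ is closed. -/
theorem isClosed_magSpace (hs : 0 < s) (hs' : s < 1) (hm : 0 < m) (hA : Continuous A) :
    IsClosed (magSpace (s := s) hm hA : Set (Ambient s m)) := by
  refine IsSeqClosed.isClosed fun e f he h => ?_
  have hf : IsGraph s m A f := IsGraph.of_tendsto hm h fun n => (he n).1
  refine ⟨hf, HsA_of_approx hA (hf.finiteNorm hs hs' hm hA) fun ε hε => ?_⟩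
  have h1 : Tendsto (fun n => ‖f - e n‖ₑ ^ 2) atTop (𝓝 0) := by
    have h2 : Tendsto (fun n => f - e n) atTop (𝓝 0) := by
      simpa using (tendsto_const_nhds (x := f)).sub h
    have h3 := ENNReal.Tendsto.pow h2.enorm (n := 2)
    simpa using h3
  obtain ⟨n, hn⟩ := (h1.eventually_lt_const hε).exists
  refine ⟨(e n).snd, (he n).2, ?_⟩
  rw [← normSq_congr s m A (snd_sub_ae hm f (e n)), (hf.sub hm (he n).1).normSq_snd hs hs' hm hA]
  exact hn

theorem IsRadial.congr {u v : R3 → ℂ} (h : u =ᵐ[volume] v) (hu : IsRadial u) : IsRadial v := by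
  intro g
  filter_upwards [hu g, h, g.measurePreserving.quasiMeasurePreserving.ae_eq_comp h] with x h1 h2 h3
  simp only [Function.comp_apply] at h3
  rw [← h3, ← h2, h1]

theorem IsRadial.add {u v : R3 → ℂ} (hu : IsRadial u) (hv : IsRadial v) : IsRadial (u + v) := by
  intro g
  filter_upwards [hu g, hv g] with x h1 h2
  simp only [Pi.add_apply, h1, h2]

theorem IsRadial.smul (c : ℂ) {u : R3 → ℂ} (hu : IsRadial u) : IsRadial (c • u) := by
  intro g
  filter_upwards [hu g] with x h1
  simp only [Pi.smul_apply, h1]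

/-- The radial subspace. -/
def radSpace (hm : 0 < m) (hA : Continuous A) : Submodule ℂ (Ambient s m) where
  carrier := {e | e ∈ magSpace (s := s) hm hA ∧ IsRadial (e.snd : R3 → ℂ)}
  add_mem' := fun {e f} he hf =>
    ⟨Submodule.add_mem _ he.1 hf.1, (he.2.add hf.2).congr (snd_add_ae hm e f).symm⟩
  zero_mem' := by
    have h0 : ((0 : Ambient s m).snd : R3 → ℂ) =ᵐ[volume] 0 :=
      (ac_massMeasure s hm).ae_eq (Lp.coeFn_zero ℂ 2 (massMeasure s m))
    exact ⟨Submodule.zero_mem _, IsRadial.congr h0.symm fun g => EventuallyEq.refl _ _⟩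
  smul_mem' := fun c e he =>
    ⟨Submodule.smul_mem _ c he.1, (he.2.smul c).congr (snd_smul_ae hm c e).symm⟩

theorem isClosed_radSpace (hs : 0 < s) (hs' : s < 1) (hm : 0 < m) (hA : Continuous A) :
    IsClosed (radSpace (s := s) hm hA : Set (Ambient s m)) := by
  refine IsSeqClosed.isClosed fun e f he h => ?_
  refine ⟨(isClosed_magSpace hs hs' hm hA).isSeqClosed (fun n => (he n).1) h, fun g => ?_⟩
  obtain ⟨ns, -, h2⟩ := exists_subseq_ae hm h
  filter_upwards [h2, g.measurePreserving.quasiMeasurePreserving.ae h2,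
    ae_all_iff.2 fun n => (he (ns n)).2 g] with x h3 h4 h5
  refine tendsto_nhds_unique h4 ?_
  simpa only [h5] using h3

/-- The element of the ambient space given by a function of finite norm. -/
def embed (hs : 0 < s) (hs' : s < 1) (hm : 0 < m) (hA : Continuous A) (u : R3 → ℂ)
    (hu : FiniteNorm s m A u) : Ambient s m :=
  WithLp.toLp 2 ((hu.memLp_magDiff hs hs' hm hA).toLp, (hu.memLp hs hs' hm hA).toLp)

theorem embed_snd (hs : 0 < s) (hs' : s < 1) (hm : 0 < m) (hA : Continuous A) {u : R3 → ℂ}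
    (hu : FiniteNorm s m A u) : ((embed hs hs' hm hA u hu).snd : R3 → ℂ) =ᵐ[volume] u :=
  (ac_massMeasure s hm).ae_eq (MemLp.coeFn_toLp (hu.memLp hs hs' hm hA))

theorem isGraph_embed (hs : 0 < s) (hs' : s < 1) (hm : 0 < m) (hA : Continuous A) {u : R3 → ℂ}
    (hu : FiniteNorm s m A u) : IsGraph s m A (embed hs hs' hm hA u hu) := by
  unfold IsGraph
  filter_upwards [MemLp.coeFn_toLp (hu.memLp_magDiff hs hs' hm hA),
    (energyMeasure_ac s m).ae_eq (magDiff_congr A (embed_snd hs hs' hm hA hu))] with z h1 h2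
  rw [h2, ← h1]
  rfl

theorem embed_mem_magSpace (hs : 0 < s) (hs' : s < 1) (hm : 0 < m) (hA : Continuous A) {u : R3 → ℂ}
    (hu : u ∈ HsA s m A) : embed hs hs' hm hA u hu.1 ∈ magSpace (s := s) hm hA :=
  ⟨isGraph_embed hs hs' hm hA hu.1, HsA_congr (embed_snd hs hs' hm hA hu.1).symm hu⟩

theorem embed_mem_radSpace (hs : 0 < s) (hs' : s < 1) (hm : 0 < m) (hA : Continuous A) {u : R3 → ℂ}
    (hu : u ∈ HsARad s m A) : embed hs hs' hm hA u hu.1.1 ∈ radSpace (s := s) hm hA :=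
  ⟨embed_mem_magSpace hs hs' hm hA hu.1, hu.2.congr (embed_snd hs hs' hm hA hu.1.1).symm⟩

theorem enorm_embed (hs : 0 < s) (hs' : s < 1) (hm : 0 < m) (hA : Continuous A) {u : R3 → ℂ}
    (hu : FiniteNorm s m A u) : ‖embed hs hs' hm hA u hu‖ₑ ^ 2 = normSq s m A u := by
  rw [← (isGraph_embed hs hs' hm hA hu).normSq_snd hs hs' hm hA,
    normSq_congr s m A (embed_snd hs hs' hm hA hu)]

/-- The scalar product is the real part of the ambient inner product. -/
theorem re_inner_eq_scalarProduct (hs : 0 < s) (hs' : s < 1) (hm : 0 < m)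
    {e f : Ambient s m} (he : IsGraph s m A e) (hf : IsGraph s m A f) :
    (inner ℂ f e).re = scalarProduct s m A e.snd f.snd := by
  have hc : 0 < constC s / 2 * m ^ ((3 + 2 * s) / 2) := by
    have := constC_pos hs hs'; positivity
  have h1 : inner ℂ f.fst e.fst = ∫ z, magDiff A e.snd z.1 z.2 *
      (starRingEnd ℂ) (magDiff A f.snd z.1 z.2) ∂energyMeasure s m := by
    rw [L2.inner_def]
    refine integral_congr_ae ?_
    filter_upwards [he, hf] with z h1 h2
    rw [h1, h2]
    rfl
  have h2 : inner ℂ f.snd e.snd = ∫ x, e.snd x * (starRingEnd ℂ) (f.snd x) ∂massMeasure s m := by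
    rw [L2.inner_def]
    rfl
  have h3 : inner ℂ f e = inner ℂ f.fst e.fst + inner ℂ f.snd e.snd := WithLp.prod_inner_apply f e
  rw [h3, Complex.add_re, h1, h2, integral_energyMeasure, integral_massMeasure s hm, scalarProduct]
  congr 1
  · rw [← Complex.re_ofReal_mul, ← integral_const_mul]
    congr 1
    refine integral_congr_ae (ae_of_all _ fun z => ?_)
    have hk0 := kernel_nonneg hs hm (z.1 - z.2)
    simp only
    rw [ENNReal.toReal_ofReal (by positivity), Complex.real_smul]
    push_cast
    ring
  · rw [Complex.smul_re, smul_eq_mul]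

end space

/-! ### Weak limits in a separable Hilbert space. -/

/-- Sequential Banach–Alaoglu in the dual, transferred by the Riesz isomorphism. -/
theorem exists_weak_limit {X : Type*} [NormedAddCommGroup X] [InnerProductSpace ℂ X] [CompleteSpace X]
    [TopologicalSpace.SeparableSpace X] (x : ℕ → X) {M : ℝ} (hx : ∀ n, ‖x n‖ ≤ M) :
    ∃ (y : X) (φ : ℕ → ℕ), StrictMono φ ∧
      ∀ v : X, Tendsto (fun n => inner ℂ (x (φ n)) v) atTop (𝓝 (inner ℂ y v)) := by
  have hc := WeakDual.isSeqCompact_closedBall ℂ X (0 : StrongDual ℂ X) M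
  obtain ⟨f, -, φ, hφ, hf⟩ := hc (x := fun n => StrongDual.toWeakDual (InnerProductSpace.toDual ℂ X (x n)))
    (fun n => by
      simp only [mem_preimage, mem_closedBall_zero_iff]
      exact ((InnerProductSpace.toDual ℂ X).norm_map (x n)).trans_le (hx n))
  refine ⟨(InnerProductSpace.toDual ℂ X).symm (WeakDual.toStrongDual f), φ, hφ, fun v => ?_⟩
  rw [InnerProductSpace.toDual_symm_apply]
  exact ((WeakDual.eval_continuous v).tendsto f).comp hf

/-- Testing with $y$ itself gives $\|y\|^2=\lim\langle x_n,y\rangle\le t\|y\|$. -/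
theorem norm_le_of_weak_limit {X : Type*} [NormedAddCommGroup X] [InnerProductSpace ℂ X]
    {x : ℕ → X} {y : X} {t : ℝ}
    (h : ∀ v : X, Tendsto (fun n => inner ℂ (x n) v) atTop (𝓝 (inner ℂ y v)))
    (ht : Tendsto (fun n => ‖x n‖) atTop (𝓝 t)) : ‖y‖ ≤ t := by
  have h1 : ‖y‖ ^ 2 ≤ t * ‖y‖ := by
    have h2 : Tendsto (fun n => ‖inner ℂ (x n) y‖) atTop (𝓝 (‖y‖ ^ 2)) := by
      have := (h y).norm
      rwa [inner_self_eq_norm_sq_to_K, norm_pow, RCLike.norm_ofReal, abs_norm] at this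
    exact le_of_tendsto_of_tendsto' h2 (ht.mul_const ‖y‖) fun n => norm_inner_le_norm _ _
  rcases (norm_nonneg y).eq_or_lt with h0 | h0
  · rw [← h0]
    exact ge_of_tendsto' ht fun n => norm_nonneg _
  · nlinarith

/-- Weak compactness is used inside the complete subspace, which keeps the limit there. The adjoint
of the inclusion projects an ambient test vector onto $X$, so convergence holds against every vector
of $E$. -/
theorem exists_weak_limit_mem {E : Type*} [NormedAddCommGroup E] [InnerProductSpace ℂ E] [CompleteSpace E]
    [SecondCountableTopology E] {X : Submodule ℂ E} (hX : IsClosed (X : Set E)) {e : ℕ → E}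
    (he : ∀ n, e n ∈ X) {t : ℝ} (ht : Tendsto (fun n => ‖e n‖) atTop (𝓝 t)) :
    ∃ y ∈ X, ∃ φ : ℕ → ℕ, ‖y‖ ≤ t ∧
      ∀ v : E, Tendsto (fun n => inner ℂ v (e (φ n) - y)) atTop (𝓝 0) := by
  have : CompleteSpace X := hX.completeSpace_coe
  have : SecondCountableTopology X := TopologicalSpace.Subtype.secondCountableTopology _
  obtain ⟨M, hM⟩ := ht.bddAbove_range
  set x : ℕ → X := fun n => ⟨e n, he n⟩ with hx
  obtain ⟨y, φ, hφ, hw⟩ := exists_weak_limit x (M := M) fun n => hM ⟨n, rfl⟩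
  have hy : ‖y‖ ≤ t := norm_le_of_weak_limit hw (ht.comp hφ.tendsto_atTop)
  refine ⟨y, y.2, φ, hy, fun v => ?_⟩
  have h1 : Tendsto (fun n => inner ℂ (x (φ n) - y) (ContinuousLinearMap.adjoint X.subtypeL v))
      atTop (𝓝 0) := by
    have := (hw (ContinuousLinearMap.adjoint X.subtypeL v)).sub_const
      (inner ℂ y (ContinuousLinearMap.adjoint X.subtypeL v))
    rw [sub_self] at this
    refine this.congr fun n => ?_
    rw [inner_sub_left]
  have h2 := (Complex.continuous_conj.tendsto 0).comp h1
  rw [map_zero] at h2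
  refine h2.congr fun n => ?_
  rw [Function.comp_apply, ContinuousLinearMap.adjoint_inner_right, inner_conj_symm]
  rfl

/-! ### Test functions have finite norm; a nonzero radial example. -/

theorem norm_phase_sub_one_le (t : ℝ) : ‖Complex.exp (-(Complex.I * (t : ℂ))) - 1‖ ≤ |t| := by
  have := Real.norm_exp_I_mul_ofReal_sub_one_le (x := -t)
  rw [Complex.ofReal_neg, mul_neg, Real.norm_eq_abs, abs_neg] at this
  exact this

/-- Test functions have finite norm. -/
theorem finiteNorm_of_contDiff {s m : ℝ} (hs : 0 < s) (hs' : s < 1) (hm : 0 < m) {A : R3 → R3}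
    (hA : Continuous A) {φ : R3 → ℂ} (hφ : ContDiff ℝ 1 φ) (hc : HasCompactSupport φ) :
    FiniteNorm s m A φ := by
  obtain ⟨L, hL⟩ := ContDiff.lipschitzWith_of_hasCompactSupport hc hφ (by norm_num)
  obtain ⟨S, hS⟩ := hc.exists_bound_of_continuous hφ.continuous
  have hS0 : 0 ≤ S := (norm_nonneg _).trans (hS 0)
  obtain ⟨R, hR0, hR⟩ : ∃ R : ℝ, 0 < R ∧ ∀ x, φ x ≠ 0 → x ∈ Metric.ball (0 : R3) R := by
    obtain ⟨R, hR⟩ := hc.isCompact.isBounded.subset_ball 0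
    exact ⟨max R 1, by positivity, fun x hx => Metric.ball_subset_ball (le_max_left _ _)
      (hR (subset_tsupport _ hx))⟩
  -- If $x$ lies in the ball of radius $R$ and $|x-y|<1$, the midpoint lies in the ball of radius
  -- $R+1$, where $A$ is bounded.
  obtain ⟨a, ha⟩ := (isCompact_closedBall (0 : R3) (R + 1)).exists_bound_of_continuousOn hA.continuousOn
  have ha0 : 0 ≤ a := (norm_nonneg _).trans (ha 0 (by simp; linarith))
  set C : ℝ := a * S + L + 2 * S with hC
  have hC0 : 0 ≤ C := by positivity
  set B := Metric.ball (0 : R3) R with hB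
  have hBm : MeasurableSet B := Metric.isOpen_ball.measurableSet
  set χ : R3 → ℝ≥0∞ := B.indicator (fun _ => 1) with hχ
  have hχm : Measurable χ := measurable_const.indicator hBm
  have hlip : ∀ x y, ‖φ x - φ y‖ ≤ L * ‖x - y‖ := fun x y => by
    simpa [dist_eq_norm] using hL.dist_le_mul x y
  have hnear : ∀ x y, ‖x - y‖ < 1 → ‖magDiff A φ x y‖ ≤ C * ‖x - y‖ := by
    intro x y hxy
    have h1 : magDiff A φ x y = (Complex.exp (-(Complex.I *
      ((inner ℝ (x - y) (A ((1 / 2 : ℝ) • (x + y))) : ℝ) : ℂ))) - 1) * φ x + (φ x - φ y) := by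
      rw [magDiff]; ring
    rw [h1]
    have h2 : ‖(Complex.exp (-(Complex.I *
      ((inner ℝ (x - y) (A ((1 / 2 : ℝ) • (x + y))) : ℝ) : ℂ))) - 1) * φ x‖ ≤ a * S * ‖x - y‖ := by
      rcases eq_or_ne (φ x) 0 with h0 | h0
      · rw [h0]; simp; positivity
      · have hx : ‖x‖ < R := by simpa [hB] using hR x h0
        have hmid : (1 / 2 : ℝ) • (x + y) ∈ Metric.closedBall (0 : R3) (R + 1) := by
          have e : (1 / 2 : ℝ) • (x + y) = x - (1 / 2 : ℝ) • (x - y) := by module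
          rw [mem_closedBall_zero_iff, e]
          refine (norm_sub_le _ _).trans ?_
          rw [norm_smul]
          norm_num
          linarith
        rw [norm_mul]
        calc _ ≤ |inner ℝ (x - y) (A ((1 / 2 : ℝ) • (x + y)))| * S := by
              gcongr
              · exact norm_phase_sub_one_le _
              · exact hS x
          _ ≤ (‖x - y‖ * a) * S := by
              gcongr
              exact (abs_real_inner_le_norm _ _).trans (by gcongr; exact ha _ hmid)
          _ = _ := by ring
    calc _ ≤ a * S * ‖x - y‖ + L * ‖x - y‖ := (norm_add_le _ _).trans (add_le_add h2 (hlip x y))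
      _ ≤ C * ‖x - y‖ := by
        rw [hC]
        have : 0 ≤ S * ‖x - y‖ := by positivity
        linarith
  have hfar : ∀ x y, ‖magDiff A φ x y‖ ≤ C := by
    intro x y
    calc ‖magDiff A φ x y‖ ≤ ‖φ x‖ + ‖φ y‖ := by
          refine (norm_sub_le _ _).trans ?_
          rw [norm_mul, norm_phase, one_mul]
      _ ≤ S + S := add_le_add (hS x) (hS y)
      _ ≤ C := by
        have : 0 ≤ a * S := by positivity
        have : (0 : ℝ) ≤ L := L.2
        rw [hC]; linarith
  -- The difference is at most $C|x-y|$ when $|x-y|<1$, at most $C$ always, and vanishes unless one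
  -- of the points is in the support. The kernel integrates $\min(|z|^2,1)$, so the energy is
  -- finite.
  have hpt : ∀ x y, ‖magDiff A φ x y‖ₑ ^ 2 ≤
      ENNReal.ofReal (C ^ 2) * (ENNReal.ofReal (min (‖x - y‖ ^ 2) 1) * (χ x + χ y)) := by
    intro x y
    by_cases hxy : φ x = 0 ∧ φ y = 0
    · simp [magDiff, hxy.1, hxy.2]
    have h1 : 1 ≤ χ x + χ y := by
      rcases not_and_or.1 hxy with h | h
      · rw [hχ, indicator_of_mem (hR x h)]; exact le_self_add
      · rw [hχ, indicator_of_mem (hR y h)]; exact le_add_self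
    have h2 : ‖magDiff A φ x y‖ ^ 2 ≤ C ^ 2 * min (‖x - y‖ ^ 2) 1 := by
      by_cases h : ‖x - y‖ < 1
      · rw [min_eq_left (pow_le_one₀ (norm_nonneg _) h.le), ← mul_pow]
        gcongr
        exact hnear x y h
      · rw [min_eq_right (one_le_pow₀ (not_lt.1 h)), mul_one]
        gcongr
        exact hfar x y
    calc ‖magDiff A φ x y‖ₑ ^ 2 = ENNReal.ofReal (‖magDiff A φ x y‖ ^ 2) := by
          rw [ENNReal.ofReal_pow (norm_nonneg _), ofReal_norm]
      _ ≤ ENNReal.ofReal (C ^ 2 * min (‖x - y‖ ^ 2) 1) := ENNReal.ofReal_le_ofReal h2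
      _ = ENNReal.ofReal (C ^ 2) * (ENNReal.ofReal (min (‖x - y‖ ^ 2) 1) * 1) := by
          rw [ENNReal.ofReal_mul (by positivity), mul_one]
      _ ≤ _ := by gcongr
  set k : R3 → ℝ≥0∞ := fun z => ENNReal.ofReal (min (‖z‖ ^ 2) 1) * ENNReal.ofReal (kernel s m z) with hk
  have hkm : Measurable k := by
    have := measurable_kernel s m
    fun_prop
  have hχint : ∫⁻ x, χ x < ∞ := by
    rw [hχ, lintegral_indicator hBm, setLIntegral_const, one_mul]
    exact measure_ball_lt_top
  have hkint : ∫⁻ x, k x < ∞ := lintegral_min_mul_kernel_lt_top hs hs' hm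
  have hkm1 : Measurable fun z : R3 × R3 => k (z.1 - z.2) := by fun_prop
  have i1 : ∫⁻ z : R3 × R3, χ z.1 * k (z.1 - z.2) < ∞ := by
    rw [Measure.volume_eq_prod, lintegral_prod _ (by fun_prop)]
    simp only
    have : ∀ x, ∫⁻ y, χ x * k (x - y) = χ x * ∫⁻ y, k y := fun x => by
      rw [lintegral_const_mul _ (by fun_prop), lintegral_sub_left_eq_self k]
    simp only [this]
    rw [lintegral_mul_const _ hχm]
    exact ENNReal.mul_lt_top hχint hkint
  have i2 : ∫⁻ z : R3 × R3, χ z.2 * k (z.1 - z.2) < ∞ := by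
    rw [Measure.volume_eq_prod, lintegral_prod_symm _ (by fun_prop)]
    simp only
    have : ∀ y, ∫⁻ x, χ y * k (x - y) = χ y * ∫⁻ x, k x := fun y => by
      rw [lintegral_const_mul _ (by fun_prop), lintegral_sub_right_eq_self k]
    simp only [this]
    rw [lintegral_mul_const _ hχm]
    exact ENNReal.mul_lt_top hχint hkint
  refine ⟨hφ.continuous.aestronglyMeasurable, ENNReal.add_lt_top.2
    ⟨ENNReal.mul_lt_top ENNReal.ofReal_lt_top ?_, ENNReal.mul_lt_top ENNReal.ofReal_lt_top ?_⟩⟩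
  · calc ∫⁻ z : R3 × R3, ‖magDiff A φ z.1 z.2‖ₑ ^ 2 * ENNReal.ofReal (kernel s m (z.1 - z.2))
        ≤ ∫⁻ z : R3 × R3, ENNReal.ofReal (C ^ 2) * (χ z.1 * k (z.1 - z.2) + χ z.2 * k (z.1 - z.2)) := by
          refine lintegral_mono fun z => (mul_le_mul_left (hpt z.1 z.2) _).trans_eq ?_
          simp only [hk]
          ring
      _ = ENNReal.ofReal (C ^ 2) * ((∫⁻ z : R3 × R3, χ z.1 * k (z.1 - z.2)) +
            ∫⁻ z : R3 × R3, χ z.2 * k (z.1 - z.2)) := by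
          rw [lintegral_const_mul' _ _ ENNReal.ofReal_ne_top, lintegral_add_left (by fun_prop)]
      _ < ∞ := ENNReal.mul_lt_top ENNReal.ofReal_lt_top (ENNReal.add_lt_top.2 ⟨i1, i2⟩)
  · calc ∫⁻ x, ‖φ x‖ₑ ^ 2 ≤ ∫⁻ x, ENNReal.ofReal (S ^ 2) * χ x := by
          refine lintegral_mono fun x => ?_
          rcases eq_or_ne (φ x) 0 with h0 | h0
          · simp [h0]
          · rw [hχ, indicator_of_mem (hR x h0), mul_one, ENNReal.ofReal_pow hS0, ← ofReal_norm]
            gcongr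
            exact hS x
      _ < ∞ := by
          rw [lintegral_const_mul' _ _ ENNReal.ofReal_ne_top]
          exact ENNReal.mul_lt_top ENNReal.ofReal_lt_top hχint

/-- A radial test function. -/
def radialBump (x : R3) : ℂ := (Real.smoothTransition (1 - ‖x‖ ^ 2) : ℝ)

theorem contDiff_radialBump : ContDiff ℝ ((⊤ : ℕ∞) : WithTop ℕ∞) radialBump := by
  unfold radialBump
  exact Complex.ofRealCLM.contDiff.comp
    (Real.smoothTransition.contDiff.comp (contDiff_const.sub (contDiff_norm_sq ℝ)))

theorem hasCompactSupport_radialBump : HasCompactSupport radialBump := by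
  refine HasCompactSupport.intro (isCompact_closedBall (0 : R3) 1) fun x hx => ?_
  rw [mem_closedBall_zero_iff, not_le] at hx
  rw [radialBump, Real.smoothTransition.zero_of_nonpos (by nlinarith), Complex.ofReal_zero]

theorem radialBump_mem_HsARad {s m : ℝ} (hs : 0 < s) (hs' : s < 1) (hm : 0 < m) {A : R3 → R3}
    (hA : Continuous A) : radialBump ∈ HsARad s m A := by
  refine ⟨⟨finiteNorm_of_contDiff hs hs' hm hA (contDiff_radialBump.of_le (by norm_cast))
    hasCompactSupport_radialBump, fun ε hε => ⟨radialBump, contDiff_radialBump,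
      hasCompactSupport_radialBump, ?_⟩⟩, fun g => ?_⟩
  · have : normSq s m A (radialBump - radialBump) = 0 := by simp [normSq, magDiff]
    rwa [this]
  · exact ae_of_all _ fun x => by simp [radialBump]

theorem radialBump_ne_zero : ¬ radialBump =ᵐ[volume] 0 := by
  intro h
  have h1 : Metric.ball (0 : R3) 1 ⊆ {x | ¬ radialBump x = (0 : R3 → ℂ) x} := by
    intro x hx
    rw [mem_ball_zero_iff] at hx
    have := Real.smoothTransition.pos_of_pos (show 0 < 1 - ‖x‖ ^ 2 by nlinarith [norm_nonneg x])
    simp only [mem_ofPred_eq, radialBump, Pi.zero_apply, Complex.ofReal_eq_zero]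
    exact this.ne'
  have h2 := measure_mono_null h1 h
  exact (Metric.measure_ball_pos volume (0 : R3) one_pos).ne' h2

/-! ### Existence of a minimizer. -/

section existence

variable {s m α p : ℝ} {A : R3 → R3}

theorem HsARad_smul (c : ℂ) {u : R3 → ℂ} (hu : u ∈ HsARad s m A) : c • u ∈ HsARad s m A :=
  ⟨HsA_smul c hu.1, hu.2.smul c⟩

/-- Normalization of the Choquard energy. -/
theorem exists_normalize (hs : 0 < s) (hs' : s < 1) (hm : 0 < m) (hα : 0 < α) (hα' : α < 3)
    (hp : 1 + α / 3 < p) (hp' : p < (3 + α) / (3 - 2 * s)) (hA : Continuous A) {u : R3 → ℂ}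
    (hu : u ∈ HsARad s m A) (hne : ¬ u =ᵐ[volume] 0) :
    ∃ v ∈ HsARad s m A, functionalD α p v = 1 ∧ normSq s m A v = functionalG s m α p A u := by
  have hp0 : 0 < p := by linarith
  have hD := functionalD_pos hα hα' hp0 hu.1.1.1 hne
  have hDt := functionalD_lt_top hs hs' hm hα hα' hp hp' hA hu.1.1
  set D := functionalD α p u with hDdef
  have hDr : 0 < D.toReal := ENNReal.toReal_pos hD.ne' hDt.ne
  -- $\mathcal D$ is homogeneous of degree $2p$, so this factor normalizes it to $1$; the squared
  -- norm is then multiplied by $\mathcal D^{-1/p}$, which is the quotient $G$.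
  set c : ℂ := ((D.toReal ^ (-(1 / (2 * p))) : ℝ) : ℂ) with hc
  have hc2 : ‖c‖ₑ ^ 2 = D ^ (-(1 / p)) := by
    rw [hc, ← ofReal_norm, Complex.norm_real, Real.norm_of_nonneg (by positivity),
      ← ENNReal.ofReal_pow (by positivity), ← Real.rpow_natCast, ← Real.rpow_mul hDr.le,
      ← ENNReal.ofReal_rpow_of_pos hDr, ENNReal.ofReal_toReal hDt.ne]
    congr 1; push_cast; field_simp
  refine ⟨c • u, HsARad_smul c hu, ?_, ?_⟩
  · have := functionalD_smul α hp0 c u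
    rw [hc2, ← ENNReal.rpow_mul, ← hDdef, show -(1 / p) * p = -1 by field_simp, ENNReal.rpow_neg_one,
      ENNReal.inv_mul_cancel hD.ne' hDt.ne] at this
    exact this
  · rw [normSq_smul, hc2, functionalG, ← hDdef, ENNReal.rpow_neg, ENNReal.div_eq_inv_mul]

theorem tauRad_le (s m α p : ℝ) (A : R3 → R3) {u : R3 → ℂ} (hu : u ∈ HsARad s m A)
    (hne : ¬ u =ᵐ[volume] 0) : tauRad s m α p A ≤ functionalG s m α p A u :=
  sInf_le ⟨u, hu, hne, rfl⟩

theorem functionalG_lt_top (hs : 0 < s) (hs' : s < 1) (hm : 0 < m) (hα : 0 < α) (hα' : α < 3)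
    (hp : 1 + α / 3 < p) (hp' : p < (3 + α) / (3 - 2 * s)) (hA : Continuous A) {u : R3 → ℂ}
    (hu : u ∈ HsARad s m A) (hne : ¬ u =ᵐ[volume] 0) : functionalG s m α p A u < ∞ := by
  obtain ⟨v, hv, -, h⟩ := exists_normalize hs hs' hm hα hα' hp hp' hA hu hne
  rw [← h]
  exact hv.1.1.2

theorem tauRad_lt_top (hs : 0 < s) (hs' : s < 1) (hm : 0 < m) (hα : 0 < α) (hα' : α < 3)
    (hp : 1 + α / 3 < p) (hp' : p < (3 + α) / (3 - 2 * s)) (hA : Continuous A) :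
    tauRad s m α p A < ∞ :=
  (tauRad_le s m α p A (radialBump_mem_HsARad hs hs' hm hA) radialBump_ne_zero).trans_lt
    (functionalG_lt_top hs hs' hm hα hα' hp hp' hA (radialBump_mem_HsARad hs hs' hm hA)
      radialBump_ne_zero)

theorem ne_zero_of_functionalD (hp : 0 < p) {u : R3 → ℂ} (h : functionalD α p u ≠ 0) :
    ¬ u =ᵐ[volume] 0 := by
  intro h0
  refine h ?_
  rw [functionalD_congr α p h0]
  simp [functionalD, ENNReal.zero_rpow_of_pos hp]

/-- Magnetic averages are continuous for weak convergence. -/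
theorem exists_magSum_eq_inner (hm : 0 < m) (hA : Continuous A) (ρ : ℝ) (y : R3) :
    ∃ v : Ambient s m, ∃ c : ℂ, ∀ e : Ambient s m, magSum A ρ e.snd y = c * inner ℂ v e := by
  -- The representing vector is the conjugate phase cut off to the ball, which is in $L^2$. The
  -- factor $m^{-2s}$ chosen below undoes the weight of the mass measure.
  set h : R3 → ℂ := (Metric.ball y ρ).indicator fun x => (starRingEnd ℂ) (Complex.exp (-(Complex.I *
      ((inner ℝ (x - y) (A ((1 / 2 : ℝ) • (x + y))) : ℝ) : ℂ)))) with hh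
  have hB : MeasurableSet (Metric.ball y ρ) := Metric.isOpen_ball.measurableSet
  have hcont : Continuous fun x : R3 => (starRingEnd ℂ) (Complex.exp (-(Complex.I *
      ((inner ℝ (x - y) (A ((1 / 2 : ℝ) • (x + y))) : ℝ) : ℂ)))) := by fun_prop
  have hL : MemLp h 2 (massMeasure s m) := by
    refine memLp_two_of_lintegral (hcont.aestronglyMeasurable.indicator hB) ?_
    have h1 : ∀ x, ‖h x‖ₑ ^ 2 = (Metric.ball y ρ).indicator (fun _ => 1) x := fun x => by
      by_cases hx : x ∈ Metric.ball y ρ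
      · rw [hh, indicator_of_mem hx, indicator_of_mem hx, ← ofReal_norm, RCLike.norm_conj, ofReal_norm,
          enorm_phase, one_pow]
      · rw [hh, indicator_of_notMem hx, indicator_of_notMem hx]; simp
    simp only [h1]
    rw [massMeasure, lintegral_withDensity_eq_lintegral_mul _ measurable_const
      (measurable_const.indicator hB)]
    simp only [Pi.mul_apply]
    rw [lintegral_const_mul' _ _ ENNReal.ofReal_ne_top, lintegral_indicator hB, setLIntegral_const,
      one_mul]
    exact ENNReal.mul_lt_top ENNReal.ofReal_lt_top measure_ball_lt_top
  refine ⟨WithLp.toLp 2 (0, hL.toLp), ((m ^ (2 * s))⁻¹ : ℝ), fun e => ?_⟩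
  have h2 : inner ℂ (WithLp.toLp 2 ((0 : Lp ℂ 2 (energyMeasure s m)), hL.toLp) : Ambient s m) e
      = inner ℂ hL.toLp e.snd := by
    rw [WithLp.prod_inner_apply]
    simp
  have h3 : inner ℂ hL.toLp e.snd = ∫ x, e.snd x * (starRingEnd ℂ) (h x) ∂massMeasure s m := by
    rw [L2.inner_def]
    refine integral_congr_ae ?_
    filter_upwards [hL.coeFn_toLp] with x hx
    rw [hx]
    rfl
  rw [h2, h3, integral_massMeasure s hm, Complex.real_smul, ← mul_assoc, ← Complex.ofReal_mul,
    inv_mul_cancel₀ (by positivity), Complex.ofReal_one, one_mul, magSum, ← integral_indicator hB]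
  refine integral_congr_ae (ae_of_all _ fun x => ?_)
  by_cases hx : x ∈ Metric.ball y ρ
  · simp only [hh, indicator_of_mem hx, Complex.conj_conj]
    ring
  · simp only [hh, indicator_of_notMem hx, map_zero, mul_zero]

/-- The limit $u$ of a normalized minimizing sequence has $\|u\|^2\le\tau$ by weak lower
semicontinuity and $\mathcal D(u)\ge1$ by compactness. Hence $G(u)\le\tau$, and it remains to
renormalize. -/
theorem exists_minimizer (hs : 0 < s) (hs' : s < 1) (hm : 0 < m) (hα : 0 < α) (hα' : α < 3)
    (hp : 1 + α / 3 < p) (hp' : p < (3 + α) / (3 - 2 * s)) (hA : Continuous A) :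
    ∃ u ∈ HsARad s m A, functionalD α p u = 1 ∧ normSq s m A u = tauRad s m α p A := by
  have hp0 : 0 < p := by linarith
  have hτ := tauRad_lt_top hs hs' hm hα hα' hp hp' hA
  set τ := tauRad s m α p A with hτdef
  obtain ⟨c, hcanti, hclim, hc⟩ := exists_seq_tendsto_sInf
    (S := {c | ∃ u ∈ HsARad s m A, ¬ u =ᵐ[volume] 0 ∧ c = functionalG s m α p A u})
    ⟨_, radialBump, radialBump_mem_HsARad hs hs' hm hA, radialBump_ne_zero, rfl⟩ (OrderBot.bddBelow _)
  change Tendsto c atTop (𝓝 τ) at hclim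
  have hv : ∀ n, ∃ v ∈ HsARad s m A, functionalD α p v = 1 ∧ normSq s m A v = c n := by
    intro n
    obtain ⟨u, hu, hne, hcu⟩ := hc n
    rw [hcu]
    exact exists_normalize hs hs' hm hα hα' hp hp' hA hu hne
  choose v hvmem hvD hvN using hv
  have hct : ∀ n, c n ≠ ∞ := fun n => by rw [← hvN n]; exact (hvmem n).1.1.2.ne
  set e : ℕ → Ambient s m := fun n => embed hs hs' hm hA (v n) (hvmem n).1.1 with he
  have heX : ∀ n, e n ∈ radSpace (s := s) hm hA := fun n => embed_mem_radSpace hs hs' hm hA (hvmem n)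
  have hesq : ∀ n, ‖e n‖ ^ 2 = (c n).toReal := fun n => by
    have h1 := enorm_embed hs hs' hm hA (hvmem n).1.1
    rw [hvN n] at h1
    rw [← h1, ENNReal.toReal_pow, toReal_enorm]
  have henorm : Tendsto (fun n => ‖e n‖) atTop (𝓝 (Real.sqrt τ.toReal)) := by
    have h1 : Tendsto (fun n => (c n).toReal) atTop (𝓝 τ.toReal) :=
      (ENNReal.tendsto_toReal hτ.ne).comp hclim
    refine ((Real.continuous_sqrt.tendsto _).comp h1).congr fun n => ?_
    rw [Function.comp_apply, ← hesq n, Real.sqrt_sq (norm_nonneg _)]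
  obtain ⟨M, hM⟩ := henorm.bddAbove_range
  have hM : ∀ n, ‖e n‖ ≤ M := fun n => hM ⟨n, rfl⟩
  obtain ⟨y, hyX, φ, hy, hw⟩ := exists_weak_limit_mem (isClosed_radSpace hs hs' hm hA) heX henorm
  set w : ℕ → Ambient s m := fun n => e (φ n) - y with hwdef
  have hwX : ∀ n, w n ∈ radSpace (s := s) hm hA := fun n => Submodule.sub_mem _ (heX _) hyX
  have hM0 : 0 ≤ M := (norm_nonneg _).trans (hM 0)
  -- The added $1$ keeps the bound strictly positive, as the compactness lemma requires.
  have hwN : ∀ n, normSq s m A (w n).snd ≤ ENNReal.ofReal ((M + ‖y‖) ^ 2 + 1) := by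
    intro n
    rw [(hwX n).1.1.normSq_snd hs hs' hm hA, ← ofReal_norm, ← ENNReal.ofReal_pow (norm_nonneg _)]
    refine ENNReal.ofReal_le_ofReal ?_
    have h1 : ‖w n‖ ≤ M + ‖y‖ := (norm_sub_le _ _).trans (add_le_add_left (hM _) _)
    have := pow_le_pow_left₀ (norm_nonneg _) h1 2
    linarith
  have hsum : ∀ ρ z, Tendsto (fun n => magSum A ρ (w n).snd z) atTop (𝓝 0) := by
    intro ρ z
    obtain ⟨a, b, hab⟩ := exists_magSum_eq_inner (s := s) hm hA ρ z
    simp only [hab]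
    have := (hw a).const_mul b
    rwa [mul_zero] at this
  have hlq := fun q (h1 : 2 < q) (h2 : q < 6 / (3 - 2 * s)) =>
    tendsto_lintegral_rpow hs hs' hm hA (fun n => aestronglyMeasurable_snd hm (w n))
      (fun n => (hwX n).2) (by positivity) hwN hsum h1 h2
  set u : R3 → ℂ := ⇑y.snd with hu
  have hyg : IsGraph s m A y := hyX.1.1
  have humem : u ∈ HsARad s m A := ⟨hyX.1.2, hyX.2⟩
  have hD : 1 ≤ functionalD α p u := by
    refine one_le_functionalD_of_tendsto hs hs' hm hα hα' hp hp' hA humem.1.1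
      (fun n => aestronglyMeasurable_snd hm (w n)) (fun n => (hvmem (φ n)).1.1.1)
      (fun n => ?_) (fun n => hvD (φ n)) hlq
    filter_upwards [embed_snd hs hs' hm hA (hvmem (φ n)).1.1,
      snd_sub_ae hm (e (φ n)) y] with x h1 h2
    have h3 : ((w n).snd : R3 → ℂ) x =
      ((e (φ n)) - y).snd x := rfl
    rw [Pi.add_apply, h3, h2, Pi.sub_apply, ← h1]
    simp only [hu, he]
    ring
  have hne : ¬ u =ᵐ[volume] 0 := ne_zero_of_functionalD hp0 (one_pos.trans_le hD).ne'
  have hN : normSq s m A u ≤ τ := by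
    rw [hyg.normSq_snd hs hs' hm hA, ← ofReal_norm, ← ENNReal.ofReal_pow (norm_nonneg _)]
    refine ENNReal.ofReal_le_of_le_toReal ?_
    calc ‖y‖ ^ 2 ≤ Real.sqrt τ.toReal ^ 2 := by gcongr
      _ = τ.toReal := Real.sq_sqrt ENNReal.toReal_nonneg
  have hG : functionalG s m α p A u = τ := by
    refine le_antisymm ?_ (tauRad_le s m α p A humem hne)
    refine le_trans (ENNReal.div_le_of_le_mul ?_) hN
    have h1 : 1 ≤ functionalD α p u ^ (1 / p) := by
      calc (1 : ℝ≥0∞) = 1 ^ (1 / p) := (ENNReal.one_rpow _).symm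
        _ ≤ _ := by gcongr
    calc normSq s m A u = normSq s m A u * 1 := (mul_one _).symm
      _ ≤ _ := by gcongr
  rw [← hG]
  exact exists_normalize hs hs' hm hα hα' hp hp' hA humem hne

theorem normSq_pos (hm : 0 < m) {u : R3 → ℂ} (hu : AEStronglyMeasurable u volume)
    (hne : ¬ u =ᵐ[volume] 0) : 0 < normSq s m A u := by
  rw [pos_iff_ne_zero]
  intro h
  refine hne ?_
  unfold normSq at h
  rw [add_eq_zero, mul_eq_zero, mul_eq_zero] at h
  rcases h.2 with h | h
  · rw [ENNReal.ofReal_eq_zero] at h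
    have : 0 < m ^ (2 * s) := by positivity
    linarith
  · rw [lintegral_eq_zero_iff' (hu.enorm.pow_const 2)] at h
    filter_upwards [h] with x hx
    simpa using hx

/-- The infimum is attained at a nonzero function, whose mass term is positive. -/
theorem tauRad_pos (hs : 0 < s) (hs' : s < 1) (hm : 0 < m) (hα : 0 < α) (hα' : α < 3)
    (hp : 1 + α / 3 < p) (hp' : p < (3 + α) / (3 - 2 * s)) (hA : Continuous A) :
    0 < tauRad s m α p A := by
  obtain ⟨u, hu, hD, hN⟩ := exists_minimizer hs hs' hm hα hα' hp hp' hA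
  rw [← hN]
  exact normSq_pos hm hu.1.1.1 (ne_zero_of_functionalD (α := α) (p := p) (by linarith) (by rw [hD]; exact one_ne_zero))

end existence

/-! ### Differentiating the Choquard energy. -/

theorem hasDerivAt_norm_add_smul_rpow (a c : ℂ) {p : ℝ} (hp : 1 < p) (t : ℝ) :
    HasDerivAt (fun t : ℝ => ‖a + t • c‖ ^ p)
      (p * ‖a + t • c‖ ^ (p - 2) * inner ℝ (a + t • c) c) t := by
  have h1 : HasDerivAt (fun t : ℝ => a + t • c) c t := by
    simpa using ((hasDerivAt_id t).smul_const c).const_add a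
  have h2 := (hasFDerivAt_norm_rpow (a + t • c) hp).comp_hasDerivAt t h1
  exact h2

/-- The exponent $p-2$ may be negative. The extra factor $\|a\|$ compensates, leaving $\|a\|^{p-1}$
with $p-1>0$, also at $a=0$. -/
theorem norm_rpow_sub_two_mul_le {p : ℝ} (hp : 1 < p) {a c : ℂ} {r : ℝ} (ha : ‖a‖ ≤ r) (hc : ‖c‖ ≤ r) :
    ‖a‖ ^ (p - 2) * (‖a‖ * ‖c‖) ≤ r ^ p := by
  have hr : 0 ≤ r := (norm_nonneg _).trans ha
  have h1 : ‖a‖ ^ (p - 2) * ‖a‖ = ‖a‖ ^ (p - 1) := by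
    rcases eq_or_ne ‖a‖ 0 with h0 | h0
    · rw [h0, mul_zero, Real.zero_rpow (by linarith)]
    · rw [← Real.rpow_add_one h0]; congr 1; ring
  rw [← mul_assoc, h1]
  calc ‖a‖ ^ (p - 1) * ‖c‖ ≤ r ^ (p - 1) * r := by gcongr
    _ = r ^ p := by
      rcases hr.eq_or_lt with h0 | h0
      · rw [← h0, mul_zero, Real.zero_rpow (by linarith)]
      · rw [← Real.rpow_add_one h0.ne']; congr 1; ring

/-- The density of the Choquard nonlinearity. -/
def choquardWeight (α p : ℝ) (u : R3 → ℂ) (x : R3) : ℝ :=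
  (rieszConv α p u x).toReal * ‖u x‖ ^ (p - 2)

section derivative

variable {s m α p : ℝ} {A : R3 → R3}

theorem aestronglyMeasurable_choquardWeight (α p : ℝ) {u : R3 → ℂ} (hu : AEStronglyMeasurable u volume) :
    AEStronglyMeasurable (choquardWeight α p u) volume := by
  have h1 := (aemeasurable_rieszConv α p hu).ennreal_toReal
  have h2 := hu.norm.aemeasurable.pow_const (p - 2)
  exact (h1.mul h2).aestronglyMeasurable

/-- Both occurrences of $u$ and the test function are dominated by $|u|+|v|$, reducing integrability
of the weak formulation to finiteness of the double integral. -/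
theorem lintegral_choquard_le (hp : 1 < p) {u v : R3 → ℂ} (hu : AEStronglyMeasurable u volume)
    (hv : AEStronglyMeasurable v volume) :
    ∫⁻ x, ‖(choquardWeight α p u x : ℂ) * u x * (starRingEnd ℂ) (v x)‖ₑ ≤
      rieszForm α p (fun x => ‖u x‖ₑ + ‖v x‖ₑ) (fun x => ‖u x‖ₑ + ‖v x‖ₑ) := by
  have hsum : AEMeasurable (fun x => ‖u x‖ₑ + ‖v x‖ₑ) volume := hu.enorm.add hv.enorm
  have hp0 : 0 < p := by linarith
  rw [rieszForm_eq hsum hsum]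
  refine lintegral_mono fun x => ?_
  have h1 : ‖u x‖ ^ (p - 2) * (‖u x‖ * ‖v x‖) ≤ (‖u x‖ + ‖v x‖) ^ p :=
    norm_rpow_sub_two_mul_le hp (by linarith [norm_nonneg (v x)]) (by linarith [norm_nonneg (u x)])
  calc ‖(choquardWeight α p u x : ℂ) * u x * (starRingEnd ℂ) (v x)‖ₑ
      = ENNReal.ofReal ((rieszConv α p u x).toReal * (‖u x‖ ^ (p - 2) * (‖u x‖ * ‖v x‖))) := by
        rw [← ofReal_norm, norm_mul, norm_mul, RCLike.norm_conj, Complex.norm_real, choquardWeight,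
          Real.norm_of_nonneg (by positivity)]
        congr 1; ring
    _ ≤ ENNReal.ofReal ((rieszConv α p u x).toReal * (‖u x‖ + ‖v x‖) ^ p) := by gcongr
    _ = ENNReal.ofReal (rieszConv α p u x).toReal * (‖u x‖ₑ + ‖v x‖ₑ) ^ p := by
        rw [ENNReal.ofReal_mul (by positivity), ← ENNReal.ofReal_rpow_of_nonneg (by positivity) hp0.le,
          ENNReal.ofReal_add (by positivity) (by positivity), ofReal_norm, ofReal_norm]
    _ ≤ rieszConv α p u x * (‖u x‖ₑ + ‖v x‖ₑ) ^ p := by gcongr; exact ENNReal.ofReal_toReal_le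
    _ ≤ _ := by
        gcongr
        refine lintegral_mono fun y => ?_
        gcongr
        exact le_self_add

theorem integrable_choquard (hs : 0 < s) (hs' : s < 1) (hm : 0 < m) (hα : 0 < α) (hα' : α < 3)
    (hp : 1 + α / 3 < p) (hp' : p < (3 + α) / (3 - 2 * s)) (hA : Continuous A) {u v : R3 → ℂ}
    (hu : FiniteNorm s m A u) (hv : FiniteNorm s m A v) :
    Integrable (fun x => (choquardWeight α p u x : ℂ) * u x * (starRingEnd ℂ) (v x)) volume := by
  refine ⟨?_, (lintegral_choquard_le (by linarith) hu.1 hv.1).trans_lt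
    (rieszForm_add_lt_top hs hs' hm hα hα' hp hp' hA hu hv)⟩
  have h1 := Complex.continuous_ofReal.comp_aestronglyMeasurable
    (aestronglyMeasurable_choquardWeight α p hu.1)
  exact (h1.mul hu.1).mul (Complex.continuous_conj.comp_aestronglyMeasurable hv.1)

theorem integrable_riesz_bound (hs : 0 < s) (hs' : s < 1) (hm : 0 < m) (hα : 0 < α) (hα' : α < 3)
    (hp : 1 + α / 3 < p) (hp' : p < (3 + α) / (3 - 2 * s)) (hA : Continuous A) {u v : R3 → ℂ}
    (hu : FiniteNorm s m A u) (hv : FiniteNorm s m A v) :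
    Integrable (fun z : R3 × R3 => rieszPotential α (z.1 - z.2) * (‖u z.1‖ + ‖v z.1‖) ^ p *
      (‖u z.2‖ + ‖v z.2‖) ^ p) volume := by
  have hp0 : 0 ≤ p := by linarith
  have q1 := Measure.quasiMeasurePreserving_fst (μ := (volume : Measure R3)) (ν := (volume : Measure R3))
  have q2 := Measure.quasiMeasurePreserving_snd (μ := (volume : Measure R3)) (ν := (volume : Measure R3))
  have hsum : AEMeasurable (fun x => ‖u x‖ + ‖v x‖) volume :=
    hu.1.norm.aemeasurable.add hv.1.norm.aemeasurable
  refine ⟨?_, ?_⟩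
  · refine AEMeasurable.aestronglyMeasurable ((AEMeasurable.mul ?_ ?_).mul ?_)
    · exact ((measurable_rieszPotential α).comp (measurable_fst.sub measurable_snd)).aemeasurable
    · exact (hsum.comp_quasiMeasurePreserving q1).pow_const p
    · exact (hsum.comp_quasiMeasurePreserving q2).pow_const p
  · refine lt_of_eq_of_lt (lintegral_congr fun z => ?_)
      (rieszForm_add_lt_top hs hs' hm hα hα' hp hp' hA hu hv)
    have h0 := rieszPotential_nonneg hα hα' (z.1 - z.2)
    rw [Real.enorm_of_nonneg (by positivity), ENNReal.ofReal_mul (by positivity), ENNReal.ofReal_mul h0,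
      ← ENNReal.ofReal_rpow_of_nonneg (by positivity) hp0,
      ← ENNReal.ofReal_rpow_of_nonneg (by positivity) hp0,
      ENNReal.ofReal_add (by positivity) (by positivity),
      ENNReal.ofReal_add (by positivity) (by positivity), ofReal_norm, ofReal_norm, ofReal_norm, ofReal_norm]

theorem functionalD_toReal_eq (hα : 0 < α) (hα' : α < 3) (hp : 0 ≤ p) {u : R3 → ℂ}
    (hu : AEStronglyMeasurable u volume) : (functionalD α p u).toReal =
    ∫ z : R3 × R3, rieszPotential α (z.1 - z.2) * ‖u z.1‖ ^ p * ‖u z.2‖ ^ p := by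
  have q1 := Measure.quasiMeasurePreserving_fst (μ := (volume : Measure R3)) (ν := (volume : Measure R3))
  have q2 := Measure.quasiMeasurePreserving_snd (μ := (volume : Measure R3)) (ν := (volume : Measure R3))
  have hn : AEMeasurable (fun x => ‖u x‖) volume := hu.norm.aemeasurable
  rw [functionalD_eq α p hu, integral_eq_lintegral_of_nonneg_ae]
  · rw [rieszForm]
    congr 1
    refine lintegral_congr fun z => ?_
    have h0 := rieszPotential_nonneg hα hα' (z.1 - z.2)
    rw [ENNReal.ofReal_mul (by positivity), ENNReal.ofReal_mul h0,
      ← ENNReal.ofReal_rpow_of_nonneg (by positivity) hp,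
      ← ENNReal.ofReal_rpow_of_nonneg (by positivity) hp, ofReal_norm, ofReal_norm]
  · refine ae_of_all _ fun z => ?_
    have h0 := rieszPotential_nonneg hα hα' (z.1 - z.2)
    simp only [Pi.zero_apply]
    positivity
  · refine AEMeasurable.aestronglyMeasurable ((AEMeasurable.mul ?_ ?_).mul ?_)
    · exact ((measurable_rieszPotential α).comp (measurable_fst.sub measurable_snd)).aemeasurable
    · exact (hn.comp_quasiMeasurePreserving q1).pow_const p
    · exact (hn.comp_quasiMeasurePreserving q2).pow_const p

theorem rieszConv_toReal_eq (hα : 0 < α) (hα' : α < 3) (hp : 0 ≤ p) {u : R3 → ℂ}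
    (hu : AEStronglyMeasurable u volume) (x : R3) : (rieszConv α p u x).toReal =
    ∫ y, rieszPotential α (x - y) * ‖u y‖ ^ p := by
  have hn : AEMeasurable (fun x => ‖u x‖) volume := hu.norm.aemeasurable
  rw [rieszConv, integral_eq_lintegral_of_nonneg_ae]
  · congr 1
    refine lintegral_congr fun y => ?_
    rw [ENNReal.ofReal_mul (rieszPotential_nonneg hα hα' _),
      ← ENNReal.ofReal_rpow_of_nonneg (by positivity) hp, ofReal_norm]
  · refine ae_of_all _ fun y => ?_
    have h0 := rieszPotential_nonneg hα hα' (x - y)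
    simp only [Pi.zero_apply]
    positivity
  · refine AEMeasurable.aestronglyMeasurable (AEMeasurable.mul ?_ (hn.pow_const p))
    exact ((measurable_rieszPotential α).comp (measurable_const.sub measurable_id)).aemeasurable

theorem integral_choquard_re (hs : 0 < s) (hs' : s < 1) (hm : 0 < m) (hα : 0 < α) (hα' : α < 3)
    (hp : 1 + α / 3 < p) (hp' : p < (3 + α) / (3 - 2 * s)) (hA : Continuous A) {u v : R3 → ℂ}
    (hu : FiniteNorm s m A u) (hv : FiniteNorm s m A v) :
    (∫ x, (choquardWeight α p u x : ℂ) * u x * (starRingEnd ℂ) (v x)).re =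
      ∫ x, choquardWeight α p u x * inner ℝ (u x) (v x) := by
  rw [← Complex.reCLM_apply, ← Complex.reCLM.integral_comp_comm
    (integrable_choquard hs hs' hm hα hα' hp hp' hA hu hv)]
  refine integral_congr_ae (ae_of_all _ fun x => ?_)
  simp only [Complex.reCLM_apply, mul_assoc, Complex.re_ofReal_mul]
  rw [Complex.inner]
  simp only [Complex.mul_re, Complex.conj_re, Complex.conj_im]
  ring

/-- The derivative of the Choquard energy along a line. -/
theorem hasDerivAt_functionalD (hs : 0 < s) (hs' : s < 1) (hm : 0 < m) (hα : 0 < α) (hα' : α < 3)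
    (hp : 1 + α / 3 < p) (hp' : p < (3 + α) / (3 - 2 * s)) (hA : Continuous A) {u v : R3 → ℂ}
    (hu : FiniteNorm s m A u) (hv : FiniteNorm s m A v) :
    HasDerivAt (fun t : ℝ => (functionalD α p (u + (t : ℂ) • v)).toReal)
      (2 * p * (∫ x, (choquardWeight α p u x : ℂ) * u x * (starRingEnd ℂ) (v x)).re) 0 := by
  have hp1 : 1 < p := by linarith
  have hp0 : 0 ≤ p := by linarith
  have q1 := Measure.quasiMeasurePreserving_fst (μ := (volume : Measure R3)) (ν := (volume : Measure R3))
  have q2 := Measure.quasiMeasurePreserving_snd (μ := (volume : Measure R3)) (ν := (volume : Measure R3))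
  have hbound := integrable_riesz_bound hs hs' hm hα hα' hp hp' hA hu hv
  have hI : Measurable fun z : R3 × R3 => rieszPotential α (z.1 - z.2) :=
    (measurable_rieszPotential α).comp (measurable_fst.sub measurable_snd)
  have hN : ∀ t : ℝ, AEMeasurable (fun x => ‖u x + t • v x‖ ^ p) volume := fun t =>
    (hu.1.add (hv.1.const_smul t)).norm.aemeasurable.pow_const p
  have hN' : AEMeasurable (fun x => p * ‖u x + (0 : ℝ) • v x‖ ^ (p - 2) *
      inner ℝ (u x + (0 : ℝ) • v x) (v x)) volume := by
    have h1 := hu.1.add (hv.1.const_smul (0 : ℝ))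
    exact ((h1.norm.aemeasurable.pow_const (p - 2)).const_mul p).mul (h1.inner hv.1).aemeasurable
  set F : ℝ → R3 × R3 → ℝ := fun t z => rieszPotential α (z.1 - z.2) * ‖u z.1 + t • v z.1‖ ^ p *
    ‖u z.2 + t • v z.2‖ ^ p with hF
  set F' : ℝ → R3 × R3 → ℝ := fun t z => rieszPotential α (z.1 - z.2) *
    (p * ‖u z.1 + t • v z.1‖ ^ (p - 2) * inner ℝ (u z.1 + t • v z.1) (v z.1)) *
      ‖u z.2 + t • v z.2‖ ^ p + rieszPotential α (z.1 - z.2) * ‖u z.1 + t • v z.1‖ ^ p *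
      (p * ‖u z.2 + t • v z.2‖ ^ (p - 2) * inner ℝ (u z.2 + t • v z.2) (v z.2)) with hF'
  have hle : ∀ t ∈ Metric.ball (0 : ℝ) 1, ∀ x, ‖u x + t • v x‖ ≤ ‖u x‖ + ‖v x‖ := by
    intro t ht x
    refine (norm_add_le _ _).trans ?_
    rw [norm_smul]
    have h1 : ‖t‖ ≤ 1 := by rw [mem_ball_zero_iff] at ht; exact ht.le
    nlinarith [norm_nonneg (v x)]
  -- For $|t|<1$ the derivative of $|u+tv|^p$ is at most $p(|u|+|v|)^p$, uniformly in $t$; this is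
  -- what permits differentiation under the double integral.
  have hle2 : ∀ t ∈ Metric.ball (0 : ℝ) 1, ∀ x, |p * ‖u x + t • v x‖ ^ (p - 2) *
      inner ℝ (u x + t • v x) (v x)| ≤ p * (‖u x‖ + ‖v x‖) ^ p := by
    intro t ht x
    rw [mul_assoc, abs_mul, abs_mul, abs_of_nonneg hp0, abs_of_nonneg (by positivity)]
    gcongr
    refine le_trans ?_ (norm_rpow_sub_two_mul_le hp1 (hle t ht x)
      (by linarith [norm_nonneg (u x)] : ‖v x‖ ≤ ‖u x‖ + ‖v x‖))
    gcongr
    exact abs_real_inner_le_norm _ _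
  have hF'b : ∀ z : R3 × R3, ∀ t ∈ Metric.ball (0 : ℝ) 1, ‖F' t z‖ ≤ 2 * p * (rieszPotential α (z.1 - z.2) *
      (‖u z.1‖ + ‖v z.1‖) ^ p * (‖u z.2‖ + ‖v z.2‖) ^ p) := by
    intro z t ht
    have h0 := rieszPotential_nonneg hα hα' (z.1 - z.2)
    have h1 := hle2 t ht z.1
    have h2 := hle2 t ht z.2
    simp only [hF', Real.norm_eq_abs]
    generalize p * ‖u z.1 + t • v z.1‖ ^ (p - 2) * inner ℝ (u z.1 + t • v z.1) (v z.1) = a₁ at h1 ⊢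
    generalize p * ‖u z.2 + t • v z.2‖ ^ (p - 2) * inner ℝ (u z.2 + t • v z.2) (v z.2) = a₂ at h2 ⊢
    refine (abs_add_le _ _).trans ?_
    rw [abs_mul, abs_mul, abs_mul, abs_mul, abs_of_nonneg h0, abs_of_nonneg (by positivity : (0 : ℝ) ≤
      ‖u z.2 + t • v z.2‖ ^ p), abs_of_nonneg (by positivity : (0 : ℝ) ≤ ‖u z.1 + t • v z.1‖ ^ p)]
    calc _ ≤ rieszPotential α (z.1 - z.2) * (p * (‖u z.1‖ + ‖v z.1‖) ^ p) * (‖u z.2‖ + ‖v z.2‖) ^ p +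
          rieszPotential α (z.1 - z.2) * (‖u z.1‖ + ‖v z.1‖) ^ p * (p * (‖u z.2‖ + ‖v z.2‖) ^ p) := by
          gcongr
          · exact hle t ht z.2
          · exact hle t ht z.1
      _ = _ := by ring
  have hFm : ∀ t, AEStronglyMeasurable (F t) volume := fun t =>
    ((hI.aemeasurable.mul ((hN t).comp_quasiMeasurePreserving q1)).mul
      ((hN t).comp_quasiMeasurePreserving q2)).aestronglyMeasurable
  have hF'm : AEStronglyMeasurable (F' 0) volume :=
    (((hI.aemeasurable.mul (hN'.comp_quasiMeasurePreserving q1)).mul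
      ((hN 0).comp_quasiMeasurePreserving q2)).add
    ((hI.aemeasurable.mul ((hN 0).comp_quasiMeasurePreserving q1)).mul
      (hN'.comp_quasiMeasurePreserving q2))).aestronglyMeasurable
  have hFi : Integrable (F 0) volume := by
    refine hbound.mono' (hFm 0) (ae_of_all _ fun z => ?_)
    have h0 := rieszPotential_nonneg hα hα' (z.1 - z.2)
    have hz : (0 : ℝ) ∈ Metric.ball (0 : ℝ) 1 := by simp
    simp only [hF]
    rw [Real.norm_of_nonneg (by positivity)]
    gcongr
    · exact hle 0 hz z.1
    · exact hle 0 hz z.2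
  obtain ⟨hF'i, hder⟩ := hasDerivAt_integral_of_dominated_loc_of_deriv_le (F := F) (F' := F') (x₀ := (0 : ℝ))
    (Metric.ball_mem_nhds (0 : ℝ) one_pos) (Eventually.of_forall hFm) hFi hF'm
    (ae_of_all _ fun z => hF'b z) (hbound.const_mul (2 * p)) (ae_of_all _ fun z t _ => by
      have h1 := hasDerivAt_norm_add_smul_rpow (u z.1) (v z.1) hp1 t
      have h2 := hasDerivAt_norm_add_smul_rpow (u z.2) (v z.2) hp1 t
      exact (h1.const_mul (rieszPotential α (z.1 - z.2))).mul h2)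
  set H : R3 × R3 → ℝ := fun z => rieszPotential α (z.1 - z.2) * ‖u z.2‖ ^ p *
    (‖u z.1‖ ^ (p - 2) * inner ℝ (u z.1) (v z.1)) with hH
  have hHm : AEStronglyMeasurable H volume := by
    have h1 : AEMeasurable (fun x => ‖u x‖ ^ p) volume := hu.1.norm.aemeasurable.pow_const p
    have h2 : AEMeasurable (fun x => ‖u x‖ ^ (p - 2) * inner ℝ (u x) (v x)) volume :=
      (hu.1.norm.aemeasurable.pow_const (p - 2)).mul (hu.1.inner hv.1).aemeasurable
    exact ((hI.aemeasurable.mul (h1.comp_quasiMeasurePreserving q2)).mul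
      (h2.comp_quasiMeasurePreserving q1)).aestronglyMeasurable
  have hHi : Integrable H volume := by
    refine hbound.mono' hHm (ae_of_all _ fun z => ?_)
    have h0 := rieszPotential_nonneg hα hα' (z.1 - z.2)
    rw [hH, Real.norm_eq_abs, abs_mul, abs_mul, abs_mul, abs_of_nonneg h0,
      abs_of_nonneg (by positivity : (0 : ℝ) ≤ ‖u z.2‖ ^ p),
      abs_of_nonneg (by positivity : (0 : ℝ) ≤ ‖u z.1‖ ^ (p - 2)), mul_right_comm]
    gcongr
    · refine le_trans ?_ (norm_rpow_sub_two_mul_le hp1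
        (by linarith [norm_nonneg (v z.1)] : ‖u z.1‖ ≤ ‖u z.1‖ + ‖v z.1‖)
        (by linarith [norm_nonneg (u z.1)] : ‖v z.1‖ ≤ ‖u z.1‖ + ‖v z.1‖))
      gcongr
      exact abs_real_inner_le_norm _ _
    · linarith [norm_nonneg (v z.2)]
  have hHint : ∫ z, H z = ∫ x, choquardWeight α p u x * inner ℝ (u x) (v x) := by
    rw [Measure.volume_eq_prod] at hHi ⊢
    rw [integral_prod _ hHi]
    refine integral_congr_ae (ae_of_all _ fun x => ?_)
    simp only [hH]
    rw [integral_mul_const, ← rieszConv_toReal_eq hα hα' hp0 hu.1, choquardWeight]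
    ring
  have hHswap : ∫ z : R3 × R3, H z.swap = ∫ z, H z := by
    rw [Measure.volume_eq_prod]
    exact integral_prod_swap H
  have hHswapi : Integrable (fun z : R3 × R3 => H z.swap) volume := by
    rw [Measure.volume_eq_prod] at hHi ⊢
    exact hHi.swap
  have hval : ∫ z, F' 0 z = 2 * p * (∫ x, (choquardWeight α p u x : ℂ) * u x * (starRingEnd ℂ) (v x)).re := by
    -- The two product-rule terms are exchanged by swapping $x$ and $y$, since the Riesz kernel is
    -- even; this produces the factor $2p$.
    have h1 : ∀ z, F' 0 z = p * H z + p * H z.swap := fun z => by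
      have h2 : rieszPotential α (z.2 - z.1) = rieszPotential α (z.1 - z.2) := by
        simp only [rieszPotential, norm_sub_rev]
      simp only [hF', hH, zero_smul, add_zero, Prod.fst_swap, Prod.snd_swap, h2]
      ring
    simp only [h1]
    rw [integral_add (hHi.const_mul p) (hHswapi.const_mul p), integral_const_mul, integral_const_mul,
      hHswap, hHint, integral_choquard_re hs hs' hm hα hα' hp hp' hA hu hv]
    ring
  rw [← hval]
  refine hder.congr_of_eventuallyEq (Eventually.of_forall fun t => ?_)
  simp only
  rw [functionalD_toReal_eq hα hα' hp0 (hu.1.add (hv.1.const_smul (t : ℂ)))]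
  refine integral_congr_ae (ae_of_all _ fun z => ?_)
  simp only [hF, Pi.add_apply, Pi.smul_apply, smul_eq_mul, Complex.real_smul]

end derivative

/-! ### Riesz representation, rotations, and continuity of the nonlinearity. -/

/-- Riesz representation on a closed subspace. -/
theorem exists_inner_eq {E : Type*} [NormedAddCommGroup E] [InnerProductSpace ℂ E] [CompleteSpace E]
    {X : Submodule ℂ E} (hX : IsClosed (X : Set E)) {l : E → ℂ} {M : ℝ}
    (hadd : ∀ e ∈ X, ∀ f ∈ X, l (e + f) = l e + l f) (hsmul : ∀ c : ℂ, ∀ e ∈ X, l (c • e) = c * l e)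
    (hb : ∀ e ∈ X, ‖e‖ ≤ 1 → ‖l e‖ ≤ M) : ∃ w ∈ X, ∀ v ∈ X, inner ℂ w v = l v := by
  have : CompleteSpace X := hX.completeSpace_coe
  let f : X →ₗ[ℂ] ℂ :=
    { toFun := fun e => l e
      map_add' := fun e f => hadd e e.2 f f.2
      map_smul' := fun c e => hsmul c e e.2 }
  have hf : ∀ z : X, ‖f z‖ ≤ M / 1 * ‖z‖ := fun z =>
    LinearMap.bound_of_ball_bound' one_pos M f (fun y hy => hb y y.2 (by simpa using hy)) z
  let F : StrongDual ℂ X := f.mkContinuous _ hf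
  refine ⟨((InnerProductSpace.toDual ℂ X).symm F : X), Subtype.property _, fun v hv => ?_⟩
  have h1 := InnerProductSpace.toDual_symm_apply (𝕜 := ℂ) (x := (⟨v, hv⟩ : X)) (y := F)
  rw [Submodule.coe_inner] at h1
  exact h1

section rotation

variable {s m α p : ℝ} {A : R3 → R3}

/-- The invariance condition on $A$ says exactly that the phase at $(gx,gy)$ is the phase at
$(x,y)$; hence composing with $g$ preserves the norm. -/
theorem magDiff_comp (hinv : InvarianceCondition A) (g : R3 ≃ₗᵢ[ℝ] R3) (u : R3 → ℂ) (x y : R3) :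
    magDiff A (fun x => u (g x)) x y = magDiff A u (g x) (g y) := by
  have h := hinv g x y
  rw [map_sub, map_smul, map_add] at h
  rw [magDiff, magDiff, h]

theorem measurableEmbedding_prodMap (g : R3 ≃ₗᵢ[ℝ] R3) : MeasurableEmbedding (Prod.map g g) :=
  g.toHomeomorph.measurableEmbedding.prodMap g.toHomeomorph.measurableEmbedding

theorem measurePreserving_prodMap (g : R3 ≃ₗᵢ[ℝ] R3) :
    MeasurePreserving (Prod.map g g) (volume : Measure (R3 × R3)) volume :=
  g.measurePreserving.prod g.measurePreserving

theorem normSq_comp (s m : ℝ) (hinv : InvarianceCondition A) (g : R3 ≃ₗᵢ[ℝ] R3) (u : R3 → ℂ) :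
    normSq s m A (fun x => u (g x)) = normSq s m A u := by
  unfold normSq
  congr 2
  · rw [← (measurePreserving_prodMap g).lintegral_comp_emb (measurableEmbedding_prodMap g)
      (fun z => ‖magDiff A u z.1 z.2‖ₑ ^ 2 * ENNReal.ofReal (kernel s m (z.1 - z.2)))]
    refine lintegral_congr fun z => ?_
    rw [magDiff_comp hinv, Prod.map_fst, Prod.map_snd, ← map_sub, kernel_map]
  · exact g.measurePreserving.lintegral_comp_emb g.toHomeomorph.measurableEmbedding
      (fun x => ‖u x‖ₑ ^ 2)

theorem HsA_comp (hinv : InvarianceCondition A) (g : R3 ≃ₗᵢ[ℝ] R3) {u : R3 → ℂ}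
    (hu : u ∈ HsA s m A) : (fun x => u (g x)) ∈ HsA s m A := by
  refine ⟨⟨hu.1.1.comp_measurePreserving g.measurePreserving, ?_⟩, fun ε hε => ?_⟩
  · rw [normSq_comp s m hinv]; exact hu.1.2
  · obtain ⟨φ, h1, h2, h3⟩ := hu.2 ε hε
    refine ⟨fun x => φ (g x), h1.comp g.contDiff, h2.comp_homeomorph g.toHomeomorph, ?_⟩
    rwa [← normSq_comp s m hinv g] at h3

theorem rieszConv_comp (α p : ℝ) {u : R3 → ℂ} (hu : IsRadial u) (g : R3 ≃ₗᵢ[ℝ] R3) (x : R3) :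
    rieszConv α p u (g x) = rieszConv α p u x := by
  rw [rieszConv, ← g.measurePreserving.lintegral_comp_emb g.toHomeomorph.measurableEmbedding]
  refine lintegral_congr_ae ?_
  filter_upwards [hu g] with y hy
  rw [hy, ← map_sub, rieszPotential, rieszPotential, LinearIsometryEquiv.norm_map]

theorem integral_choquard_comp (α p : ℝ) {u : R3 → ℂ} (hu : IsRadial u) (g : R3 ≃ₗᵢ[ℝ] R3)
    (v : R3 → ℂ) : ∫ x, (choquardWeight α p u x : ℂ) * u x * (starRingEnd ℂ) (v (g x)) =
      ∫ x, (choquardWeight α p u x : ℂ) * u x * (starRingEnd ℂ) (v x) := by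
  rw [← g.measurePreserving.integral_comp g.toHomeomorph.measurableEmbedding
    (fun x => (choquardWeight α p u x : ℂ) * u x * (starRingEnd ℂ) (v x))]
  refine integral_congr_ae ?_
  filter_upwards [hu g] with x hx
  rw [hx, choquardWeight, choquardWeight, rieszConv_comp α p hu, hx]

end rotation

section bound

variable {s m α p : ℝ} {A : R3 → R3}

theorem exists_lintegral_rpow_le (hs : 0 < s) (hs' : s < 1) (hm : 0 < m) (hA : Continuous A) {q : ℝ}
    (hq : 2 ≤ q) (hq' : q ≤ 6 / (3 - 2 * s)) : ∃ M : ℝ≥0∞, M ≠ ∞ ∧ ∀ u : R3 → ℂ,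
      AEStronglyMeasurable u volume → normSq s m A u ≤ 1 → ∫⁻ x, ‖u x‖ₑ ^ q ≤ M := by
  obtain ⟨S, hS, hsob⟩ := exists_sobolev hs hs' hm
  obtain ⟨C, hC, hE⟩ := exists_energy_le_normSq hs hs' hm
  have hd : 0 < 3 - 2 * s := by linarith
  have hQ : 2 < 6 / (3 - 2 * s) := by rw [lt_div_iff₀ hd]; linarith
  have e1 : 0 ≤ (6 / (3 - 2 * s) - q) / (6 / (3 - 2 * s) - 2) := div_nonneg (by linarith) (by linarith)
  have e2 : 0 ≤ (q - 2) / (6 / (3 - 2 * s) - 2) := div_nonneg (by linarith) (by linarith)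
  have e3 : 0 ≤ 3 / (3 - 2 * s) := by positivity
  refine ⟨ENNReal.ofReal C ^ ((6 / (3 - 2 * s) - q) / (6 / (3 - 2 * s) - 2)) *
    (ENNReal.ofReal S ^ (3 / (3 - 2 * s))) ^ ((q - 2) / (6 / (3 - 2 * s) - 2)),
    ENNReal.mul_ne_top (ENNReal.rpow_ne_top_of_nonneg e1 (by simp))
      (ENNReal.rpow_ne_top_of_nonneg e2 (ENNReal.rpow_ne_top_of_nonneg e3 (by simp))),
    fun u hu hN => ?_⟩
  refine (lintegral_rpow_interpolate (by norm_num) hq hq' hQ _ hu.enorm).trans ?_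
  have h1 : ∀ K : ℝ≥0∞, K * normSq s m A u ≤ K := fun K => mul_le_of_le_one_right' hN
  gcongr
  · refine le_trans ?_ ((hE A hA u hu).trans (h1 _))
    refine lintegral_mono fun x => ?_
    rw [ENNReal.rpow_ofNat]
    exact le_add_self
  · exact (hsob A hA u hu).trans (by gcongr; exact h1 _)

/-- Subcritical norms are bounded on the unit ball of $H^s_A$, so the Choquard term is a bounded
functional of $v$. -/
theorem exists_integral_choquard_le (hs : 0 < s) (hs' : s < 1) (hm : 0 < m) (hα : 0 < α) (hα' : α < 3)
    (hp : 1 + α / 3 < p) (hp' : p < (3 + α) / (3 - 2 * s)) (hA : Continuous A) {u : R3 → ℂ}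
    (hu : FiniteNorm s m A u) : ∃ M : ℝ, ∀ v : R3 → ℂ, AEStronglyMeasurable v volume →
      normSq s m A v ≤ 1 →
      ‖∫ x, (choquardWeight α p u x : ℂ) * u x * (starRingEnd ℂ) (v x)‖ ≤ M := by
  obtain ⟨q₁, q₂, b₁, b₂, K₁, K₂, h1, h2, h3, h4, h5, h6, h7, h8, H⟩ :=
    exists_riesz_bound hs hs' hα hα' hp hp'
  have key : ∀ q, 2 < q → q < 6 / (3 - 2 * s) → ∃ M : ℝ≥0∞, M ≠ ∞ ∧ ∀ v : R3 → ℂ,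
      AEStronglyMeasurable v volume → normSq s m A v ≤ 1 → ∫⁻ x, (‖u x‖ₑ + ‖v x‖ₑ) ^ q ≤ M := by
    intro q hq hq'
    obtain ⟨M, hM, hv⟩ := exists_lintegral_rpow_le hs hs' hm hA hq.le hq'.le
    have hu' := lintegral_rpow_lt_top hs hs' hm hA hu hq.le hq'.le
    have h2t : (2 : ℝ≥0∞) ^ (q - 1) ≠ ∞ := ENNReal.rpow_ne_top_of_nonneg (by linarith) (by simp)
    refine ⟨2 ^ (q - 1) * ((∫⁻ x, ‖u x‖ₑ ^ q) + M),
      ENNReal.mul_ne_top h2t (ENNReal.add_ne_top.2 ⟨hu'.ne, hM⟩), fun v hvm hN => ?_⟩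
    calc ∫⁻ x, (‖u x‖ₑ + ‖v x‖ₑ) ^ q ≤ ∫⁻ x, 2 ^ (q - 1) * (‖u x‖ₑ ^ q + ‖v x‖ₑ ^ q) :=
          lintegral_mono fun x => ENNReal.rpow_add_le_mul_rpow_add_rpow _ _ (by linarith)
      _ = 2 ^ (q - 1) * ((∫⁻ x, ‖u x‖ₑ ^ q) + ∫⁻ x, ‖v x‖ₑ ^ q) := by
          rw [lintegral_const_mul' _ _ h2t, lintegral_add_left' (hu.1.enorm.pow_const q)]
      _ ≤ _ := by gcongr; exact hv v hvm hN
  obtain ⟨M₁, hM₁, k1⟩ := key q₁ h1 h2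
  obtain ⟨M₂, hM₂, k2⟩ := key q₂ h3 h4
  set T := K₁ * (M₁ ^ b₁ * M₁ ^ b₁) + K₂ * (M₂ ^ b₂ * M₂ ^ b₂) with hT
  have t1 : M₁ ^ b₁ ≠ ∞ := ENNReal.rpow_ne_top_of_nonneg h5.le hM₁
  have t2 : M₂ ^ b₂ ≠ ∞ := ENNReal.rpow_ne_top_of_nonneg h6.le hM₂
  have hTt : T ≠ ∞ := ENNReal.add_ne_top.2 ⟨ENNReal.mul_ne_top h7 (ENNReal.mul_ne_top t1 t1),
    ENNReal.mul_ne_top h8 (ENNReal.mul_ne_top t2 t2)⟩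
  refine ⟨T.toReal, fun v hv hN => ?_⟩
  rw [← toReal_enorm]
  refine ENNReal.toReal_mono hTt ((enorm_integral_le_lintegral_enorm _).trans
    ((lintegral_choquard_le (by linarith) hu.1 hv).trans ?_))
  have hm1 : AEMeasurable (fun x => ‖u x‖ₑ + ‖v x‖ₑ) volume := hu.1.enorm.add hv.enorm
  refine (H _ _ hm1 hm1).trans ?_
  have := k1 v hv hN
  have := k2 v hv hN
  rw [hT]
  gcongr

end bound

/-! ### Euler–Lagrange equation and symmetric criticality. -/

section eulerLagrange

variable {s m α p : ℝ} {A : R3 → R3}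

/-- The Choquard functional is represented by a radial element of the magnetic space. -/
theorem exists_radial_representative (hs : 0 < s) (hs' : s < 1) (hm : 0 < m) (hα : 0 < α) (hα' : α < 3)
    (hp : 1 + α / 3 < p) (hp' : p < (3 + α) / (3 - 2 * s)) (hA : Continuous A)
    (hinv : InvarianceCondition A) {u : R3 → ℂ} (hu : u ∈ HsARad s m A) :
    ∃ w ∈ radSpace (s := s) hm hA, ∀ e ∈ magSpace (s := s) hm hA, inner ℂ e w =
      ∫ x, (choquardWeight α p u x : ℂ) * u x * (starRingEnd ℂ) ((e.snd : R3 → ℂ) x) := by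
  set L : (R3 → ℂ) → ℂ := fun v => ∫ x, (choquardWeight α p u x : ℂ) * u x * (starRingEnd ℂ) (v x)
    with hL
  have hcongr : ∀ {v v' : R3 → ℂ}, v =ᵐ[volume] v' → L v = L v' := fun h => by
    refine integral_congr_ae ?_
    filter_upwards [h] with x hx
    rw [hx]
  have hint : ∀ e ∈ magSpace (s := s) hm hA, Integrable (fun x => (choquardWeight α p u x : ℂ) * u x *
      (starRingEnd ℂ) ((e.snd : R3 → ℂ) x)) volume := fun e he =>
    integrable_choquard hs hs' hm hα hα' hp hp' hA hu.1.1 he.2.1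
  obtain ⟨M, hM⟩ := exists_integral_choquard_le hs hs' hm hα hα' hp hp' hA hu.1.1
  -- The Choquard pairing is conjugate-linear in $v$; its conjugate is linear and can be
  -- represented.
  obtain ⟨w, hw, hrep⟩ := exists_inner_eq (isClosed_magSpace (s := s) hs hs' hm hA)
    (l := fun e => (starRingEnd ℂ) (L e.snd)) (M := M)
    (fun e he f hf => by
      rw [← map_add, hcongr (snd_add_ae hm e f)]
      simp only [hL, Pi.add_apply, map_add, mul_add]
      rw [integral_add (hint e he) (hint f hf), map_add])
    (fun c e _ => by
      rw [hcongr (snd_smul_ae hm c e)]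
      simp only [hL, Pi.smul_apply, smul_eq_mul, map_mul]
      simp only [mul_left_comm _ ((starRingEnd ℂ) c)]
      rw [integral_const_mul, map_mul, Complex.conj_conj])
    (fun e he h1 => by
      rw [RCLike.norm_conj]
      refine hM _ (aestronglyMeasurable_snd hm e) ?_
      rw [he.1.normSq_snd hs hs' hm hA]
      refine pow_le_one₀ zero_le ?_
      rw [← ofReal_norm]
      exact ENNReal.ofReal_le_one.2 h1)
  have hrep' : ∀ e ∈ magSpace (s := s) hm hA, inner ℂ e w = L e.snd := fun e he => by
    rw [← inner_conj_symm, hrep e he, Complex.conj_conj]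
  refine ⟨w, ⟨hw, fun g => ?_⟩, hrep'⟩
  have hwg := HsA_comp hinv g hw.2
  set w' := embed hs hs' hm hA _ hwg.1 with hw'
  have hw'X : w' ∈ magSpace (s := s) hm hA := embed_mem_magSpace hs hs' hm hA hwg
  have hsnd : (w'.snd : R3 → ℂ) =ᵐ[volume] fun x => (w.snd : R3 → ℂ) (g x) :=
    embed_snd hs hs' hm hA hwg.1
  have hnorm : ‖w'‖ = ‖w‖ := by
    have h1 : ‖w'‖ₑ ^ 2 = ‖w‖ₑ ^ 2 := by
      rw [hw', enorm_embed, normSq_comp s m hinv, hw.1.normSq_snd hs hs' hm hA]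
    have h2 := congrArg ENNReal.toReal h1
    rw [ENNReal.toReal_pow, ENNReal.toReal_pow, toReal_enorm, toReal_enorm] at h2
    exact (pow_left_inj₀ (norm_nonneg _) (norm_nonneg _) two_ne_zero).1 h2
  -- It is enough to test with $w$ and $w'=w\circ g$: the pairing is rotation invariant because $u$
  -- is radial, so $\langle w',w\rangle=\|w\|^2$. With $\|w'\|=\|w\|$ this gives $\|w'-w\|=0$.
  have hinner : inner ℂ w' w = inner ℂ w w := by
    rw [hrep' w' hw'X, hrep' w hw, hcongr hsnd]
    exact integral_choquard_comp α p hu.2 g _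
  have hzero : w' = w := by
    have h1 := norm_sub_sq (𝕜 := ℂ) w' w
    rw [hinner, inner_self_eq_norm_sq, hnorm] at h1
    have h2 : ‖w' - w‖ ^ 2 = 0 := by rw [h1]; ring
    exact sub_eq_zero.1 (norm_eq_zero.1 (pow_eq_zero_iff two_ne_zero |>.1 h2))
  exact hsnd.symm.trans (by rw [hzero])

/-- The Euler-Lagrange equation of a minimizer, tested with radial functions. -/
theorem scalarProduct_eq_of_radial (hs : 0 < s) (hs' : s < 1) (hm : 0 < m) (hα : 0 < α) (hα' : α < 3)
    (hp : 1 + α / 3 < p) (hp' : p < (3 + α) / (3 - 2 * s)) (hA : Continuous A) {u v : R3 → ℂ}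
    (hu : u ∈ HsARad s m A) (hne : ¬ u =ᵐ[volume] 0)
    (hmin : functionalG s m α p A u = tauRad s m α p A) (hv : v ∈ HsARad s m A) :
    (inner ℂ (embed hs hs' hm hA u hu.1.1) (embed hs hs' hm hA v hv.1.1)).re =
      (normSq s m A u).toReal / (functionalD α p u).toReal *
        (∫ x, (choquardWeight α p u x : ℂ) * u x * (starRingEnd ℂ) (v x)).re := by
  have hp0 : 0 < p := by linarith
  set e := embed hs hs' hm hA u hu.1.1 with he
  set f := embed hs hs' hm hA v hv.1.1 with hf
  set τ := tauRad s m α p A with hτ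
  have hDder := hasDerivAt_functionalD hs hs' hm hα hα' hp hp' hA hu.1.1 hv.1.1
  set I := (∫ x, (choquardWeight α p u x : ℂ) * u x * (starRingEnd ℂ) (v x)).re with hI
  set D : ℝ → ℝ := fun t => (functionalD α p (u + (t : ℂ) • v)).toReal with hD
  have hD0 : D 0 = (functionalD α p u).toReal := by simp [hD]
  have hDpos : 0 < D 0 := by
    rw [hD0]
    exact ENNReal.toReal_pos (functionalD_pos hα hα' hp0 hu.1.1.1 hne).ne'
      (functionalD_lt_top hs hs' hm hα hα' hp hp' hA hu.1.1).ne
  have hnormSq : ∀ t : ℝ, normSq s m A (u + (t : ℂ) • v) = ‖e + (t : ℂ) • f‖ₑ ^ 2 := fun t => by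
    rw [← ((isGraph_embed hs hs' hm hA hu.1.1).add hm
      ((isGraph_embed hs hs' hm hA hv.1.1).smul hm (t : ℂ))).normSq_snd hs hs' hm hA]
    refine normSq_congr s m A ?_
    filter_upwards [snd_add_ae hm e ((t : ℂ) • f), snd_smul_ae hm (t : ℂ) f,
      embed_snd hs hs' hm hA hu.1.1, embed_snd hs hs' hm hA hv.1.1] with x h1 h2 h3 h4
    rw [h1, Pi.add_apply, Pi.add_apply, h2, Pi.smul_apply, Pi.smul_apply, h3, h4]
  -- Multiplying out the quotient gives an inequality that also holds when $u+tv=0$, where the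
  -- quotient itself is not admissible.
  have hle : ∀ t : ℝ, τ.toReal * D t ^ (1 / p) ≤ ‖e + (t : ℂ) • f‖ ^ 2 := by
    intro t
    by_cases h0 : u + (t : ℂ) • v =ᵐ[volume] 0
    · have h1 : functionalD α p (u + (t : ℂ) • v) = 0 := by
        rw [functionalD_congr α p h0]
        simp [functionalD, ENNReal.zero_rpow_of_pos hp0]
      simp only [hD, h1, ENNReal.toReal_zero]
      rw [Real.zero_rpow (by positivity), mul_zero]
      positivity
    · have hmem : u + (t : ℂ) • v ∈ HsARad s m A :=
        ⟨HsA_add hA hu.1 (HsA_smul _ hv.1), hu.2.add (hv.2.smul _)⟩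
      have h1 := ENNReal.mul_le_of_le_div (tauRad_le s m α p A hmem h0)
      rw [hnormSq] at h1
      have h2 := ENNReal.toReal_mono (by simp) h1
      rwa [ENNReal.toReal_mul, ← ENNReal.toReal_rpow, ENNReal.toReal_pow, toReal_enorm] at h2
  have heq : τ.toReal * D 0 ^ (1 / p) = ‖e‖ ^ 2 := by
    have hDp : functionalD α p u ^ (1 / p) ≠ 0 := by
      rw [Ne, ENNReal.rpow_eq_zero_iff_of_pos (by positivity)]
      exact (functionalD_pos hα hα' hp0 hu.1.1.1 hne).ne'
    have hDp' : functionalD α p u ^ (1 / p) ≠ ∞ := ENNReal.rpow_ne_top_of_nonneg (by positivity)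
      (functionalD_lt_top hs hs' hm hα hα' hp hp' hA hu.1.1).ne
    have h1 : τ * functionalD α p u ^ (1 / p) = ‖e‖ₑ ^ 2 := by
      rw [← hmin, functionalG, ENNReal.div_mul_cancel hDp hDp', he, enorm_embed]
    have h2 := congrArg ENNReal.toReal h1
    rwa [ENNReal.toReal_mul, ← ENNReal.toReal_rpow, ENNReal.toReal_pow, toReal_enorm, ← hD0] at h2
  have hN : ∀ t : ℝ, ‖e + (t : ℂ) • f‖ ^ 2 = ‖e‖ ^ 2 + 2 * t * (inner ℂ e f).re + t ^ 2 * ‖f‖ ^ 2 := by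
    intro t
    rw [norm_add_sq (𝕜 := ℂ), inner_smul_right, norm_smul, Complex.norm_real, mul_pow,
      Real.norm_eq_abs, sq_abs]
    simp only [RCLike.re_to_complex, Complex.re_ofReal_mul]
    ring
  have hNder : HasDerivAt (fun t : ℝ => ‖e + (t : ℂ) • f‖ ^ 2) (2 * (inner ℂ e f).re) 0 := by
    simp only [hN]
    have h1 := (((hasDerivAt_id (0 : ℝ)).const_mul 2).mul_const (inner ℂ e f).re).const_add (‖e‖ ^ 2)
    have h2 := ((hasDerivAt_id (0 : ℝ)).pow 2).mul_const (‖f‖ ^ 2)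
    refine (h1.add h2).congr_deriv ?_
    simp
  have hPder := (hDder.rpow_const (p := 1 / p) (Or.inl hDpos.ne')).const_mul τ.toReal
  -- The difference is nonnegative and vanishes at $t=0$, so its derivative there is zero.
  have hmin0 : IsLocalMin (fun t : ℝ => ‖e + (t : ℂ) • f‖ ^ 2 - τ.toReal * D t ^ (1 / p)) 0 := by
    refine Eventually.of_forall fun t => ?_
    have h1 := hle t
    simp only [Complex.ofReal_zero, zero_smul, add_zero]
    rw [heq]
    linarith
  have hfinal := hmin0.hasDerivAt_eq_zero (hNder.sub hPder)
  have hNs : (normSq s m A u).toReal = ‖e‖ ^ 2 := by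
    rw [← enorm_embed hs hs' hm hA hu.1.1, ENNReal.toReal_pow, toReal_enorm]
  have hpow : D 0 ^ (1 / p - 1) = D 0 ^ (1 / p) / D 0 := by
    rw [Real.rpow_sub_one hDpos.ne']
  rw [hNs, ← hD0, ← heq]
  change 2 * (inner ℂ e f).re - τ.toReal * (2 * p * I * (1 / p) * D 0 ^ (1 / p - 1)) = 0 at hfinal
  rw [hpow] at hfinal
  field_simp at hfinal ⊢
  linarith

theorem scalarProduct_congr (s m : ℝ) (A : R3 → R3) {u u' v v' : R3 → ℂ} (hu : u =ᵐ[volume] u')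
    (hv : v =ᵐ[volume] v') : scalarProduct s m A u v = scalarProduct s m A u' v' := by
  have h1 : ∫ z : R3 × R3, magDiff A u z.1 z.2 * (starRingEnd ℂ) (magDiff A v z.1 z.2) *
      ((kernel s m (z.1 - z.2) : ℝ) : ℂ) = ∫ z : R3 × R3, magDiff A u' z.1 z.2 *
      (starRingEnd ℂ) (magDiff A v' z.1 z.2) * ((kernel s m (z.1 - z.2) : ℝ) : ℂ) := by
    refine integral_congr_ae ?_
    filter_upwards [magDiff_congr A hu, magDiff_congr A hv] with z h1 h2
    rw [h1, h2]
  have h2 : ∫ x : R3, u x * (starRingEnd ℂ) (v x) = ∫ x : R3, u' x * (starRingEnd ℂ) (v' x) := by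
    refine integral_congr_ae ?_
    filter_upwards [hu, hv] with x h1 h2
    rw [h1, h2]
  rw [scalarProduct, scalarProduct, h1, h2]

/-- An element of a graph is determined by its function. -/
theorem IsGraph.ext (hs : 0 < s) (hs' : s < 1) (hm : 0 < m) (hA : Continuous A) {e f : Ambient s m}
    (he : IsGraph s m A e) (hf : IsGraph s m A f) (h : (e.snd : R3 → ℂ) =ᵐ[volume] f.snd) : e = f := by
  have h1 := (he.sub hm hf).normSq_snd hs hs' hm hA
  have h2 : ((e - f).snd : R3 → ℂ) =ᵐ[volume] 0 := by
    filter_upwards [snd_sub_ae hm e f, h] with x h3 h4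
    rw [h3, Pi.sub_apply, h4, sub_self, Pi.zero_apply]
  have h3 : normSq s m A (0 : R3 → ℂ) = 0 := by simp [normSq, magDiff]
  rw [normSq_congr s m A h2, h3] at h1
  have h4 : ‖e - f‖ₑ = 0 := by simpa using h1.symm
  exact sub_eq_zero.1 (enorm_eq_zero.1 h4)

/-- The principle of symmetric criticality for minimizers. -/
theorem scalarProduct_eq (hs : 0 < s) (hs' : s < 1) (hm : 0 < m) (hα : 0 < α) (hα' : α < 3)
    (hp : 1 + α / 3 < p) (hp' : p < (3 + α) / (3 - 2 * s)) (hA : Continuous A)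
    (hinv : InvarianceCondition A) {u v : R3 → ℂ}
    (hu : u ∈ HsARad s m A) (hne : ¬ u =ᵐ[volume] 0)
    (hmin : functionalG s m α p A u = tauRad s m α p A) (hv : v ∈ HsA s m A) :
    scalarProduct s m A u v =
      (normSq s m A u).toReal / (functionalD α p u).toReal *
        (∫ x, (choquardWeight α p u x : ℂ) * u x * (starRingEnd ℂ) (v x)).re := by
  obtain ⟨w, hw, hrep⟩ := exists_radial_representative hs hs' hm hα hα' hp hp' hA hinv hu
  set c := (normSq s m A u).toReal / (functionalD α p u).toReal with hc
  set e := embed hs hs' hm hA u hu.1.1 with he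
  have heR : e ∈ radSpace (s := s) hm hA := embed_mem_radSpace hs hs' hm hA hu
  have hortho : ∀ f ∈ radSpace (s := s) hm hA, (inner ℂ f (e - (c : ℂ) • w)).re = 0 := by
    intro f hf
    have h1 := scalarProduct_eq_of_radial hs hs' hm hα hα' hp hp' hA hu hne hmin ⟨hf.1.2, hf.2⟩
    have h2 : embed hs hs' hm hA (f.snd : R3 → ℂ) hf.1.2.1 = f :=
      (isGraph_embed hs hs' hm hA hf.1.2.1).ext hs hs' hm hA hf.1.1 (embed_snd hs hs' hm hA hf.1.2.1)
    rw [h2, ← hrep f hf.1] at h1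
    rw [inner_sub_right, inner_smul_right, Complex.sub_re, Complex.re_ofReal_mul, ← h1,
      ← inner_conj_symm f e, Complex.conj_re, sub_self]
  -- Both vectors are radial, so their difference is an admissible test vector for `hortho`; the
  -- relation $e=cw$ can then be paired with any, not necessarily radial, $v$.
  have hzero : e = (c : ℂ) • w := by
    have h1 := hortho _ (Submodule.sub_mem _ heR (Submodule.smul_mem _ (c : ℂ) hw))
    have h2 : ‖e - (c : ℂ) • w‖ ^ 2 = 0 := by
      rw [← inner_self_eq_norm_sq (𝕜 := ℂ)]; exact h1
    exact sub_eq_zero.1 (norm_eq_zero.1 (pow_eq_zero_iff two_ne_zero |>.1 h2))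
  have hvX := embed_mem_magSpace hs hs' hm hA hv
  have h3 := re_inner_eq_scalarProduct hs hs' hm (isGraph_embed hs hs' hm hA hu.1.1)
    (isGraph_embed hs hs' hm hA hv.1)
  rw [scalarProduct_congr s m A (embed_snd hs hs' hm hA hu.1.1) (embed_snd hs hs' hm hA hv.1)] at h3
  rw [← h3, ← he, hzero, inner_smul_right, hrep _ hvX, Complex.re_ofReal_mul]
  congr 2
  refine integral_congr_ae ?_
  filter_upwards [embed_snd hs hs' hm hA hv.1] with x hx
  rw [hx]

end eulerLagrange

/-! ### Rescaling a minimizer to a weak solution. -/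

section solution

variable {s m α p : ℝ} {A : R3 → R3}

theorem scalarProduct_real_smul (s m : ℝ) (A : R3 → R3) (t : ℝ) (u v : R3 → ℂ) :
    scalarProduct s m A ((t : ℂ) • u) v = t * scalarProduct s m A u v := by
  simp only [scalarProduct, magDiff_smul, Pi.smul_apply, smul_eq_mul, mul_assoc (t : ℂ)]
  rw [integral_const_mul, integral_const_mul, Complex.re_ofReal_mul, Complex.re_ofReal_mul]
  ring

/-- The potential contributes $t^p$, the power $t^{p-2}$ and the function $t$, so the nonlinearity
has degree $2p-1$. -/
theorem choquard_real_smul (α : ℝ) (hp : 0 < p) {t : ℝ} (ht : 0 < t) (u : R3 → ℂ) (x : R3) :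
    (choquardWeight α p ((t : ℂ) • u) x : ℂ) * ((t : ℂ) • u) x =
      ((t * t ^ (2 * p - 2) : ℝ) : ℂ) * ((choquardWeight α p u x : ℂ) * u x) := by
  have h1 : rieszConv α p ((t : ℂ) • u) x = ‖(t : ℂ)‖ₑ ^ p * rieszConv α p u x :=
    rieszConv_smul α hp (t : ℂ) u x
  have h2 : choquardWeight α p ((t : ℂ) • u) x = t ^ (2 * p - 2) * choquardWeight α p u x := by
    rw [choquardWeight, choquardWeight, h1, ENNReal.toReal_mul, ← ENNReal.toReal_rpow, toReal_enorm,
      Complex.norm_real, Real.norm_of_nonneg ht.le, Pi.smul_apply, norm_smul, Complex.norm_real,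
      Real.norm_of_nonneg ht.le, Real.mul_rpow ht.le (norm_nonneg _),
      show 2 * p - 2 = p + (p - 2) by ring, Real.rpow_add ht]
    ring
  rw [h2, Pi.smul_apply, smul_eq_mul]
  push_cast
  ring

/-- A multiple of a minimizer is a weak solution. -/
theorem exists_weakSolution (hs : 0 < s) (hs' : s < 1) (hm : 0 < m) (hα : 0 < α) (hα' : α < 3)
    (hp : 1 + α / 3 < p) (hp' : p < (3 + α) / (3 - 2 * s)) (hA : Continuous A)
    (hinv : InvarianceCondition A) {u : R3 → ℂ}
    (hu : u ∈ HsARad s m A) (hne : ¬ u =ᵐ[volume] 0)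
    (hmin : functionalG s m α p A u = tauRad s m α p A) :
    ∃ t : ℝ, 0 < t ∧ (t : ℂ) • u ∈ HsARad s m A ∧ IsWeakSolution s m α p A ((t : ℂ) • u) := by
  have hp0 : 0 < p := by linarith
  have hD : 0 < (functionalD α p u).toReal :=
    ENNReal.toReal_pos (functionalD_pos hα hα' hp0 hu.1.1.1 hne).ne'
      (functionalD_lt_top hs hs' hm hα hα' hp hp' hA hu.1.1).ne
  have hN : 0 < (normSq s m A u).toReal :=
    ENNReal.toReal_pos (normSq_pos hm hu.1.1.1 hne).ne' hu.1.1.2.ne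
  set c := (normSq s m A u).toReal / (functionalD α p u).toReal with hc
  have hc0 : 0 < c := div_pos hN hD
  -- The left side scales by $t$ and the right side by $t\cdot t^{2p-2}$, so $t^{2p-2}=c$ cancels
  -- the multiplier; $p>1$ makes the exponent nonzero.
  set t := c ^ (2 * p - 2)⁻¹ with ht
  have ht0 : 0 < t := Real.rpow_pos_of_pos hc0 _
  have htc : t ^ (2 * p - 2) = c := Real.rpow_inv_rpow hc0.le (by linarith)
  have htu : (t : ℂ) • u ∈ HsARad s m A := HsARad_smul _ hu
  refine ⟨t, ht0, htu, htu.1, ae_rieszConv_lt_top hs hs' hm hα hα' hp hp' hA htu.1.1, fun v hv =>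
    ⟨integrable_choquard hs hs' hm hα hα' hp hp' hA htu.1.1 hv.1, ?_⟩⟩
  change _ = (∫ x, (choquardWeight α p ((t : ℂ) • u) x : ℂ) * ((t : ℂ) • u) x *
    (starRingEnd ℂ) (v x)).re
  simp only [choquard_real_smul α hp0 ht0, mul_assoc (((t * t ^ (2 * p - 2) : ℝ) : ℂ))]
  rw [integral_const_mul, Complex.re_ofReal_mul, htc, scalarProduct_real_smul,
    scalarProduct_eq hs hs' hm hα hα' hp hp' hA hinv hu hne hmin hv, mul_assoc]

end solution

end MagneticChoquard

end

open MagneticChoquard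

theorem mainTheorem7 (s m α p : ℝ) (hs : 0 < s) (hs' : s < 1) (hm : 0 < m)
    (hα : 0 < α) (hα' : α < 3)
    (hp : 1 + α / 3 < p) (hp' : p < (3 + α) / (3 - 2 * s))
    (A : R3 → R3) (hA : HasLocallyBoundedGradient A) (hinv : InvarianceCondition A) :
    (0 < tauRad s m α p A ∧ tauRad s m α p A < ⊤) ∧
    (∃ u ∈ HsARad s m A, ¬ u =ᵐ[MeasureTheory.volume] 0 ∧ functionalD α p u = 1 ∧
      functionalG s m α p A u = tauRad s m α p A) ∧
    (∀ u ∈ HsARad s m A, ¬ u =ᵐ[MeasureTheory.volume] 0 →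
      functionalG s m α p A u = tauRad s m α p A →
      ∃ t : ℝ, 0 < t ∧ (fun x => (t : ℂ) * u x) ∈ HsARad s m A ∧
        IsWeakSolution s m α p A (fun x => (t : ℂ) * u x)) := by
  have hA' := hA.continuous
  refine ⟨⟨tauRad_pos hs hs' hm hα hα' hp hp' hA', tauRad_lt_top hs hs' hm hα hα' hp hp' hA'⟩,
    ?_, fun u hu hne hmin => exists_weakSolution hs hs' hm hα hα' hp hp' hA' hinv hu hne hmin⟩
  obtain ⟨u, hu, hD, hN⟩ := exists_minimizer hs hs' hm hα hα' hp hp' hA'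
  refine ⟨u, hu, ne_zero_of_functionalD (α := α) (p := p) (by linarith) (by rw [hD]; exact one_ne_zero),
    hD, ?_⟩
  rw [functionalG, hD, ENNReal.one_rpow, div_one, hN]
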